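/- Let $\pi$ be a probability distribution on $\{0,1,2,\dots\}$ with mean $m=\sum_k k\pi_k\in(0,\infty)$. The Eternal Galton--Watson Tree $\mathrm{EGW}(\pi)$ is the following random ordered rooted tree $[\boldsymbol T,\boldsymbol o]$. Start from a path $\boldsymbol o_0,\boldsymbol o_1,\boldsymbol o_2,\dots$ in which $\boldsymbol o_i$ is the parent $F(\boldsymbol o_{i-1})$ of $\boldsymbol o_{i-1}$ for all $i\ge 1$. Independently for $i\ge1$, give $\boldsymbol o_i$ a total of $z_i$ children, where $\mathbb P(z_i=k)=k\pi_k/m$, namely $\boldsymbol o_{i-1}$ and $z_i-1$ new vertices, in uniformly random order. Then $\boldsymbol o_0$ and all the new vertices generate independent ordinary Galton--Watson trees with offspring distribution $\pi$. The root is $\boldsymbol o=\boldsymbol o_0$. The non-ordered tree is obtained by forgetting the order. In a tree in which every vertex $v$ has a parent $F(v)$, let $D(v)=\{w:\exists n\ge 0,\ F^n(w)=v\}$ be the set of descendants of $v$, and $L(v)=\{w:\exists n\geq 0,\ F^n(w)=F^n(v)\}$ the generation (foil) of $v$. A generation $L$ is youngest if $F^{-1}(L)=\emptyset$. Let $F^\infty$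 be the set of vertices that have descendants of every order. A bi-infinite $F$-path is $(v_n)_{n\in\mathbb Z}$ with $F(v_n)=v_{n+1}$, up to a shift of the index. An end is a class of semi-infinite simple undirected paths, two of them being equivalent if they have infinitely many common vertices. A random rooted tree is unimodular if it satisfies the mass transport principle $\mathbb E\sum_v g[\boldsymbol T,\boldsymbol o,v]=\mathbb E\sum_v g[\boldsymbol T,v,\boldsymbol o]$ for every non-negative measurable function $g$ of the isomorphism class of a tree with two distinguished vertices. The tree is of class $\mathcal I/\mathcal I$ if it and all its generations are infinite, and moreover it has one end and no bi-infinite $F$-path, every $D(v)$ is finite, and $F^\infty=\emptyset$. It is of class $\mathcal I/\mathcal F$ if it is infinite and all its generations are finite, and moreover it has a unique bi-infinite $F$-path, this path has exactly one vertex in every generation, its vertex set is $F^\infty$, and there is no youngest generation. 1. If $m=1$, then $\mathrm{EGW}(\pi)$ is unimodular, both as an ordered and as a non-ordered tree. If moreover $\pi_1\neq1$, then almost surely it is of class $\mathcal I/\mathcal I$ and there is no youngest generation. If $\pi_1=1$, then almost surely it is of class $\mathcal I/\mathcal F$ and each generation has only one vertex. 2. If $m>1$, then almost surely all generations are infinite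 and there is no youngest generation. Moreover, $\mathbb P(\#D(\boldsymbol o)=\infty)>0$ and, almost surely, there are uncountably many bi-infinite $F$-paths and the tree has uncountably many ends. 3. If $m<1$, then almost surely $D(v)$ is finite for every vertex $v$ and the tree has exactly one end. Moreover, all generations are finite almost surely if and only if $\sum_{k\ge1}(k\log k)\pi_k<\infty$, and all generations are infinite almost surely if and only if this sum is infinite. Also, $\mathbb E[\#L(\boldsymbol o)]<\infty$ if and only if $\pi$ has finite variance. -/

import Mathlib

open MeasureTheory ProbabilityTheory Set
open scoped ENNReal

noncomputable section

/-- A locally finite Eternal Family Tree whose vertices carry marks in `M`: a directed tree in which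
every vertex `v` has exactly one outgoing edge, to `parent v`.  A functional graph is a directed
tree iff any two vertices have a common ancestor and there is no directed cycle.

`EFT Unit` is the type of (non-ordered) trees.  An ordered tree is an element of `EFT ℕ`, the
mark of a vertex being its rank (starting at `0`) among its siblings. -/
structure EFT (M : Type) where
  V : Type
  parent : V → V
  mark : V → M
  confluent : ∀ v w : V, ∃ m n : ℕ, parent^[m] v = parent^[n] w
  acyclic : ∀ (v : V) (n : ℕ), parent^[n + 1] v ≠ v
  locallyFinite : ∀ v : V, {w | parent w = v}.Finite

namespace EFT

variable {M : Type} (T : EFT M)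

/-- Forget the marks (in the ordered case: the order). -/
def forget : EFT Unit where
  V := T.V
  parent := T.parent
  mark := fun _ => ()
  confluent := T.confluent
  acyclic := T.acyclic
  locallyFinite := T.locallyFinite

/-- The underlying undirected graph. -/
def graph : SimpleGraph T.V := SimpleGraph.fromRel (fun v w => T.parent v = w)

/-- The vertex set of the tree of descendants of `v` (which contains `v`). -/
def descendants (v : T.V) : Set T.V := {w | ∃ n : ℕ, T.parent^[n] w = v}

/-- The generation (foil) of `v`. -/
def generation (v : T.V) : Set T.V := {w | ∃ n : ℕ, T.parent^[n] v = T.parent^[n] w}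

/-- There is a youngest generation: a generation none of whose vertices has a child. -/
def HasYoungestGeneration : Prop := ∃ v : T.V, T.parent ⁻¹' T.generation v = ∅

/-- The vertices which have descendants of every order. -/
def eternalVertices : Set T.V := {v | ∀ n : ℕ, ∃ w, T.parent^[n] w = v}

/-- The bi-infinite directed paths, each represented by its set of vertices (which determines the
path up to a shift of its parametrization). -/
def biInfinitePaths : Set (Set T.V) :=
  {S | ∃ p : ℤ → T.V, (∀ n, T.parent (p n) = p (n + 1)) ∧ S = range p}

/-- Rays: simple semi-infinite paths of the undirected tree. -/
structure Ray where
  toFun : ℕ → T.V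
  injective : Function.Injective toFun
  adj : ∀ n, T.graph.Adj (toFun n) (toFun (n + 1))

/-- Ends: classes of rays, two rays being equivalent when they have infinitely many
common vertices. -/
def Ends : Type := Quot (fun r s : T.Ray => (range r.toFun ∩ range s.toFun).Infinite)

/-- The tree has exactly one end. -/
def OneEnded : Prop := Nat.card T.Ends = 1

/-- Class `I/F`: the tree is infinite and all its generations are finite; there is a unique
bi-infinite directed path, it meets every generation in exactly one vertex and consists of the
vertices with descendants of all orders; there is no youngest generation. -/
structure IsClassIF : Prop where
  infinite : Infinite T.V
  generation_finite : ∀ v, (T.generation v).Finite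
  path : ∃ S : Set T.V, T.biInfinitePaths = {S} ∧ (∀ v, ∃! w, w ∈ T.generation v ∩ S) ∧
    T.eternalVertices = S
  no_youngest : ¬ T.HasYoungestGeneration

/-- Class `I/I`: the tree and all its generations are infinite; it has one end, no bi-infinite
directed path, all descendant trees are finite, and no vertex has descendants of all orders. -/
structure IsClassII : Prop where
  infinite : Infinite T.V
  generation_infinite : ∀ v, (T.generation v).Infinite
  oneEnded : T.OneEnded
  no_path : T.biInfinitePaths = ∅
  descendants_finite : ∀ v, (T.descendants v).Finite
  no_eternal : T.eternalVertices = ∅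

end EFT

/-- A rooted Eternal Family Tree `(T, o)`. -/
structure RootedEFT (M : Type) extends EFT M where
  root : V

/-- An Eternal Family Tree with a pair of distinguished vertices `(T, o, v)`. -/
structure BirootedEFT (M : Type) extends RootedEFT M where
  second : V

namespace EFT

variable {M : Type}

/-- The rooted tree `(T, o)`. -/
def withRoot (T : EFT M) (o : T.V) : RootedEFT M := { T with root := o }

/-- The doubly rooted tree `(T, o, v)`. -/
def withRoots (T : EFT M) (o v : T.V) : BirootedEFT M := { T with root := o, second := v }

/-- `φ` is an isomorphism of (marked, directed) trees. -/
structure IsIso {T S : EFT M} (φ : T.V ≃ S.V) : Prop where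
  parent : ∀ v, φ (T.parent v) = S.parent (φ v)
  mark : ∀ v, S.mark (φ v) = T.mark v

end EFT

instance RootedEFT.setoid (M : Type) : Setoid (RootedEFT M) where
  r T S := ∃ φ : T.V ≃ S.V, EFT.IsIso (T := T.toEFT) (S := S.toEFT) φ ∧ φ T.root = S.root
  iseqv := {
    refl := fun _ => ⟨Equiv.refl _, ⟨fun _ => rfl, fun _ => rfl⟩, rfl⟩
    symm := fun {T S} ⟨φ, h, h'⟩ => ⟨φ.symm,
      ⟨fun v => by rw [Equiv.symm_apply_eq, h.parent, Equiv.apply_symm_apply],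
        fun v => by rw [← h.mark, Equiv.apply_symm_apply]⟩,
      by rw [Equiv.symm_apply_eq, h']⟩
    trans := fun ⟨φ, h, h'⟩ ⟨ψ, k, k'⟩ => ⟨φ.trans ψ,
      ⟨fun v => by simp [h.parent, k.parent], fun v => by simp [h.mark, k.mark]⟩,
      by simp [h', k']⟩ }

instance BirootedEFT.setoid (M : Type) : Setoid (BirootedEFT M) where
  r T S := ∃ φ : T.V ≃ S.V, EFT.IsIso (T := T.toEFT) (S := S.toEFT) φ ∧
    φ T.root = S.root ∧ φ T.second = S.second
  iseqv := {
    refl := fun _ => ⟨Equiv.refl _, ⟨fun _ => rfl, fun _ => rfl⟩, rfl, rfl⟩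
    symm := fun {T S} ⟨φ, h, h', h''⟩ => ⟨φ.symm,
      ⟨fun v => by rw [Equiv.symm_apply_eq, h.parent, Equiv.apply_symm_apply],
        fun v => by rw [← h.mark, Equiv.apply_symm_apply]⟩,
      by rw [Equiv.symm_apply_eq, h'], by rw [Equiv.symm_apply_eq, h'']⟩
    trans := fun ⟨φ, h, h', h''⟩ ⟨ψ, k, k', k''⟩ => ⟨φ.trans ψ,
      ⟨fun v => by simp [h.parent, k.parent], fun v => by simp [h.mark, k.mark]⟩,
      by simp [h', k'], by simp [h'', k'']⟩ }

/-- Isomorphism classes of rooted Eternal Family Trees. -/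
def EFTStar (M : Type) : Type 1 := Quotient (RootedEFT.setoid M)

/-- Isomorphism classes of Eternal Family Trees with two distinguished vertices. -/
def EFTStarStar (M : Type) : Type 1 := Quotient (BirootedEFT.setoid M)

/-- The isomorphism class `[T, o]`. -/
def EFTStar.mk {M : Type} (T : RootedEFT M) : EFTStar M := Quotient.mk _ T

/-- The isomorphism class `[T, o, v]`. -/
def EFTStarStar.mk {M : Type} (T : BirootedEFT M) : EFTStarStar M := Quotient.mk _ T

/-- The closed ball of radius `r` around the root, for the graph distance. -/
def RootedEFT.ball {M : Type} (T : RootedEFT M) (r : ℕ) : Set T.V :=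
  {v | T.graph.edist T.root v ≤ (r : ℕ∞)}

/-- `φ` is an isomorphism (of rooted, marked, directed graphs) between the balls of radius `r`
around the roots. -/
structure RootedEFT.IsBallIso {M : Type} {T S : RootedEFT M} {r : ℕ}
    (φ : T.ball r ≃ S.ball r) : Prop where
  root : ∀ v : T.ball r, (v : T.V) = T.root ↔ (φ v : S.V) = S.root
  parent : ∀ v w : T.ball r, T.parent v = w ↔ S.parent (φ v) = φ w
  mark : ∀ v : T.ball r, S.mark (φ v) = T.mark v

/-- The local topology (for discrete marks), generated by the sets of trees whose ball of radius `r`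
around the root is isomorphic to a given one. -/
instance EFTStar.topology (M : Type) : TopologicalSpace (EFTStar M) :=
  TopologicalSpace.generateFrom
    {U | ∃ (r : ℕ) (S : RootedEFT M), U = {x | ∃ T : RootedEFT M, EFTStar.mk T = x ∧
      ∃ φ : T.ball r ≃ S.ball r, RootedEFT.IsBallIso φ}}

/-- The local topology for doubly rooted trees: the ball around the first root has to contain the
second root, and isomorphisms of balls have to respect it. -/
instance EFTStarStar.topology (M : Type) : TopologicalSpace (EFTStarStar M) :=
  TopologicalSpace.generateFrom
    {U | ∃ (r : ℕ) (S : BirootedEFT M), U = {x | ∃ T : BirootedEFT M, EFTStarStar.mk T = x ∧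
      ∃ φ : T.ball r ≃ S.ball r, RootedEFT.IsBallIso φ ∧
        ∃ h : T.second ∈ T.ball r, (φ ⟨T.second, h⟩ : S.V) = S.second}}

instance EFTStar.measurableSpace (M : Type) : MeasurableSpace (EFTStar M) := borel _

instance EFTStarStar.measurableSpace (M : Type) : MeasurableSpace (EFTStarStar M) := borel _

/-- The mass `∑_v g[T, o, v]` sent by the root. -/
def EFTStar.massOut {M : Type} (g : EFTStarStar M → ℝ≥0∞) : EFTStar M → ℝ≥0∞ :=
  Quotient.lift (fun T : RootedEFT M => ∑' v : T.V, g (.mk (T.withRoots T.root v))) (by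
    rintro T S ⟨φ, h, h'⟩
    rw [← Equiv.tsum_eq φ]
    refine tsum_congr fun v => congrArg g (Quotient.sound ⟨φ, h, h', rfl⟩))

/-- The mass `∑_v g[T, v, o]` received by the root. -/
def EFTStar.massIn {M : Type} (g : EFTStarStar M → ℝ≥0∞) : EFTStar M → ℝ≥0∞ :=
  Quotient.lift (fun T : RootedEFT M => ∑' v : T.V, g (.mk (T.withRoots v T.root))) (by
    rintro T S ⟨φ, h, h'⟩
    rw [← Equiv.tsum_eq φ]
    refine tsum_congr fun v => congrArg g (Quotient.sound ⟨φ, h, rfl, h'⟩))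

/-- `X` is a unimodular random Eternal Family Tree: a random element of `EFTStar M` which satisfies
the mass transport principle. -/
structure IsUnimodular {M : Type} {Ω : Type*} [MeasurableSpace Ω] (P : Measure Ω)
    (X : Ω → EFTStar M) : Prop where
  measurable : Measurable X
  mass_transport : ∀ g : EFTStarStar M → ℝ≥0∞, Measurable g →
    ∫⁻ ω, EFTStar.massOut g (X ω) ∂P = ∫⁻ ω, EFTStar.massIn g (X ω) ∂P

namespace EGW

/-- The mean of an offspring distribution. -/
abbrev mean (π : PMF ℕ) : ℝ≥0∞ := ∑' k : ℕ, (k : ℝ≥0∞) * π k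

/-- The size-biased distribution `k ↦ k π(k) / m`. -/
def sizeBiased (π : PMF ℕ) (h0 : mean π ≠ 0) (htop : mean π ≠ ∞) : PMF ℕ :=
  PMF.normalize (fun k : ℕ => (k : ℝ≥0∞) * π k) h0 htop

lemma nonempty_fin_of_mem_support {π : PMF ℕ} {h0 : mean π ≠ 0} {htop : mean π ≠ ∞} {k : ℕ}
    (hk : k ∈ (sizeBiased π h0 htop).support) : Nonempty (Fin k) := by
  rw [sizeBiased, PMF.mem_support_normalize_iff] at hk
  rcases Nat.eq_zero_or_pos k with rfl | h
  · simp at hk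
  · exact ⟨⟨0, h⟩⟩

/-- The law of a pair `⟨z, j⟩`: `z` has the size-biased law and, given `z`, the position `j` is
uniform on `{0, …, z - 1}`. -/
def spineLaw (π : PMF ℕ) (h0 : mean π ≠ 0) (htop : mean π ≠ ∞) : PMF (Σ k : ℕ, Fin k) :=
  (sizeBiased π h0 htop).bindOnSupport fun k hk =>
    haveI := nonempty_fin_of_mem_support hk
    (PMF.uniformOfFintype (Fin k)).map (Sigma.mk k)

/-- The random ingredients of the construction.  For the ancestral path `o₀, o₁, o₂, …`, the first
component gives at `i` the number of children of `oᵢ₊₁` and the position of `oᵢ` among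
them.  The second component gives the numbers of children of all potential vertices outside
`{o₁, o₂, …}`: the address `(i, [jₙ, …, j₁])` stands for the vertex that is reached from `oᵢ` by
passing to its child number `j₁`, …, then to the child number `jₙ` (counted from `0`). -/
abbrev Sample : Type := (ℕ → Σ k : ℕ, Fin k) × (ℕ × List ℕ → ℕ)

/-- The law of the ingredients: all are independent, the first ones with law `spineLaw π`,
the second ones with law `π`. -/
def sampleLaw (π : PMF ℕ) (h0 : mean π ≠ 0) (htop : mean π ≠ ∞) : Measure Sample :=
  (Measure.infinitePi fun _ : ℕ => (spineLaw π h0 htop).toMeasure).prod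
    (Measure.infinitePi fun _ : ℕ × List ℕ => π.toMeasure)

/-- The number of children of the vertex with a given address. -/
def numChildren (d : Sample) : ℕ × List ℕ → ℕ
  | (i + 1, []) => (d.1 i).1
  | x => d.2 x

/-- The child number `j` of the vertex with address `x` is a vertex of the path `o₀, o₁, …`. -/
def IsSpineSlot (d : Sample) : ℕ × List ℕ → ℕ → Prop
  | (i + 1, []), j => j = (d.1 i).2
  | _, _ => False

/-- The addresses of the vertices.  A vertex `oᵢ` of the ancestral path has only the
address `(i, [])`. -/
def IsVertex (d : Sample) (i : ℕ) : List ℕ → Prop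
  | [] => True
  | j :: w => IsVertex d i w ∧ j < numChildren d (i, w) ∧ ¬ IsSpineSlot d (i, w) j

/-- The vertex set. -/
def Vertex (d : Sample) : Type := {x : ℕ × List ℕ // IsVertex d x.1 x.2}

/-- The parent of a vertex. -/
def parent (d : Sample) : Vertex d → Vertex d
  | ⟨(i, []), _⟩ => ⟨(i + 1, []), trivial⟩
  | ⟨(i, _ :: w), h⟩ => ⟨(i, w), h.1⟩

/-- The rank of a vertex among its siblings. -/
def rank (d : Sample) : Vertex d → ℕ
  | ⟨(i, []), _⟩ => (d.1 i).2
  | ⟨(_, j :: _), _⟩ => j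

/-- The vertex `oᵢ`. -/
def spine (d : Sample) (i : ℕ) : Vertex d := ⟨(i, []), trivial⟩

lemma parent_iterate_spine (d : Sample) (i n : ℕ) :
    (parent d)^[n] (spine d i) = spine d (i + n) := by
  induction n with
  | zero => rfl
  | succ n ih => rw [Function.iterate_succ_apply', ih]; rfl

lemma exists_iterate_eq_spine (d : Sample) (v : Vertex d) :
    ∃ n, (parent d)^[n] v = spine d v.1.1 := by
  obtain ⟨⟨i, w⟩, h⟩ := v
  induction w with
  | nil => exact ⟨0, rfl⟩
  | cons j w ih => exact ⟨(ih h.1).choose + 1, (ih h.1).choose_spec⟩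

/-- The generation number of a vertex, increasing towards the ancestors. -/
def level (d : Sample) (v : Vertex d) : ℤ := v.1.1 - v.1.2.length

lemma level_parent (d : Sample) (v : Vertex d) : level d (parent d v) = level d v + 1 := by
  obtain ⟨⟨i, w⟩, h⟩ := v
  cases w with
  | nil => simp [level, parent]
  | cons j w => simp [level, parent]; ring

lemma level_iterate (d : Sample) (v : Vertex d) (n : ℕ) :
    level d ((parent d)^[n] v) = level d v + n := by
  induction n with
  | zero => simp
  | succ n ih => rw [Function.iterate_succ_apply', level_parent, ih]; push_cast; ring

/-- The ordered tree built from the ingredients `d`. -/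
def tree (d : Sample) : EFT ℕ where
  V := Vertex d
  parent := parent d
  mark := rank d
  confluent v w := by
    obtain ⟨m, hm⟩ := exists_iterate_eq_spine d v
    obtain ⟨n, hn⟩ := exists_iterate_eq_spine d w
    refine ⟨w.1.1 + m, v.1.1 + n, ?_⟩
    rw [Function.iterate_add_apply, Function.iterate_add_apply, hm, hn, parent_iterate_spine,
      parent_iterate_spine, add_comm]
  acyclic v n h := by
    have := level_iterate d v (n + 1)
    rw [h] at this
    push_cast at this
    linarith
  locallyFinite v := by
    refine Set.Finite.of_finite_image
      (f := Subtype.val) (Set.Finite.subset (((Set.finite_Iio (numChildren d v.1)).image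
        (fun j => (v.1.1, j :: v.1.2))).union (Set.finite_singleton (v.1.1 - 1, []))) ?_)
      Subtype.val_injective.injOn
    rintro _ ⟨⟨⟨i, w⟩, h⟩, rfl, rfl⟩
    cases w with
    | nil => exact Or.inr rfl
    | cons j w => exact Or.inl ⟨j, h.2.1, rfl⟩

/-- The root `o = o₀`. -/
def root (d : Sample) : (tree d).V := spine d 0

/-- The ordered rooted tree `[T, o]` built from `d`. -/
def ordered (d : Sample) : EFTStar ℕ := .mk ((tree d).withRoot (root d))

/-- The non-ordered rooted tree `[T, o]` built from `d`. -/
def unordered (d : Sample) : EFTStar Unit := .mk ((tree d).forget.withRoot (root d))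

end EGW

end

/-! The tree is a deterministic function of independent ingredients, so each claim becomes a
statement about an infinite product measure or about a fixed tree. Let f(s) = ∑ π_k s^k, let q_n be
the probability that a Galton–Watson tree reaches depth n, and s its limit, the survival
probability. Then q_{n+1} = 1 - f(1 - q_n), which `reachProb_succ` derives from the independence of
the root's offspring number and the subtrees (`gw_root_sub`).

Unimodularity. The size bias k and the uniform position 1/k cancel: a pair (number of children,
position) on the ancestral path has weight π_k / m (`spineLaw_apply`). For m = 1 this is also the
weight with which child j of a vertex with k children is counted, so the tree seen from o₁ with o
marked corresponds to the tree with a marked child of the root, under summation over children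
(`lintegral_reroot`). Hence E H(o) = E ∑ H(v) over the children v of o, and by iteration over the
descendants of any given order (`lintegral_root_eq_desc`). For `mass_transport`, the pairs (u, v)
are split by the distances to their youngest common ancestor; moving the root there turns both sides
of the principle into the same sum. Measurability holds because a ball depends locally on finitely
many discrete ingredients (`continuous_ordered`, `continuous_birooted`).

Generations. A given generation receives vertices from the bush of a far ancestor o_i exactly when
that bush is deep enough. These events are independent over i, so both Borel–Cantelli lemmas apply,
and everything depends on whether ∑ p_n converges, where p_n = 1 - f'(1 - q_n) / m
(`ae_infinite_level`, `ae_finite_level`, `toReal_branchProb`). For m = 1, convexity gives q_{n+1} ≥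
q_n (1 - p_n); since q_n → 0 when π_1 ≠ 1, the series diverges. For m > 1, p_n is bounded below. For
m < 1, (1 - π_0)^n ≤ q_n ≤ m^n makes ∑_n (1 - (1 - q_n)^{k-1}) comparable to log k, up to constants
and bounded errors, whence the k log k condition.

Descendants. If m ≤ 1 and π_1 ≠ 1, all Galton–Watson subtrees die out, so all D(v) are finite;
one-endedness and the absence of bi-infinite paths follow for purely combinatorial reasons
(`isClassII_of_finite_descendants`). If m > 1, a surviving tree almost surely has two surviving
vertices in some generation (`gw_isThin`); using this at every address yields a binary tree of
descending rays (`not_countable_descendingRays`), hence uncountably many paths and ends. The mean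
size of L(o) is computed exactly, as a geometric series (`lintegral_encard_generation`). -/

noncomputable section

/-! ### Resampling and relabelling coordinates of an infinite product -/

theorem measurable_update_prod {ι α : Type*} [DecidableEq ι] [MeasurableSpace α] (i₀ : ι) :
    Measurable fun p : α × (ι → α) => Function.update p.2 i₀ p.1 :=
  measurable_pi_lambda _ fun i => by
    by_cases h : i = i₀
    · subst h; simpa using measurable_fst
    · simp only [Function.update_of_ne h]; fun_prop

theorem MeasureTheory.Measure.infinitePi_map_update {ι α : Type*} [DecidableEq ι]
    [MeasurableSpace α] (μ : Measure α) [IsProbabilityMeasure μ] (i₀ : ι) :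
    (μ.prod (infinitePi fun _ : ι => μ)).map (fun p => Function.update p.2 i₀ p.1) =
      infinitePi fun _ : ι => μ := by
  have hm := measurable_update_prod (α := α) i₀
  refine eq_infinitePi _ fun s t ht => ?_
  rw [map_apply hm (.pi s.countable_toSet fun i _ => ht i)]
  have : (fun p : α × (ι → α) => Function.update p.2 i₀ p.1) ⁻¹' (Set.pi s t) =
      (if i₀ ∈ s then t i₀ else univ) ×ˢ (Set.pi (s.erase i₀ : Finset ι) t) := by
    ext ⟨k, y⟩
    simp only [mem_preimage, Set.mem_pi, Finset.mem_coe, mem_prod, Finset.mem_erase]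
    constructor
    · intro h
      refine ⟨?_, fun i hi => by simpa [Function.update_of_ne hi.1] using h i hi.2⟩
      split_ifs with h0
      · simpa using h i₀ h0
      · trivial
    · rintro ⟨h1, h2⟩ i hi
      by_cases h : i = i₀
      · subst h; simpa [hi] using h1
      · simpa [Function.update_of_ne h] using h2 i ⟨h, hi⟩
  rw [this, Measure.prod_prod, infinitePi_pi _ (fun i _ => ht i)]
  by_cases h0 : i₀ ∈ s
  · simp only [h0, if_true]
    exact Finset.mul_prod_erase s (fun i => μ (t i)) h0
  · simp [h0]

/-- Overwriting a coordinate by an independent copy does not change the law. This replaces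
conditioning on one offspring number. -/
theorem MeasureTheory.Measure.lintegral_infinitePi_update {ι α : Type*} [DecidableEq ι]
    [MeasurableSpace α] (μ : Measure α) [IsProbabilityMeasure μ] (i₀ : ι)
    {F : (ι → α) → ℝ≥0∞} (hF : Measurable F) :
    ∫⁻ y, F y ∂(infinitePi fun _ : ι => μ) =
      ∫⁻ k, ∫⁻ y, F (Function.update y i₀ k) ∂(infinitePi fun _ : ι => μ) ∂μ := by
  have hm := measurable_update_prod (α := α) i₀
  conv_lhs => rw [← infinitePi_map_update μ i₀]
  rw [lintegral_map hF hm]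
  exact lintegral_prod _ (hF.comp hm).aemeasurable

/-- Distinct coordinates of an i.i.d. family are again i.i.d., whatever their labels; used for the
change of addresses when the root moves. -/
theorem MeasureTheory.Measure.lintegral_infinitePi_comp {ι κ α : Type*}
    [MeasurableSpace α] (μ : Measure α) [IsProbabilityMeasure μ] {f : ι → κ}
    (hf : Function.Injective f) {F : (ι → α) → ℝ≥0∞} (hF : Measurable F) :
    ∫⁻ y, F (fun i => y (f i)) ∂(infinitePi fun _ : κ => μ) =
      ∫⁻ y, F y ∂(infinitePi fun _ : ι => μ) := by
  rw [← map_infinitePi_infinitePi_of_inj (P := fun _ : κ => μ) hf,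
    lintegral_map hF (by fun_prop)]

namespace EGW

/-! ### Galton–Watson trees coded by lists -/

/-- The law of the offspring numbers of the potential vertices of a Galton–Watson tree. -/
def gw (π : PMF ℕ) : Measure (List ℕ → ℕ) := Measure.infinitePi fun _ : List ℕ => π.toMeasure

instance (π : PMF ℕ) : IsProbabilityMeasure (gw π) := by unfold gw; infer_instance

/-- The offspring numbers of the tree of descendants of the child number `j`. -/
def sub (y : List ℕ → ℕ) (j : ℕ) : List ℕ → ℕ := fun w => y (w ++ [j])

/-- `w` is a vertex of the Galton–Watson tree with offspring numbers `y`. -/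
def IsGW (y : List ℕ → ℕ) : List ℕ → Prop
  | [] => True
  | j :: w => IsGW y w ∧ j < y w

/-- The tree has a vertex at depth `n`. -/
def Reaches (n : ℕ) (y : List ℕ → ℕ) : Prop := ∃ w, w.length = n ∧ IsGW y w

/-- The tree has vertices at all depths. -/
def Surv (y : List ℕ → ℕ) : Prop := ∀ n, Reaches n y

/-- Addresses list the most recent step first, so the last entry is the child of the root;
decomposing a tree at its root means splitting lists at their end. -/
lemma isGW_snoc (y : List ℕ → ℕ) (w : List ℕ) (j : ℕ) :
    IsGW y (w ++ [j]) ↔ j < y [] ∧ IsGW (sub y j) w := by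
  induction w with
  | nil => simp [IsGW]
  | cons i w ih => simp only [List.cons_append, IsGW, ih]; unfold sub; tauto

lemma reaches_zero (y : List ℕ → ℕ) : Reaches 0 y := ⟨[], rfl, trivial⟩

lemma reaches_succ (n : ℕ) (y : List ℕ → ℕ) :
    Reaches (n + 1) y ↔ ∃ j < y [], Reaches n (sub y j) := by
  constructor
  · rintro ⟨w, hw, h⟩
    rcases List.eq_nil_or_concat w with rfl | ⟨v, j, rfl⟩
    · simp at hw
    · rw [List.concat_eq_append] at h hw
      rw [isGW_snoc] at h
      exact ⟨j, h.1, v, by simpa using hw, h.2⟩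
  · rintro ⟨j, hj, w, hw, h⟩
    exact ⟨w ++ [j], by simp [hw], (isGW_snoc _ _ _).2 ⟨hj, h⟩⟩

lemma Reaches.mono {n m : ℕ} (hnm : n ≤ m) {y : List ℕ → ℕ} (h : Reaches m y) : Reaches n y := by
  induction hnm with
  | refl => exact h
  | step _ ih =>
    obtain ⟨w, hw, h⟩ := h
    cases w with
    | nil => simp at hw
    | cons j w => exact ih ⟨w, by simpa using hw, h.1⟩

/-- Compactness: if each of the finitely many subtrees of the children dies at some depth, the
maximum of these depths bounds the whole tree. -/
lemma surv_iff (y : List ℕ → ℕ) : Surv y ↔ ∃ j < y [], Surv (sub y j) := by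
  constructor
  · intro h
    by_contra! hc
    simp only [Surv, not_forall] at hc
    choose! N hN using hc
    obtain ⟨j, hj, hr⟩ := (reaches_succ _ _).1 (h ((Finset.range (y [])).sup N + 1))
    exact hN j hj (hr.mono (Finset.le_sup (Finset.mem_range.2 hj)))
  · rintro ⟨j, hj, h⟩ n
    exact ((reaches_succ n y).2 ⟨j, hj, h n⟩).mono n.le_succ

lemma finite_isGW {y : List ℕ → ℕ} (h : ¬ Surv y) : {w | IsGW y w}.Finite := by
  have key (n : ℕ) : {w | IsGW y w ∧ w.length = n}.Finite := by
    induction n with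
    | zero => exact (finite_singleton []).subset fun w hw => List.length_eq_zero_iff.1 hw.2
    | succ n ih =>
      refine (ih.biUnion fun w _ => (finite_Iio (y w)).image fun j => j :: w).subset ?_
      rintro (_ | ⟨j, w⟩) ⟨h, hl⟩
      · simp at hl
      · exact mem_biUnion (x := w) ⟨h.1, by simpa using hl⟩ ⟨j, h.2, rfl⟩
  simp only [Surv, not_forall] at h
  obtain ⟨N, hN⟩ := h
  refine ((finite_Iio N).biUnion fun n _ => key n).subset fun w hw => ?_
  refine mem_biUnion (x := w.length) ?_ ⟨hw, rfl⟩
  by_contra hc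
  exact hN (Reaches.mono (not_lt.1 hc) ⟨w, rfl, hw⟩)

lemma measurable_sub (j : ℕ) : Measurable fun y : List ℕ → ℕ => sub y j := by
  unfold sub; fun_prop

lemma measurableSet_isGW (w : List ℕ) : MeasurableSet {y | IsGW y w} := by
  induction w with
  | nil => simp [IsGW]
  | cons j w ih => exact ih.inter (measurableSet_lt measurable_const (measurable_pi_apply w))

lemma measurableSet_reaches (n : ℕ) : MeasurableSet {y | Reaches n y} := by
  have : {y | Reaches n y} = ⋃ w ∈ {w : List ℕ | w.length = n}, {y | IsGW y w} := by
    ext; simp [Reaches]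
  rw [this]
  exact MeasurableSet.biUnion (to_countable _) fun w _ => measurableSet_isGW w

lemma measurableSet_surv : MeasurableSet {y | Surv y} := by
  have : {y | Surv y} = ⋂ n, {y | Reaches n y} := by ext; simp [Surv]
  rw [this]
  exact MeasurableSet.iInter measurableSet_reaches

/-- The addresses `w ++ [j]` are distinct for distinct `(j, w)`, so the subtrees read disjoint sets
of i.i.d. coordinates. -/
theorem map_gw_sub (π : PMF ℕ) :
    (gw π).map (fun y j => sub y j) = Measure.infinitePi fun _ : ℕ => gw π := by
  have hf : Function.Injective fun p : ℕ × List ℕ => p.2 ++ [p.1] := by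
    rintro ⟨j, w⟩ ⟨j', w'⟩ h
    simpa [and_comm] using List.append_inj' h rfl
  unfold gw
  rw [← Measure.infinitePi_map_curry (fun _ _ => π.toMeasure),
    ← Measure.map_infinitePi_infinitePi_of_inj (P := fun _ : List ℕ => π.toMeasure) hf,
    Measure.map_map (by fun_prop) (by fun_prop)]
  rfl

/-- The offspring number of the root and the subtrees of its children are independent. -/
theorem gw_root_sub (π : PMF ℕ) (K : Set ℕ) (S : Finset ℕ) {A : ℕ → Set (List ℕ → ℕ)}
    (hA : ∀ j, MeasurableSet (A j)) :
    gw π {y | y [] ∈ K ∧ ∀ j ∈ S, sub y j ∈ A j} = π.toMeasure K * ∏ j ∈ S, gw π (A j) := by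
  have hms : Measurable fun (y : List ℕ → ℕ) j => sub y j :=
    measurable_pi_lambda _ measurable_sub
  have hpi : MeasurableSet (Set.pi (S : Set ℕ) A) := .pi S.countable_toSet fun j _ => hA j
  have h2 : gw π {y | ∀ j ∈ S, sub y j ∈ A j} = ∏ j ∈ S, gw π (A j) := by
    have : gw π ((fun y j => sub y j) ⁻¹' Set.pi (S : Set ℕ) A) = ∏ j ∈ S, gw π (A j) := by
      rw [← Measure.map_apply hms hpi, map_gw_sub, Measure.infinitePi_pi _ fun j _ => hA j]
    exact this
  have hset : {y : List ℕ → ℕ | y [] ∈ K ∧ ∀ j ∈ S, sub y j ∈ A j} =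
      (fun y => y []) ⁻¹' K ∩ (fun y j => sub y j) ⁻¹' Set.pi (S : Set ℕ) A := rfl
  have hm : MeasurableSet ((fun y : List ℕ → ℕ => y []) ⁻¹' K) :=
    measurable_pi_apply [] (MeasurableSet.of_discrete)
  have hm2 := hm.inter (hms hpi)
  rw [hset, ← lintegral_indicator_one hm2]
  unfold gw
  -- Resample the offspring number at the address `[]`: no subtree reads that coordinate, so the
  -- integrand factorizes.
  rw [Measure.lintegral_infinitePi_update _ [] (measurable_one.indicator hm2)]
  have : ∀ (k : ℕ) (y : List ℕ → ℕ), indicator ((fun y : List ℕ → ℕ => y []) ⁻¹' K ∩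
      (fun y j => sub y j) ⁻¹' Set.pi (S : Set ℕ) A) (1 : (List ℕ → ℕ) → ℝ≥0∞) (Function.update y [] k) =
      K.indicator 1 k * {y | ∀ j ∈ S, sub y j ∈ A j}.indicator 1 y := by
    intro k y
    have hs (j : ℕ) : sub (Function.update y [] k) j = sub y j := by
      ext w; simp [sub]
    have hmem : Function.update y [] k ∈ (fun y : List ℕ → ℕ => y []) ⁻¹' K ∩
        (fun y j => sub y j) ⁻¹' Set.pi (S : Set ℕ) A ↔ k ∈ K ∧ ∀ j ∈ S, sub y j ∈ A j := by
      simp [hs, Set.mem_pi]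
    by_cases h : k ∈ K ∧ ∀ j ∈ S, sub y j ∈ A j
    · rw [indicator_of_mem (hmem.2 h), indicator_of_mem h.1,
        indicator_of_mem (show y ∈ {y | ∀ j ∈ S, sub y j ∈ A j} from h.2)]
      simp
    · rw [indicator_of_notMem (mt hmem.1 h)]
      by_cases hk : k ∈ K
      · rw [indicator_of_notMem (s := {y | ∀ j ∈ S, sub y j ∈ A j}) fun h' => h ⟨hk, h'⟩, mul_zero]
      · rw [indicator_of_notMem hk, zero_mul]
  simp_rw [this]
  have hm3 : MeasurableSet {y : List ℕ → ℕ | ∀ j ∈ S, sub y j ∈ A j} := hms hpi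
  simp_rw [lintegral_const_mul _ (measurable_one.indicator hm3), lintegral_indicator_one hm3]
  rw [lintegral_mul_const _ (measurable_one.indicator .of_discrete),
    lintegral_indicator_one .of_discrete]
  exact congrArg _ h2

theorem gw_sub (π : PMF ℕ) (S : Finset ℕ) {A : ℕ → Set (List ℕ → ℕ)}
    (hA : ∀ j, MeasurableSet (A j)) :
    gw π {y | ∀ j ∈ S, sub y j ∈ A j} = ∏ j ∈ S, gw π (A j) := by
  simpa using gw_root_sub π univ S hA

/-- Decomposition according to the offspring number of the root. -/
theorem gw_eq_tsum (π : PMF ℕ) (B : Set (List ℕ → ℕ)) (hB : MeasurableSet B) :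
    gw π B = ∑' k, gw π {y | y [] = k ∧ y ∈ B} := by
  have : B = ⋃ k, {y | y [] = k ∧ y ∈ B} := by ext; simp
  conv_lhs => rw [this]
  refine measure_iUnion ?_ fun k => ?_
  · intro k k' hk
    exact Set.disjoint_left.2 fun y hy hy' => hk (hy.1.symm.trans hy'.1)
  · exact (measurable_pi_apply [] (MeasurableSet.of_discrete (s := {k}))).inter hB

/-- Given k children, the k subtrees are independent; the result is the generating function f at `gw
π A`. -/
theorem gw_forall_sub (π : PMF ℕ) {A : Set (List ℕ → ℕ)} (hA : MeasurableSet A) :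
    gw π {y | ∀ j < y [], sub y j ∈ A} = ∑' k, π k * gw π A ^ k := by
  rw [gw_eq_tsum]
  · refine tsum_congr fun k => ?_
    have := gw_root_sub π {k} (Finset.range k) (A := fun _ => A) fun _ => hA
    rw [Finset.prod_const, Finset.card_range, π.toMeasure_apply_singleton k .of_discrete] at this
    rw [← this]
    congr 1
    ext y
    simp only [mem_ofPred_eq, mem_singleton_iff, Finset.mem_range]
    constructor <;> (rintro ⟨rfl, h⟩; exact ⟨rfl, h⟩)
  · simp only [measurableSet_setOfPred]
    refine Measurable.forall fun j => Measurable.imp ?_ ?_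
    · exact measurableSet_setOfPred.1 (measurableSet_lt measurable_const (measurable_pi_apply []))
    · exact measurableSet_setOfPred.1 (measurable_sub j hA)

/-- Union bound over the distinguished child, which produces the factor k; with the power k - 1 for
its siblings this is f' at `gw π B`, times `gw π A`. -/
theorem gw_exists_sub_le (π : PMF ℕ) {A B : Set (List ℕ → ℕ)} (hA : MeasurableSet A)
    (hB : MeasurableSet B) :
    gw π {y | ∃ j < y [], sub y j ∈ A ∧ ∀ i < y [], i ≠ j → sub y i ∈ B} ≤
      ∑' k : ℕ, π k * (k * (gw π A * gw π B ^ (k - 1))) := by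
  calc _ ≤ gw π (⋃ k : ℕ, ⋃ j ∈ Finset.range k,
        {y | y [] ∈ ({k} : Set ℕ) ∧ ∀ i ∈ Finset.range k,
          sub y i ∈ (fun i => if i = j then A else B) i}) := by
        refine measure_mono ?_
        rintro y ⟨j, hj, h, h'⟩
        simp only [mem_iUnion]
        refine ⟨y [], j, Finset.mem_range.2 hj, rfl, fun i hi => ?_⟩
        by_cases hij : i = j
        · subst hij; simpa using h
        · simpa [hij] using h' i (Finset.mem_range.1 hi) hij
    _ ≤ ∑' k : ℕ, ∑ j ∈ Finset.range k, gw π {y | y [] ∈ ({k} : Set ℕ) ∧ ∀ i ∈ Finset.range k,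
          sub y i ∈ (fun i => if i = j then A else B) i} :=
        (measure_iUnion_le _).trans (ENNReal.tsum_le_tsum fun k => measure_biUnion_finset_le _ _)
    _ = _ := by
        refine tsum_congr fun k => ?_
        have : ∀ j ∈ Finset.range k, gw π {y | y [] ∈ ({k} : Set ℕ) ∧ ∀ i ∈ Finset.range k,
          sub y i ∈ (fun i => if i = j then A else B) i} = π k * (gw π A * gw π B ^ (k - 1)) := by
          intro j hj
          rw [gw_root_sub π {k} (Finset.range k) (fun i => by split_ifs <;> assumption),
            π.toMeasure_apply_singleton k .of_discrete, ← Finset.mul_prod_erase _ _ hj, if_pos rfl,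
            Finset.prod_congr rfl (g := fun _ => gw π B), Finset.prod_const,
            Finset.card_erase_of_mem hj, Finset.card_range]
          intro i hi
          rw [if_neg (Finset.ne_of_mem_erase hi)]
        rw [Finset.sum_congr rfl this]
        simp only [Finset.sum_const, Finset.card_range, nsmul_eq_mul]
        ring

end EGW

/-! ### Eternal Family Trees -/

namespace EFT

variable {M : Type} (T : EFT M)

lemma iterate_parent_injective (v : T.V) : Function.Injective fun n => T.parent^[n] v := by
  have key : ∀ m k : ℕ, T.parent^[m] v ≠ T.parent^[m + (k + 1)] v := fun m k h => by
    rw [add_comm, Function.iterate_add_apply] at h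
    exact T.acyclic _ k h.symm
  intro m n h
  rcases lt_trichotomy m n with hmn | hmn | hmn
  · obtain ⟨k, rfl⟩ := Nat.exists_eq_add_of_lt hmn
    exact absurd h (key m k)
  · exact hmn
  · obtain ⟨k, rfl⟩ := Nat.exists_eq_add_of_lt hmn
    exact absurd h.symm (key n k)

lemma parent_ne (v : T.V) : T.parent v ≠ v := T.acyclic v 0

lemma mem_descendants_of_parent {v w : T.V} (h : T.parent w ∈ T.descendants v) :
    w ∈ T.descendants v := by
  obtain ⟨n, hn⟩ := h
  exact ⟨n + 1, hn⟩

lemma parent_mem_descendants {v w : T.V} (h : w ∈ T.descendants v) (hne : w ≠ v) :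
    T.parent w ∈ T.descendants v := by
  obtain ⟨n, hn⟩ := h
  cases n with
  | zero => exact absurd hn hne
  | succ n => exact ⟨n, hn⟩

lemma graph_adj {v w : T.V} : T.graph.Adj v w ↔ T.parent v = w ∨ T.parent w = v := by
  simp only [graph, SimpleGraph.fromRel_adj, and_iff_right_iff_imp]
  rintro (rfl | rfl)
  · exact (T.parent_ne _).symm
  · exact T.parent_ne _

/-! ### Rays and ends -/

variable {T}

/-- The edge from `w` to its parent is the only one between the descendants of `w` and the other
vertices. -/
lemma Ray.eq_of_exit (r : T.Ray) {n : ℕ} {w : T.V} (h : r.toFun n ∈ T.descendants w)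
    (h' : r.toFun (n + 1) ∉ T.descendants w) : r.toFun n = w := by
  by_contra hne
  rcases T.graph_adj.1 (r.adj n) with h1 | h1
  · exact h' (h1 ▸ T.parent_mem_descendants h hne)
  · exact h' (T.mem_descendants_of_parent (h1.symm ▸ h))

lemma Ray.eq_of_enter (r : T.Ray) {n : ℕ} {w : T.V} (h : r.toFun n ∉ T.descendants w)
    (h' : r.toFun (n + 1) ∈ T.descendants w) : r.toFun (n + 1) = w := by
  by_contra hne
  rcases T.graph_adj.1 (r.adj n) with h1 | h1
  · exact h (T.mem_descendants_of_parent (h1.symm ▸ h'))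
  · exact h (h1 ▸ T.parent_mem_descendants h' hne)

/-- A change of side requires a visit to `w`, and a simple path visits `w` at most once. -/
lemma Ray.eventually_mem_or (r : T.Ray) (w : T.V) :
    (∃ N, ∀ n ≥ N, r.toFun n ∈ T.descendants w) ∨ ∃ N, ∀ n ≥ N, r.toFun n ∉ T.descendants w := by
  obtain ⟨N, hN⟩ : ∃ N, ∀ n ≥ N, r.toFun n ≠ w := by
    by_cases h : ∃ k, r.toFun k = w
    · obtain ⟨k, hk⟩ := h
      refine ⟨k + 1, fun n hn h => ?_⟩
      have := r.injective (h.trans hk.symm)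
      omega
    · exact ⟨0, fun n _ h' => h ⟨n, h'⟩⟩
  have step : ∀ n ≥ N, (r.toFun (n + 1) ∈ T.descendants w ↔ r.toFun n ∈ T.descendants w) := by
    intro n hn
    constructor
    · intro h
      by_contra h'
      exact hN (n + 1) (by omega) (r.eq_of_enter h' h)
    · intro h
      by_contra h'
      exact hN n hn (r.eq_of_exit h h')
  have all : ∀ n ≥ N, (r.toFun n ∈ T.descendants w ↔ r.toFun N ∈ T.descendants w) := by
    intro n hn
    induction n, hn using Nat.le_induction with
    | base => rfl
    | succ _ hn ih => exact (step _ hn).trans ih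
  by_cases h : r.toFun N ∈ T.descendants w
  · exact .inl ⟨N, fun n hn => (all n hn).2 h⟩
  · exact .inr ⟨N, fun n hn => mt (all n hn).1 h⟩

/-- The vertices whose tree of descendants contains the ray up to finitely many vertices. -/
def Ray.limitAncestors (r : T.Ray) : Set T.V := {w | ∃ N, ∀ n ≥ N, r.toFun n ∈ T.descendants w}

/-- Otherwise `s` eventually avoids the descendants of `w` while `r` eventually stays there, so
common vertices lie in two finite initial segments. Equality of ends is the equivalence generated by
the relation, hence ends are told apart by an invariant. -/
lemma Ray.limitAncestors_subset {r s : T.Ray} (h : (range r.toFun ∩ range s.toFun).Infinite) :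
    r.limitAncestors ⊆ s.limitAncestors := by
  rintro w ⟨N, hN⟩
  refine (s.eventually_mem_or w).resolve_right ?_
  rintro ⟨N', hN'⟩
  refine h (((finite_Iio N).image r.toFun).union ((finite_Iio N').image s.toFun) |>.subset ?_)
  rintro _ ⟨⟨n, rfl⟩, ⟨n', hn'⟩⟩
  by_cases h1 : n < N
  · exact .inl ⟨n, h1, rfl⟩
  · refine .inr ⟨n', ?_, hn'⟩
    by_contra h2
    exact hN' n' (not_lt.1 h2) (hn' ▸ hN n (not_lt.1 h1))

/-- `Ray.limitAncestors` as a function of the end of the ray. -/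
def limitAncestors : T.Ends → Set T.V :=
  Quot.lift Ray.limitAncestors fun _ _ h =>
    (Ray.limitAncestors_subset h).antisymm (Ray.limitAncestors_subset (inter_comm _ _ ▸ h))

variable (T) in
/-- The ray of the ancestors of a vertex. -/
def ancestorRay (v : T.V) : T.Ray where
  toFun n := T.parent^[n] v
  injective := T.iterate_parent_injective v
  adj _ := T.graph_adj.2 (.inl (Function.iterate_succ_apply' _ _ _).symm)

/-- A ray cannot stay in the finite set of descendants of an ancestor `w` of its origin, and it can
leave this set only through `w`. -/
lemma Ray.iterate_parent_mem_range (hfin : ∀ v, (T.descendants v).Finite) (r : T.Ray) (n : ℕ) :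
    T.parent^[n] (r.toFun 0) ∈ range r.toFun := by
  set w := T.parent^[n] (r.toFun 0)
  have h0 : r.toFun 0 ∈ T.descendants w := ⟨n, rfl⟩
  have hex : ∃ k, r.toFun k ∉ T.descendants w := by
    by_contra! hc
    exact infinite_range_of_injective r.injective ((hfin w).subset (range_subset_iff.2 hc))
  classical
  have hne : Nat.find hex ≠ 0 := fun h => Nat.find_spec hex (h.symm ▸ h0)
  obtain ⟨k, hk⟩ := Nat.exists_eq_succ_of_ne_zero hne
  have hk1 : r.toFun (k + 1) ∉ T.descendants w := by
    have := Nat.find_spec hex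
    rwa [hk] at this
  refine ⟨k, r.eq_of_exit ?_ hk1⟩
  by_contra h
  have := Nat.find_min' hex h
  omega

/-- Any two rays run through all ancestors of a common ancestor of their origins, hence share
infinitely many vertices. -/
theorem oneEnded_of_finite_descendants (v₀ : T.V) (hfin : ∀ v, (T.descendants v).Finite) :
    T.OneEnded := by
  refine Nat.card_eq_one_iff_unique.2 ⟨⟨?_⟩, ⟨Quot.mk _ (T.ancestorRay v₀)⟩⟩
  rintro ⟨r⟩ ⟨s⟩
  refine Quot.sound ?_
  obtain ⟨m, n, h⟩ := T.confluent (r.toFun 0) (s.toFun 0)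
  refine (infinite_range_of_injective
    (T.iterate_parent_injective (T.parent^[m] (r.toFun 0)))).mono ?_
  rintro _ ⟨k, rfl⟩
  refine ⟨?_, ?_⟩
  · simpa only [← Function.iterate_add_apply] using r.iterate_parent_mem_range hfin (k + m)
  · simpa only [h, ← Function.iterate_add_apply] using s.iterate_parent_mem_range hfin (k + n)

lemma eternalVertices_eq_empty (hfin : ∀ v, (T.descendants v).Finite) :
    T.eternalVertices = ∅ := by
  refine eq_empty_of_forall_notMem fun v hv => ?_
  choose w hw using hv
  refine infinite_range_of_injective (f := w) (fun m n h => ?_)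
    ((hfin v).subset (range_subset_iff.2 fun n => ⟨n, hw n⟩))
  exact T.iterate_parent_injective (w m) ((hw m).trans ((hw n).symm.trans (by rw [h])))

lemma biInfinitePaths_eq_empty (hfin : ∀ v, (T.descendants v).Finite) :
    T.biInfinitePaths = ∅ := by
  refine eq_empty_of_forall_notMem ?_
  rintro S ⟨p, hp, rfl⟩
  have : p 0 ∈ T.eternalVertices := by
    intro n
    refine ⟨p (-n), ?_⟩
    have (k : ℕ) : T.parent^[k] (p (-n)) = p (-n + k) := by
      induction k with
      | zero => simp
      | succ k ih => rw [Function.iterate_succ_apply', ih, hp]; push_cast; ring_nf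
    simpa using this n
  rw [eternalVertices_eq_empty hfin] at this
  exact this

theorem isClassII_of_finite_descendants (v₀ : T.V) (hfin : ∀ v, (T.descendants v).Finite)
    (hgen : ∀ v, (T.generation v).Infinite) : T.IsClassII where
  infinite := by
    have := infinite_range_of_injective (T.iterate_parent_injective v₀)
    exact infinite_univ_iff.1 (this.mono (subset_univ _))
  generation_infinite := hgen
  oneEnded := oneEnded_of_finite_descendants v₀ hfin
  no_path := biInfinitePaths_eq_empty hfin
  descendants_finite := hfin
  no_eternal := eternalVertices_eq_empty hfin

/-! ### Level functions -/

/-- `l` increases by one from a vertex to its parent. -/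
def IsLevel (T : EFT M) (l : T.V → ℤ) : Prop := ∀ v, l (T.parent v) = l v + 1

lemma IsLevel.iterate {l : T.V → ℤ} (hl : T.IsLevel l) (v : T.V) (n : ℕ) :
    l (T.parent^[n] v) = l v + n := by
  induction n with
  | zero => simp
  | succ n ih => rw [Function.iterate_succ_apply', hl, ih]; push_cast; ring

/-- Two vertices always have a common ancestor; if their levels agree, it is equally many
generations above both. -/
lemma IsLevel.mem_generation_iff {l : T.V → ℤ} (hl : T.IsLevel l) {v w : T.V} :
    w ∈ T.generation v ↔ l w = l v := by
  constructor
  · rintro ⟨n, hn⟩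
    have := congrArg l hn
    rw [hl.iterate, hl.iterate] at this
    linarith
  · intro h
    obtain ⟨m, n, hmn⟩ := T.confluent v w
    have := congrArg l hmn
    rw [hl.iterate, hl.iterate] at this
    have : m = n := by omega
    subst this
    exact ⟨m, hmn⟩

lemma IsLevel.not_hasYoungestGeneration {l : T.V → ℤ} (hl : T.IsLevel l)
    (h : ∀ k, ∃ v, l v = k) : ¬ T.HasYoungestGeneration := by
  rintro ⟨v, hv⟩
  obtain ⟨w, hw⟩ := h (l v - 1)
  refine eq_empty_iff_forall_notMem.1 hv w (hl.mem_generation_iff.2 ?_)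
  rw [hl, hw]; ring

theorem IsLevel.isClassIF_of_bijective {l : T.V → ℤ} (hl : T.IsLevel l)
    (hb : Function.Bijective l) : T.IsClassIF ∧ ∀ v, T.generation v = {v} := by
  have hgen : ∀ v, T.generation v = {v} := fun v => by
    ext w
    rw [hl.mem_generation_iff, hb.1.eq_iff, mem_singleton_iff]
  choose p hp using hb.2
  -- Along a bi-infinite path the level takes every integer value, so injectivity of `l` forces the
  -- path to exhaust the tree.
  have hpath : ∀ q : ℤ → T.V, (∀ n, T.parent (q n) = q (n + 1)) → range q = univ := by
    intro q hq
    have h1 : ∀ n, l (q n) = l (q 0) + n := by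
      intro n
      induction n with
      | zero => simp
      | succ n ih => rw [← hq, hl, ih]; ring
      | pred n ih =>
        have := hl (q (-n - 1))
        rw [hq, sub_add_cancel, ih] at this
        linarith
    refine eq_univ_of_forall fun v => ⟨l v - l (q 0), hb.1 ?_⟩
    rw [h1]; ring
  have hpp : ∀ n, T.parent (p n) = p (n + 1) := fun n => hb.1 (by rw [hl, hp, hp])
  refine ⟨⟨?_, fun v => by simp [hgen v], ⟨univ, ?_, ?_, ?_⟩, ?_⟩, hgen⟩
  · exact Infinite.of_surjective l hb.2
  · ext S
    constructor
    · rintro ⟨q, hq, rfl⟩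
      exact hpath q hq
    · rintro rfl
      exact ⟨p, hpp, (hpath p hpp).symm⟩
  · intro v
    exact ⟨v, by simp [hgen], fun w hw => by simpa [hgen] using hw⟩
  · refine eq_univ_of_forall fun v n => ⟨p (l v - n), hb.1 ?_⟩
    rw [hl.iterate, hp]; ring
  · exact hl.not_hasYoungestGeneration hb.2

/-! ### Descending rays -/

variable (T) in
/-- The infinite descending paths from `v₀`. -/
def descendingRays (v₀ : T.V) : Set (ℕ → T.V) := {r | r 0 = v₀ ∧ ∀ n, T.parent (r (n + 1)) = r n}

section descendingRays

variable {v₀ : T.V}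

lemma iterate_parent_of_mem_descendingRays {r : ℕ → T.V} (hr : r ∈ T.descendingRays v₀)
    (k n : ℕ) : T.parent^[k] (r (n + k)) = r n := by
  induction k with
  | zero => rfl
  | succ k ih => rw [Function.iterate_succ_apply, ← add_assoc, hr.2, ih]

lemma iterate_parent_eq_base {r : ℕ → T.V} (hr : r ∈ T.descendingRays v₀) (k : ℕ) :
    T.parent^[k] (r k) = v₀ := by
  simpa [hr.1] using iterate_parent_of_mem_descendingRays hr k 0

/-- The bi-infinite path which extends a descending ray. -/
def extendRay (v₀ : T.V) (r : ℕ → T.V) : ℤ → T.V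
  | .ofNat n => T.parent^[n] v₀
  | .negSucc n => r (n + 1)

lemma parent_extendRay {r : ℕ → T.V} (hr : r ∈ T.descendingRays v₀) (n : ℤ) :
    T.parent (extendRay v₀ r n) = extendRay v₀ r (n + 1) := by
  rcases n with n | n | n
  · exact (Function.iterate_succ_apply' _ _ _).symm
  · exact (hr.2 0).trans hr.1
  · exact hr.2 (n + 1)

/-- The extended path has a single vertex `n` generations below `v₀`. Hence the ray can be recovered
from the vertex set alone, which is how bi-infinite paths are recorded. -/
lemma eq_of_mem_range_extendRay {r : ℕ → T.V} (hr : r ∈ T.descendingRays v₀) {x : T.V} {n : ℕ}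
    (hx : x ∈ range (extendRay v₀ r)) (hn : T.parent^[n] x = v₀) : x = r n := by
  obtain ⟨k | k, rfl⟩ := hx
  · change T.parent^[n] (T.parent^[k] v₀) = v₀ at hn
    rw [← Function.iterate_add_apply] at hn
    have := T.iterate_parent_injective v₀ (hn.trans (Function.iterate_zero_apply _ _).symm)
    obtain ⟨rfl, rfl⟩ : n = 0 ∧ k = 0 := by omega
    exact hr.1.symm
  · change T.parent^[n] (r (k + 1)) = v₀ at hn
    have := T.iterate_parent_injective _ (hn.trans (iterate_parent_eq_base hr _).symm)
    rw [this]; rfl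

lemma mem_range_extendRay {r : ℕ → T.V} (hr : r ∈ T.descendingRays v₀) (n : ℕ) :
    r n ∈ range (extendRay v₀ r) := by
  cases n with
  | zero => exact ⟨0, hr.1.symm⟩
  | succ n => exact ⟨.negSucc n, rfl⟩

theorem not_countable_biInfinitePaths (h : ¬ (T.descendingRays v₀).Countable) :
    ¬ T.biInfinitePaths.Countable := by
  refine fun hc => h (MapsTo.countable_of_injOn (f := fun r => range (extendRay v₀ r)) ?_ ?_ hc)
  · exact fun r hr => ⟨_, parent_extendRay hr, rfl⟩
  · intro r hr s hs hrs
    funext n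
    refine (eq_of_mem_range_extendRay hr (n := n) ?_ (iterate_parent_eq_base hs n)).symm
    exact (show range (extendRay v₀ r) = range (extendRay v₀ s) from hrs) ▸
      mem_range_extendRay hs n

/-- A descending ray as a ray of the undirected tree. -/
def descendingRays.toRay (r : T.descendingRays v₀) : T.Ray where
  toFun := r.1
  injective m n h := T.iterate_parent_injective (r.1 m) <|
    (iterate_parent_eq_base r.2 m).trans <| (iterate_parent_eq_base r.2 n).symm.trans (by rw [h])
  adj n := T.graph_adj.2 (.inr (r.2.2 n))

/-- Among the vertices `n` generations below `v₀`, only the n-th vertex of a descending ray has that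
ray eventually among its descendants. So `limitAncestors` determines the ray, and distinct
descending rays have distinct ends. -/
theorem uncountable_ends (h : ¬ (T.descendingRays v₀).Countable) : Uncountable T.Ends := by
  rw [← not_countable_iff]
  intro hc
  refine h (countable_coe_iff.1 ?_)
  let f : T.descendingRays v₀ → T.Ends := fun r => Quot.mk _ (descendingRays.toRay r)
  refine Function.Injective.countable (f := f) ?_
  intro r s hrs
  have hinv : (descendingRays.toRay r).limitAncestors = (descendingRays.toRay s).limitAncestors :=
    congrArg limitAncestors hrs
  refine Subtype.ext (funext fun n => ?_)
  have hs : s.1 n ∈ (descendingRays.toRay s).limitAncestors := by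
    refine ⟨n, fun k hk => ⟨k - n, ?_⟩⟩
    have := iterate_parent_of_mem_descendingRays s.2 (k - n) n
    rwa [Nat.add_sub_cancel' hk] at this
  rw [← hinv] at hs
  obtain ⟨N, hN⟩ := hs
  obtain ⟨j, hj⟩ := hN (max N n) (le_max_left _ _)
  change T.parent^[j] (r.1 (max N n)) = s.1 n at hj
  have h1 : T.parent^[n + j] (r.1 (max N n)) = v₀ := by
    rw [Function.iterate_add_apply, hj, iterate_parent_eq_base s.2]
  have h2 := T.iterate_parent_injective _ (h1.trans (iterate_parent_eq_base r.2 _).symm)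
  rw [← hj, ← iterate_parent_of_mem_descendingRays r.2 j n, h2]

/-- Each vertex of `A` has two distinct descendants in `A` of the same order; choosing between them
repeatedly embeds the binary sequences into the rays, and Cantor's diagonal argument applies. -/
theorem not_countable_descendingRays {A : Set T.V} (h0 : v₀ ∈ A)
    (hA : ∀ v ∈ A, ∃ n, ∃ w ∈ A, ∃ w' ∈ A, w ≠ w' ∧ T.parent^[n] w = v ∧ T.parent^[n] w' = v) :
    ¬ (T.descendingRays v₀).Countable := by
  have hA' : ∀ v : A, ∃ n, ∃ w : Bool → A, Function.Injective w ∧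
      ∀ b, T.parent^[n] (w b : T.V) = v := by
    rintro ⟨v, hv⟩
    obtain ⟨n, w, hw, w', hw', hne, h, h'⟩ := hA v hv
    refine ⟨n, fun b => if b then ⟨w, hw⟩ else ⟨w', hw'⟩, ?_, ?_⟩
    · intro b b'
      cases b <;> cases b' <;> simp [hne, hne.symm]
    · intro b
      cases b <;> simp [h, h']
  choose N w hw hp using hA'
  have hN : ∀ v, 1 ≤ N v := by
    intro v
    by_contra hc
    have h0 : N v = 0 := by omega
    have := hp v
    rw [h0] at this
    simp only [Function.iterate_zero, id] at this
    exact absurd (hw v (Subtype.ext ((this true).trans (this false).symm))) (by simp)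
  -- `x b k` is the vertex reached after the first k choices of `b`, and `d b k` below is its depth
  -- under `v₀`.
  let x : (ℕ → Bool) → ℕ → A := fun b k =>
    Nat.rec (motive := fun _ => A) ⟨v₀, h0⟩ (fun k v => w v (b k)) k
  let d : (ℕ → Bool) → ℕ → ℕ := fun b k =>
    Nat.rec (motive := fun _ => ℕ) 0 (fun k n => n + N (x b k)) k
  have hxs (b k) : x b (k + 1) = w (x b k) (b k) := rfl
  have hds (b k) : d b (k + 1) = d b k + N (x b k) := rfl
  have hd (b k) : k ≤ d b k := by
    induction k with
    | zero => simp
    | succ k ih => rw [hds]; have := hN (x b k); omega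
  -- The ancestor at depth n is the same from whichever later chosen vertex it is computed.
  have coh (b) (n k : ℕ) (hk : n ≤ d b k) (l : ℕ) (hl : k ≤ l) :
      n ≤ d b l ∧ T.parent^[d b l - n] (x b l : T.V) = T.parent^[d b k - n] (x b k : T.V) := by
    induction l, hl using Nat.le_induction with
    | base => exact ⟨hk, rfl⟩
    | succ l hl ih =>
      refine ⟨by rw [hds]; omega, ?_⟩
      rw [← ih.2, hds, Nat.sub_add_comm ih.1, Function.iterate_add_apply, hxs, hp]
  -- The vertex at depth n is read off from `x b n`, which is deep enough because each choice
  -- descends at least one generation.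
  let r : (ℕ → Bool) → ℕ → T.V := fun b n => T.parent^[d b n - n] (x b n : T.V)
  have hr (b) : r b ∈ T.descendingRays v₀ := by
    refine ⟨rfl, fun n => ?_⟩
    have := (coh b n n (hd b n) (n + 1) n.le_succ).2
    change T.parent (T.parent^[d b (n + 1) - (n + 1)] (x b (n + 1) : T.V)) = _
    rw [← Function.iterate_succ_apply' T.parent]
    refine Eq.trans ?_ this
    have := hd b (n + 1)
    rw [show (d b (n + 1) - (n + 1)).succ = d b (n + 1) - n by omega]
  have hrx (b k) : r b (d b k) = (x b k : T.V) := by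
    have := (coh b (d b k) k le_rfl (d b k) (hd b k)).2
    simpa using this
  have hinj : Function.Injective r := by
    intro b b' hbb
    have key (k : ℕ) : x b k = x b' k ∧ d b k = d b' k := by
      induction k with
      | zero => exact ⟨rfl, rfl⟩
      | succ k ih =>
        have hd' : d b (k + 1) = d b' (k + 1) := by rw [hds, hds, ih.1, ih.2]
        refine ⟨Subtype.ext ?_, hd'⟩
        exact (hrx b (k + 1)).symm.trans (by rw [hd', hbb]; exact hrx b' (k + 1))
    funext k
    have := (key (k + 1)).1
    rw [hxs, hxs, (key k).1] at this
    exact hw _ this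
  intro hc
  have : Countable (ℕ → Bool) := by
    have := countable_coe_iff.2 hc
    exact Function.Injective.countable (f := fun b => (⟨r b, hr b⟩ : T.descendingRays v₀))
      fun b b' h => hinj (congrArg Subtype.val h)
  obtain ⟨f, hf⟩ := exists_surjective_nat (ℕ → Bool)
  obtain ⟨n, hn⟩ := hf fun n => !(f n n)
  simpa using congrFun hn n

end descendingRays

end EFT

instance {ι : Type*} {X : ι → Type*} [∀ i, MeasurableSpace (X i)]
    [∀ i, DiscreteMeasurableSpace (X i)] : DiscreteMeasurableSpace (Σ i, X i) :=
  ⟨fun s => MeasurableSpace.measurableSet_iInf.2 fun i =>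
    (MeasurableSet.of_discrete : MeasurableSet (Sigma.mk i ⁻¹' s))⟩

namespace EGW

variable {π : PMF ℕ} (h0 : mean π ≠ 0) (htop : mean π ≠ ∞)

/-! ### The law of the ingredients -/

/-- The size bias k cancels the uniform weight 1/k. That the weight does not depend on j is the
source of unimodularity. -/
theorem spineLaw_apply (k : ℕ) (j : Fin k) : spineLaw π h0 htop ⟨k, j⟩ = π k / mean π := by
  rw [spineLaw, PMF.bindOnSupport_apply, tsum_eq_single k]
  · split_ifs with h
    · have : (k : ℝ≥0∞) * π k * (mean π)⁻¹ = 0 := h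
      simp only [mul_eq_zero, ENNReal.inv_eq_zero, htop, or_false] at this
      rcases this with h | h
      · have := j.pos; simp_all
      · simp [h]
    · have hk : (k : ℝ≥0∞) ≠ 0 := by have := j.pos; positivity
      have hb : sizeBiased π h0 htop k = (k : ℝ≥0∞) * π k * (mean π)⁻¹ := rfl
      rw [PMF.map_apply, tsum_eq_single j]
      · simp only [if_true, PMF.uniformOfFintype_apply, Fintype.card_fin, hb]
        rw [div_eq_mul_inv, mul_comm (k : ℝ≥0∞), mul_assoc, mul_assoc,
          mul_comm (k : ℝ≥0∞), mul_assoc, ENNReal.inv_mul_cancel hk (by simp), mul_one]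
      · intro j' hj'
        rw [if_neg]
        intro h
        exact hj' (eq_of_heq (Sigma.mk.inj h).2).symm
  · intro k' hk'
    split_ifs with h
    · simp
    · rw [PMF.map_apply, ENNReal.tsum_eq_zero.2, mul_zero]
      intro j'
      rw [if_neg]
      intro h
      exact hk' (Sigma.mk.inj h).1.symm

theorem tsum_spineLaw_mul (F : (Σ k, Fin k) → ℝ≥0∞) :
    ∑' c, spineLaw π h0 htop c * F c = ∑' k, π k / mean π * ∑ j : Fin k, F ⟨k, j⟩ := by
  rw [ENNReal.tsum_sigma']
  refine tsum_congr fun k => ?_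
  simp_rw [spineLaw_apply, tsum_fintype, ← Finset.mul_sum]

instance : IsProbabilityMeasure (sampleLaw π h0 htop) := by unfold sampleLaw; infer_instance

/-- The offspring numbers of all potential vertices with the same nearest vertex on the
ancestral path. -/
def bush (d : Sample) (i : ℕ) : List ℕ → ℕ := fun w => d.2 (i, w)

lemma measurable_bush (i : ℕ) : Measurable fun d : Sample => bush d i := by
  unfold bush; fun_prop

/-- Every address carries a Galton–Watson tree of offspring numbers, whether or not it is a vertex;
null events can thus be excluded at all countably many addresses at once. -/
theorem map_bush_append (i : ℕ) (v : List ℕ) :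
    (sampleLaw π h0 htop).map (fun d w => bush d i (w ++ v)) = gw π := by
  have hf : Function.Injective fun w : List ℕ => (i, w ++ v) := fun w w' h => by
    simpa using h
  have h1 : (sampleLaw π h0 htop).map Prod.snd =
      Measure.infinitePi fun _ : ℕ × List ℕ => π.toMeasure := by
    unfold sampleLaw; simp [Measure.map_snd_prod]
  unfold gw
  rw [← Measure.map_infinitePi_infinitePi_of_inj (P := fun _ : ℕ × List ℕ => π.toMeasure) hf,
    ← h1, Measure.map_map (by fun_prop) measurable_snd]
  rfl

theorem map_bush (i : ℕ) : (sampleLaw π h0 htop).map (fun d => bush d i) = gw π := by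
  simpa using map_bush_append h0 htop i []

theorem map_bushes {f : ℕ → ℕ} (hf : Function.Injective f) :
    (Measure.infinitePi fun _ : ℕ × List ℕ => π.toMeasure).map (fun y i w => y (f i, w)) =
      Measure.infinitePi fun _ : ℕ => gw π := by
  have hf' : Function.Injective fun p : ℕ × List ℕ => (f p.1, p.2) := by
    rintro ⟨j, w⟩ ⟨j', w'⟩ h
    simpa [hf.eq_iff] using h
  unfold gw
  rw [← Measure.infinitePi_map_curry (fun _ _ => π.toMeasure)]
  conv_rhs =>
    rw [← Measure.map_infinitePi_infinitePi_of_inj (P := fun _ : ℕ × List ℕ => π.toMeasure) hf',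
      Measure.map_map (by fun_prop) (by fun_prop)]
  rfl

/-- With the spine ingredients fixed, the bushes are independent; the resulting product involves
distinct spine coordinates, so its integral factorizes too. The shift `f i + 1` occurs because `d.1
i` describes the children of `o_{i+1}`. -/
theorem sampleLaw_forall_spine {f : ℕ → ℕ} (hf : Function.Injective f)
    {B : ℕ → Set ((Σ k, Fin k) × (List ℕ → ℕ))} (hB : ∀ i, MeasurableSet (B i)) (S : Finset ℕ) :
    sampleLaw π h0 htop {d | ∀ i ∈ S, (d.1 (f i), bush d (f i + 1)) ∈ B i} =
      ∏ i ∈ S, ((spineLaw π h0 htop).toMeasure.prod (gw π)) (B i) := by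
  have hf1 : Function.Injective fun i => f i + 1 := fun i i' h => hf (by simpa using h)
  have hmeas : MeasurableSet {d : Sample | ∀ i ∈ S, (d.1 (f i), bush d (f i + 1)) ∈ B i} := by
    have : {d : Sample | ∀ i ∈ S, (d.1 (f i), bush d (f i + 1)) ∈ B i} =
        ⋂ i ∈ S, (fun d : Sample => (d.1 (f i), bush d (f i + 1))) ⁻¹' B i := by
      ext; simp
    rw [this]
    refine Finset.measurableSet_biInter S fun i _ => ?_
    exact (Measurable.prodMk (by fun_prop) (measurable_bush _)) (hB i)
  unfold sampleLaw
  rw [Measure.prod_apply hmeas]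
  have hslice (a : ℕ → Σ k, Fin k) :
      (Measure.infinitePi fun _ : ℕ × List ℕ => π.toMeasure)
        (Prod.mk a ⁻¹' {d : Sample | ∀ i ∈ S, (d.1 (f i), bush d (f i + 1)) ∈ B i}) =
      ∏ i ∈ S, gw π (Prod.mk (a (f i)) ⁻¹' B i) := by
    have hs (i) : MeasurableSet (Prod.mk (a (f i)) ⁻¹' B i) := measurable_prodMk_left (hB i)
    rw [← Measure.infinitePi_pi (fun _ : ℕ => gw π) (fun i _ => hs i), ← map_bushes hf1,
      Measure.map_apply (by fun_prop) (.pi S.countable_toSet fun i _ => hs i)]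
    rfl
  simp_rw [hslice]
  have hg (i) : Measurable fun c : Σ k, Fin k => gw π (Prod.mk c ⁻¹' B i) :=
    measurable_measure_prodMk_left (hB i)
  have hind : iIndepFun (fun i (a : ℕ → Σ k, Fin k) => gw π (Prod.mk (a (f i)) ⁻¹' B i))
      (Measure.infinitePi fun _ : ℕ => (spineLaw π h0 htop).toMeasure) := by
    have h1 : iIndepFun (fun i (a : ℕ → Σ k, Fin k) => a i)
        (Measure.infinitePi fun _ : ℕ => (spineLaw π h0 htop).toMeasure) :=
      iIndepFun_infinitePi (X := fun _ c => c) fun _ => measurable_id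
    exact (h1.precomp hf).comp (fun i c => gw π (Prod.mk c ⁻¹' B i)) hg
  rw [lintegral_prod_eq_prod_lintegral_of_indepFun S _ hind
    fun i => (hg i).comp (measurable_pi_apply _)]
  refine Finset.prod_congr rfl fun i _ => ?_
  rw [Measure.prod_apply (hB i)]
  conv_rhs => rw [← Measure.infinitePi_map_eval (fun _ : ℕ => (spineLaw π h0 htop).toMeasure) (f i)]
  exact (lintegral_map (hg i) (measurable_pi_apply _)).symm

theorem sampleLaw_spine (i : ℕ) {B : Set ((Σ k, Fin k) × (List ℕ → ℕ))} (hB : MeasurableSet B) :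
    sampleLaw π h0 htop {d | (d.1 i, bush d (i + 1)) ∈ B} =
      ((spineLaw π h0 htop).toMeasure.prod (gw π)) B := by
  simpa using sampleLaw_forall_spine h0 htop Function.injective_id (fun _ => hB) {i}

theorem iIndepSet_spine {f : ℕ → ℕ} (hf : Function.Injective f)
    {B : ℕ → Set ((Σ k, Fin k) × (List ℕ → ℕ))} (hB : ∀ i, MeasurableSet (B i)) :
    iIndepSet (fun i => {d : Sample | (d.1 (f i), bush d (f i + 1)) ∈ B i})
      (sampleLaw π h0 htop) := by
  rw [iIndepSet_iff_meas_biInter]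
  · intro S
    simp_rw [sampleLaw_spine h0 htop _ (hB _)]
    rw [← sampleLaw_forall_spine h0 htop hf hB S]
    congr 1
    ext; simp
  · intro i
    exact (Measurable.prodMk (by fun_prop) (measurable_bush _)) (hB i)

/-! ### Vertices of the tree -/

lemma isVertex_zero (d : Sample) (w : List ℕ) : IsVertex d 0 w ↔ IsGW (bush d 0) w := by
  induction w with
  | nil => simp [IsVertex, IsGW]
  | cons j w ih =>
    simp only [IsVertex, IsGW, ih]
    cases w <;> simp [numChildren, IsSpineSlot, bush]

/-- The last entry is the step away from the ancestral path, the only one for which the slot taken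
by `o_i` is excluded; from there on the tree is an ordinary Galton–Watson tree. -/
lemma isVertex_succ_snoc (d : Sample) (i : ℕ) (w : List ℕ) (j : ℕ) :
    IsVertex d (i + 1) (w ++ [j]) ↔
      (j < (d.1 i).1 ∧ j ≠ (d.1 i).2) ∧ IsGW (sub (bush d (i + 1)) j) w := by
  induction w with
  | nil => simp [IsVertex, IsGW, numChildren, IsSpineSlot]
  | cons l w ih =>
    simp only [List.cons_append, IsVertex, ih, IsGW]
    cases w <;> simp [numChildren, IsSpineSlot, bush, sub] <;> tauto

lemma finite_isVertex_length (d : Sample) (i n : ℕ) :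
    {w | IsVertex d i w ∧ w.length = n}.Finite := by
  induction n with
  | zero => exact (finite_singleton []).subset fun w hw => List.length_eq_zero_iff.1 hw.2
  | succ n ih =>
    refine (ih.biUnion fun w _ => (finite_Iio (numChildren d (i, w))).image
      fun j => j :: w).subset ?_
    rintro (_ | ⟨j, w⟩) ⟨h, hl⟩
    · simp at hl
    · exact mem_biUnion (x := w) ⟨h.1, by simpa using hl⟩ ⟨j, h.2.1, rfl⟩

lemma isLevel (d : Sample) : (tree d).IsLevel (level d) := level_parent d

lemma generation_eq (d : Sample) (v : Vertex d) :
    (tree d).generation v = {w | level d w = level d v} :=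
  Set.ext fun _ => (isLevel d).mem_generation_iff

/-- Some child outside the ancestral path has a descendant `n` generations later. -/
def Branches (n : ℕ) (c : (Σ k, Fin k) × (List ℕ → ℕ)) : Prop :=
  ∃ j < c.1.1, j ≠ c.1.2 ∧ Reaches n (sub c.2 j)

lemma measurableSet_branches (n : ℕ) : MeasurableSet {c | Branches n c} := by
  have : {c | Branches n c} = ⋃ j : ℕ, {c : (Σ k, Fin k) × (List ℕ → ℕ) |
      (j < c.1.1 ∧ j ≠ c.1.2)} ∩ {c | Reaches n (sub c.2 j)} := by
    ext; simp [Branches, and_assoc]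
  rw [this]
  refine MeasurableSet.iUnion fun j => .inter ?_ ?_
  · exact measurable_fst (MeasurableSet.of_discrete (s := {c : Σ k, Fin k | j < c.1 ∧ j ≠ c.2}))
  · exact ((measurable_sub j).comp measurable_snd) (measurableSet_reaches n)

lemma branches_iff (d : Sample) (i n : ℕ) :
    Branches n (d.1 i, bush d (i + 1)) ↔ ∃ w, w.length = n + 1 ∧ IsVertex d (i + 1) w := by
  constructor
  · rintro ⟨j, hj, hj', w, hw, h⟩
    exact ⟨w ++ [j], by simp [hw], (isVertex_succ_snoc d i w j).2 ⟨⟨hj, hj'⟩, h⟩⟩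
  · rintro ⟨w, hw, h⟩
    rcases List.eq_nil_or_concat w with rfl | ⟨v, j, rfl⟩
    · simp at hw
    · rw [List.concat_eq_append] at h hw
      rw [isVertex_succ_snoc] at h
      exact ⟨j, h.1.1, h.1.2, v, by simpa using hw, h.2⟩

/-- The probability of `Branches`. -/
def branchProb (n : ℕ) : ℝ≥0∞ :=
  ((spineLaw π h0 htop).toMeasure.prod (gw π)) {c | Branches n c}

/-- Second Borel–Cantelli lemma: infinitely many ancestors have a bush deep enough to meet a given
level. -/
theorem ae_infinite_level (h : ∑' n, branchProb h0 htop n = ∞) :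
    ∀ᵐ d ∂sampleLaw π h0 htop, ∀ k : ℤ, {v | level d v = k}.Infinite := by
  -- The event yields a vertex of depth i + b + 1 in the bush of index i + a + 1, hence of level a -
  -- b; taking for a and b the positive and negative parts of k covers every integer level.
  have key : ∀ a b : ℕ, ∀ᵐ d ∂sampleLaw π h0 htop,
      ∃ᶠ i in Filter.atTop, Branches (i + b) (d.1 (i + a), bush d (i + a + 1)) := by
    intro a b
    have hms (i : ℕ) : MeasurableSet
        {d : Sample | (d.1 (i + a), bush d (i + a + 1)) ∈ {c | Branches (i + b) c}} :=
      (Measurable.prodMk (by fun_prop) (measurable_bush _)) (measurableSet_branches _)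
    have h1 := measure_limsup_eq_one hms (iIndepSet_spine h0 htop (add_left_injective a)
      fun i => measurableSet_branches (i + b)) (by
        simp_rw [sampleLaw_spine h0 htop _ (measurableSet_branches _)]
        change ∑' i, branchProb h0 htop (i + b) = ∞
        have hs := ENNReal.summable.sum_add_tsum_nat_add' (f := branchProb h0 htop) (k := b)
        rw [h] at hs
        refine (ENNReal.add_eq_top.1 hs).resolve_left ?_
        exact ENNReal.sum_ne_top.2 fun i _ => measure_ne_top _ _)
    have h2 := (prob_compl_eq_zero_iff (MeasurableSet.measurableSet_limsup hms)).2 h1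
    filter_upwards [compl_mem_ae_iff.2 h2] with d hd
    rw [compl_compl, Filter.mem_limsup_iff_frequently_mem] at hd
    exact hd
  filter_upwards [ae_all_iff.2 fun a => ae_all_iff.2 (key a)] with d hd k
  have hf := Nat.frequently_atTop_iff_infinite.1 (hd k.toNat (-k).toNat)
  refine Set.Infinite.of_image (fun v : Vertex d => v.1.1) ?_
  refine (hf.image (f := fun i => i + k.toNat + 1) fun i _ i' _ h => by simpa using h).mono ?_
  rintro _ ⟨i, hi, rfl⟩
  obtain ⟨w, hw, hv⟩ := (branches_iff _ _ _).1 hi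
  refine ⟨⟨(_, w), hv⟩, ?_, rfl⟩
  change ((i + k.toNat + 1 : ℕ) : ℤ) - (w.length : ℤ) = k
  omega

/-- First Borel–Cantelli lemma: only finitely many bushes meet a given level, and each has finitely
many vertices at a given depth. -/
theorem ae_finite_level (h : ∑' n, branchProb h0 htop n ≠ ∞) :
    ∀ᵐ d ∂sampleLaw π h0 htop, ∀ k : ℤ, {v | level d v = k}.Finite := by
  have key : ∀ a b : ℕ, ∀ᵐ d ∂sampleLaw π h0 htop,
      ∀ᶠ i in Filter.atTop, ¬ Branches (i + b) (d.1 (i + a), bush d (i + a + 1)) := by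
    intro a b
    refine ae_eventually_notMem
      (s := fun i => {d : Sample | (d.1 (i + a), bush d (i + a + 1)) ∈ {c | Branches (i + b) c}}) ?_
    simp_rw [sampleLaw_spine h0 htop _ (measurableSet_branches _)]
    change ∑' i, branchProb h0 htop (i + b) ≠ ∞
    have hs := ENNReal.summable.sum_add_tsum_nat_add' (f := branchProb h0 htop) (k := b)
    exact ne_top_of_le_ne_top h (hs ▸ le_add_self)
  filter_upwards [ae_all_iff.2 fun a => ae_all_iff.2 (key a)] with d hd k
  obtain ⟨N, hN⟩ := Filter.eventually_atTop.1 (hd k.toNat (-k).toNat)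
  refine Set.Finite.of_finite_image (f := Subtype.val) ?_ Subtype.val_injective.injOn
  refine ((finite_Iic (N + k.toNat + 1)).biUnion fun i _ =>
    ((finite_isVertex_length d i (i - k).toNat).image (Prod.mk i))).subset ?_
  rintro _ ⟨⟨⟨i, w⟩, hv⟩, hl, rfl⟩
  change (i : ℤ) - (w.length : ℤ) = k at hl
  refine mem_biUnion (x := i) ?_ ⟨w, ⟨hv, by omega⟩, rfl⟩
  by_contra hc
  rw [mem_Iic, not_le] at hc
  obtain ⟨i, rfl⟩ : ∃ i', i = i' + k.toNat + 1 := ⟨i - k.toNat - 1, by omega⟩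
  refine hN i (by omega) ((branches_iff _ _ _).2 ⟨w, ?_, hv⟩)
  omega

end EGW

namespace EGW

/-! ### Survival of Galton–Watson trees -/

section survival

variable (π : PMF ℕ)

/-- The offspring probabilities as real numbers. -/
def prob (k : ℕ) : ℝ := (π k).toReal

/-- The probability that a Galton–Watson tree reaches depth `n`. -/
def reachProb (n : ℕ) : ℝ := (gw π).real {y | Reaches n y}

/-- The probability that a Galton–Watson tree survives. -/
def survProb : ℝ := (gw π).real {y | Surv y}

/-- The probability that some child of the root survives if each of them does so independently
with probability `q`. -/
def reachMap (q : ℝ) : ℝ := ∑' k, prob π k * (1 - (1 - q) ^ k)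

variable {π}

lemma prob_nonneg (k : ℕ) : 0 ≤ prob π k := ENNReal.toReal_nonneg

lemma ofReal_prob (k : ℕ) : ENNReal.ofReal (prob π k) = π k :=
  ENNReal.ofReal_toReal (π.apply_ne_top k)

lemma hasSum_prob : HasSum (prob π) 1 := by
  have := ENNReal.hasSum_toReal (f := fun k => π k) (by simp)
  rwa [← ENNReal.tsum_toReal_eq (fun k => π.apply_ne_top k), π.tsum_coe, ENNReal.toReal_one] at this

lemma hasSum_mul_prob (htop : mean π ≠ ∞) :
    HasSum (fun k : ℕ => k * prob π k) (mean π).toReal := by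
  have := ENNReal.hasSum_toReal (f := fun k : ℕ => (k : ℝ≥0∞) * π k) htop
  rw [← ENNReal.tsum_toReal_eq fun k => ENNReal.mul_ne_top (by simp) (π.apply_ne_top k)] at this
  simpa [prob] using this

lemma prob_zero_lt_one (h0 : mean π ≠ 0) : prob π 0 < 1 := by
  by_contra! h
  refine h0 (ENNReal.tsum_eq_zero.2 fun k => ?_)
  rcases Nat.eq_zero_or_pos k with rfl | hk
  · simp
  · have h1 := hasSum_prob (π := π).summable.sum_le_tsum {0, k} fun i _ => prob_nonneg i
    rw [hasSum_prob.tsum_eq, Finset.sum_pair hk.ne] at h1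
    have h2 : prob π k = 0 := le_antisymm (by linarith) (prob_nonneg k)
    rw [← ofReal_prob, h2]
    simp

lemma reachProb_mem (n : ℕ) : reachProb π n ∈ Icc (0 : ℝ) 1 :=
  ⟨measureReal_nonneg, measureReal_le_one⟩

lemma survProb_mem : survProb π ∈ Icc (0 : ℝ) 1 := ⟨measureReal_nonneg, measureReal_le_one⟩

/-! ### Estimates for `reachMap`, that is, q ↦ 1 - f(1 - q) -/

section reachMap

variable {q : ℝ} (hq : q ∈ Icc (0 : ℝ) 1)
include hq

lemma one_sub_pow_mem (k : ℕ) : 1 - (1 - q) ^ k ∈ Icc (0 : ℝ) 1 := by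
  have h1 : (1 - q) ^ k ≤ 1 := pow_le_one₀ (by linarith [hq.2]) (by linarith [hq.1])
  have h2 : 0 ≤ (1 - q) ^ k := pow_nonneg (by linarith [hq.2]) k
  constructor <;> linarith

lemma summable_prob_mul_pow : Summable fun k => prob π k * (1 - q) ^ k := by
  refine hasSum_prob (π := π).summable.of_nonneg_of_le
    (fun k => mul_nonneg (prob_nonneg k) (pow_nonneg (by linarith [hq.2]) k)) fun k => ?_
  exact mul_le_of_le_one_right (prob_nonneg k) (by linarith [(one_sub_pow_mem hq k).1])

lemma summable_reachMap : Summable fun k => prob π k * (1 - (1 - q) ^ k) := by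
  simp_rw [mul_sub, mul_one]
  exact hasSum_prob.summable.sub (summable_prob_mul_pow hq)

lemma reachMap_eq : reachMap π q = 1 - ∑' k, prob π k * (1 - q) ^ k := by
  simp_rw [reachMap, mul_sub, mul_one]
  rw [hasSum_prob.summable.tsum_sub (summable_prob_mul_pow hq), hasSum_prob.tsum_eq]

lemma summable_deriv (htop : mean π ≠ ∞) :
    Summable fun k : ℕ => k * prob π k * (1 - q) ^ (k - 1) := by
  refine (hasSum_mul_prob htop).summable.of_nonneg_of_le (fun k => ?_) fun k => ?_
  · exact mul_nonneg (mul_nonneg k.cast_nonneg (prob_nonneg k)) (pow_nonneg (by linarith [hq.2]) _)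
  · exact mul_le_of_le_one_right (mul_nonneg k.cast_nonneg (prob_nonneg k))
      (by linarith [(one_sub_pow_mem hq (k - 1)).1])

lemma one_sub_pow_le (k : ℕ) : 1 - (1 - q) ^ k ≤ k * q := by
  have := one_add_mul_le_pow (a := -q) (by linarith [hq.2]) k
  rw [← sub_eq_add_neg] at this
  linarith

lemma one_sub_pow_lt (h : 0 < q) {k : ℕ} (hk : 2 ≤ k) : 1 - (1 - q) ^ k < k * q := by
  obtain ⟨k, rfl⟩ := Nat.exists_eq_add_of_le' hk
  have h1 := one_sub_pow_le hq (k + 1)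
  have h2 : (1 - q) ^ (k + 2) = (1 - q) ^ (k + 1) - q * (1 - q) ^ (k + 1) := by ring
  have h3 : (1 - q) ^ (k + 1) < 1 := pow_lt_one₀ (by linarith [hq.2]) (by linarith) (by simp)
  push_cast at *
  nlinarith

/-- Convexity of s ↦ s^k: its tangent at 1 - q lies below the value 1 at s = 1. -/
lemma mul_pow_le_one_sub_pow (k : ℕ) : q * (k * (1 - q) ^ (k - 1)) ≤ 1 - (1 - q) ^ k := by
  induction k with
  | zero => simp
  | succ k ih =>
    rcases Nat.eq_zero_or_pos k with rfl | hk
    · simp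
    · have hp : (1 - q) ^ k = (1 - q) ^ (k - 1) * (1 - q) := by
        rw [← pow_succ, Nat.sub_add_cancel hk]
      have h2 : 0 ≤ (1 - q) ^ (k - 1) := pow_nonneg (by linarith [hq.2]) _
      have h3 : (1 - q) ^ k ≤ 1 := by linarith [(one_sub_pow_mem hq k).1]
      have h4 : (1 - q) ^ k ≤ (1 - q) ^ (k - 1) := by rw [hp]; nlinarith [hq.1]
      have h5 : (k : ℝ) * (1 - q) ^ k ≤ k * (1 - q) ^ (k - 1) :=
        mul_le_mul_of_nonneg_left h4 k.cast_nonneg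
      rw [Nat.add_sub_cancel, pow_succ]
      push_cast
      nlinarith [mul_le_mul_of_nonneg_left h5 hq.1]

lemma mul_pow_lt_one_sub_pow (h : 0 < q) {k : ℕ} (hk : 2 ≤ k) :
    q * (k * (1 - q) ^ (k - 1)) < 1 - (1 - q) ^ k := by
  obtain ⟨k, rfl⟩ := Nat.exists_eq_add_of_le' hk
  have h1 := mul_pow_le_one_sub_pow hq (k + 1)
  have h3 : (1 - q) ^ (k + 1) < 1 := pow_lt_one₀ (by linarith [hq.2]) (by linarith) (by simp)
  have h4 := mul_le_mul_of_nonneg_left h1 (show 0 ≤ 1 - q by linarith [hq.2])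
  have h5 := mul_lt_mul_of_pos_left h3 h
  have h6 : (1 - q) ^ (k + 1) = (1 - q) ^ k * (1 - q) := pow_succ _ _
  have h7 : (1 - q) ^ (k + 2) = (1 - q) ^ k * (1 - q) * (1 - q) := by ring
  rw [Nat.add_sub_cancel] at h4
  rw [show k + 2 - 1 = k + 1 by omega, h7]
  rw [h6] at h4 h5 ⊢
  push_cast at *
  linarith

lemma reachMap_le (htop : mean π ≠ ∞) : reachMap π q ≤ (mean π).toReal * q := by
  rw [← (hasSum_mul_prob htop).tsum_eq, ← tsum_mul_right]
  refine (summable_reachMap hq).tsum_le_tsum (fun k => ?_)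
    ((hasSum_mul_prob htop).summable.mul_right q)
  have := mul_le_mul_of_nonneg_left (one_sub_pow_le hq k) (prob_nonneg (π := π) k)
  linarith

lemma reachMap_lt (htop : mean π ≠ ∞) (h : 0 < q) {k : ℕ} (hk : 2 ≤ k) (hk' : 0 < prob π k) :
    reachMap π q < (mean π).toReal * q := by
  rw [← (hasSum_mul_prob htop).tsum_eq, ← tsum_mul_right]
  refine Summable.tsum_lt_tsum (i := k) (fun k => ?_) ?_ (summable_reachMap hq)
    ((hasSum_mul_prob htop).summable.mul_right q)
  · have := mul_le_mul_of_nonneg_left (one_sub_pow_le hq k) (prob_nonneg (π := π) k)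
    linarith
  · have := mul_lt_mul_of_pos_left (one_sub_pow_lt hq h hk) hk'
    linarith

/-- This is 1 - f(1 - q) ≥ q f'(1 - q). The same inequality drives survival for m > 1, the exclusion
of thin trees and the divergence for m = 1. -/
lemma le_reachMap (htop : mean π ≠ ∞) :
    q * ∑' k : ℕ, k * prob π k * (1 - q) ^ (k - 1) ≤ reachMap π q := by
  rw [← tsum_mul_left]
  refine ((summable_deriv hq htop).mul_left q).tsum_le_tsum (fun k => ?_) (summable_reachMap hq)
  have := mul_le_mul_of_nonneg_left (mul_pow_le_one_sub_pow hq k) (prob_nonneg (π := π) k)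
  linarith

lemma lt_reachMap (htop : mean π ≠ ∞) (h : 0 < q) {k : ℕ} (hk : 2 ≤ k) (hk' : 0 < prob π k) :
    q * ∑' k : ℕ, k * prob π k * (1 - q) ^ (k - 1) < reachMap π q := by
  rw [← tsum_mul_left]
  refine Summable.tsum_lt_tsum (i := k) (fun k => ?_) ?_ ((summable_deriv hq htop).mul_left q)
    (summable_reachMap hq)
  · have := mul_le_mul_of_nonneg_left (mul_pow_le_one_sub_pow hq k) (prob_nonneg (π := π) k)
    linarith
  · have := mul_lt_mul_of_pos_left (mul_pow_lt_one_sub_pow hq h hk) hk'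
    linarith

/-- Keep just one child whenever there is one. Iteration gives the geometric lower bound for
`reachProb`. -/
lemma one_sub_prob_zero_mul_le : (1 - prob π 0) * q ≤ reachMap π q := by
  have h1 : HasSum (fun k => if k = 0 then 0 else prob π k) (1 - prob π 0) := by
    have := hasSum_prob (π := π).update 0 0
    convert! this using 1
    · ext k
      by_cases hk : k = 0
      · subst hk; simp
      · simp [hk]
    · ring
  rw [← h1.tsum_eq, ← tsum_mul_right]
  refine (h1.summable.mul_right q).tsum_le_tsum (fun k => ?_) (summable_reachMap hq)
  rcases Nat.eq_zero_or_pos k with rfl | hk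
  · simp
  · simp only [hk.ne', if_false]
    refine mul_le_mul_of_nonneg_left ?_ (prob_nonneg k)
    have : (1 - q) ^ k ≤ (1 - q) ^ 1 :=
      pow_le_pow_of_le_one (by linarith [hq.2]) (by linarith [hq.1]) hk
    linarith

end reachMap

lemma real_exists_sub {A : Set (List ℕ → ℕ)} (hA : MeasurableSet A) :
    (gw π).real {y | ∃ j < y [], sub y j ∈ A} = reachMap π ((gw π).real A) := by
  have hq : (gw π).real A ∈ Icc (0 : ℝ) 1 := ⟨measureReal_nonneg, measureReal_le_one⟩
  have hm : MeasurableSet {y : List ℕ → ℕ | ∃ j < y [], sub y j ∈ A} := by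
    have : {y : List ℕ → ℕ | ∃ j < y [], sub y j ∈ A} =
        ⋃ j, {y : List ℕ → ℕ | j < y []} ∩ (sub · j) ⁻¹' A := by ext; simp
    rw [this]
    exact MeasurableSet.iUnion fun j =>
      (measurableSet_lt measurable_const (measurable_pi_apply [])).inter (measurable_sub j hA)
  have hc : {y : List ℕ → ℕ | ∃ j < y [], sub y j ∈ A}ᶜ = {y | ∀ j < y [], sub y j ∈ Aᶜ} := by
    ext; simp
  have h1 := gw_forall_sub π hA.compl
  have h2 : (gw π).real {y | ∀ j < y [], sub y j ∈ Aᶜ} =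
      ∑' k, prob π k * (1 - (gw π).real A) ^ k := by
    rw [measureReal_def, h1, ENNReal.tsum_toReal_eq]
    · simp_rw [ENNReal.toReal_mul, ENNReal.toReal_pow, ← measureReal_def, probReal_compl_eq_one_sub hA]
      rfl
    · intro k
      exact ENNReal.mul_ne_top (π.apply_ne_top k) (ENNReal.pow_ne_top (measure_ne_top _ _))
  rw [reachMap_eq hq, ← h2, ← hc, probReal_compl_eq_one_sub hm]
  ring

lemma reachProb_zero : reachProb π 0 = 1 := by simp [reachProb, reaches_zero]

lemma reachProb_succ (n : ℕ) : reachProb π (n + 1) = reachMap π (reachProb π n) := by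
  rw [reachProb, reachProb, ← real_exists_sub (measurableSet_reaches n)]
  simp_rw [reaches_succ]
  rfl

lemma survProb_eq : survProb π = reachMap π (survProb π) := by
  conv_rhs => rw [survProb, ← real_exists_sub measurableSet_surv]
  rw [survProb]
  congr 1
  ext y
  exact surv_iff y

lemma survProb_le_reachProb (n : ℕ) : survProb π ≤ reachProb π n :=
  measureReal_mono fun _ h => h n

lemma tendsto_reachProb : Filter.Tendsto (reachProb π) Filter.atTop (nhds (survProb π)) := by
  have h := tendsto_measure_iInter_atTop (μ := gw π) (s := fun n => {y | Reaches n y})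
    (fun n => (measurableSet_reaches n).nullMeasurableSet) (fun m n hmn y h => Reaches.mono hmn h)
    ⟨0, measure_ne_top _ _⟩
  have h1 : ⋂ n, {y | Reaches n y} = {y | Surv y} := by ext; simp [Surv]
  rw [h1] at h
  exact (ENNReal.tendsto_toReal (measure_ne_top _ _)).comp h

lemma pow_le_reachProb (h0 : mean π ≠ 0) (n : ℕ) : (1 - prob π 0) ^ n ≤ reachProb π n := by
  induction n with
  | zero => simp [reachProb_zero]
  | succ n ih =>
    rw [reachProb_succ, pow_succ']
    exact (mul_le_mul_of_nonneg_left ih (by linarith [prob_zero_lt_one h0])).trans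
      (one_sub_prob_zero_mul_le (reachProb_mem n))

lemma reachProb_pos (h0 : mean π ≠ 0) (n : ℕ) : 0 < reachProb π n :=
  (pow_pos (by linarith [prob_zero_lt_one h0]) n).trans_le (pow_le_reachProb h0 n)

lemma reachProb_le_pow (htop : mean π ≠ ∞) (n : ℕ) : reachProb π n ≤ (mean π).toReal ^ n := by
  induction n with
  | zero => simp [reachProb_zero]
  | succ n ih =>
    rw [reachProb_succ, pow_succ']
    exact (reachMap_le (reachProb_mem n) htop).trans
      (mul_le_mul_of_nonneg_left ih ENNReal.toReal_nonneg)

lemma mean_eq_of_forall (h : ∀ k, 2 ≤ k → prob π k = 0) : mean π = π 1 := by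
  rw [mean, tsum_eq_single 1]
  · simp
  · intro k hk
    rcases Nat.lt_or_ge k 2 with h2 | h2
    · obtain rfl : k = 0 := by omega
      simp
    · rw [← ofReal_prob, h k h2]; simp

lemma exists_prob_pos (h : mean π ≠ π 1) : ∃ k, 2 ≤ k ∧ 0 < prob π k := by
  by_contra! hc
  exact h (mean_eq_of_forall fun k hk => le_antisymm (hc k hk) (prob_nonneg k))

/-- A positive fixed point of `reachMap` would violate `reachMap_le` when m < 1, and its strict form
when m = 1, since then π charges some k ≥ 2. -/
theorem survProb_eq_zero (hm : mean π ≤ 1) (h1 : π 1 ≠ 1) : survProb π = 0 := by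
  have htop : mean π ≠ ∞ := ne_top_of_le_ne_top ENNReal.one_ne_top hm
  have hmr : (mean π).toReal ≤ 1 := by
    simpa using ENNReal.toReal_mono ENNReal.one_ne_top hm
  by_contra hs
  have hs : 0 < survProb π := lt_of_le_of_ne survProb_mem.1 (Ne.symm hs)
  rcases hm.lt_or_eq with hlt | heq
  · have h2 := reachMap_le (π := π) (survProb_mem (π := π)) htop
    rw [← survProb_eq] at h2
    have : (mean π).toReal < 1 := by
      simpa using (ENNReal.toReal_lt_toReal htop ENNReal.one_ne_top).2 hlt
    nlinarith
  · obtain ⟨k, hk, hk'⟩ := exists_prob_pos (heq.trans_ne h1.symm)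
    have h2 := reachMap_lt survProb_mem htop hs hk hk'
    rw [← survProb_eq] at h2
    nlinarith

/-- If q_n → 0, then eventually f'(1 - q_n) > 1 and q_{n+1} ≥ q_n; a positive sequence that is
eventually nondecreasing does not tend to 0. -/
theorem survProb_pos (hm : 1 < mean π) (htop : mean π ≠ ∞) : 0 < survProb π := by
  by_contra hs
  have hs : survProb π = 0 := le_antisymm (not_lt.1 hs) survProb_mem.1
  have hlim := tendsto_reachProb (π := π)
  rw [hs] at hlim
  have hmr : 1 < (mean π).toReal := by
    simpa using (ENNReal.toReal_lt_toReal ENNReal.one_ne_top htop).2 hm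
  -- A finite part of the series for m already exceeds 1; its counterpart in f' is a polynomial, so
  -- continuity at 0 is immediate.
  obtain ⟨F, hF⟩ := (((hasSum_mul_prob htop).eventually (lt_mem_nhds hmr))).exists
  have hcont : Continuous fun q : ℝ => ∑ k ∈ F, k * prob π k * (1 - q) ^ (k - 1) := by fun_prop
  have h1 : ∀ᶠ n in Filter.atTop, 1 < ∑ k ∈ F, k * prob π k * (1 - reachProb π n) ^ (k - 1) := by
    refine ((hcont.tendsto 0).comp hlim).eventually (lt_mem_nhds ?_)
    simpa using hF
  obtain ⟨N, hN⟩ := Filter.eventually_atTop.1 h1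
  have hmono : ∀ n ≥ N, reachProb π N ≤ reachProb π n := by
    intro n hn
    induction n, hn using Nat.le_induction with
    | base => exact le_rfl
    | succ n hn ih =>
      refine ih.trans ?_
      rw [reachProb_succ]
      refine le_trans ?_ (le_reachMap (reachProb_mem n) htop)
      refine le_mul_of_one_le_right (reachProb_mem n).1 ((hN n hn).le.trans ?_)
      refine (summable_deriv (reachProb_mem n) htop).sum_le_tsum F fun k _ => ?_
      exact mul_nonneg (mul_nonneg k.cast_nonneg (prob_nonneg k))
        (pow_nonneg (by linarith [(reachProb_mem (π := π) n).2]) _)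
  have := ge_of_tendsto hlim (Filter.eventually_atTop.2 ⟨N, hmono⟩)
  exact absurd this (not_le.2 (reachProb_pos (by rintro h; simp [h] at hm) N))

/-- The tree survives, with a single surviving vertex in each generation. -/
def IsThin (y : List ℕ → ℕ) : Prop :=
  Surv y ∧ ∀ w w' : List ℕ, w.length = w'.length → IsGW y w → IsGW y w' →
    Surv (fun u => y (u ++ w)) → Surv (fun u => y (u ++ w')) → w = w'

lemma measurableSet_isThin : MeasurableSet {y | IsThin y} := by
  have h (w : List ℕ) : MeasurableSet {y : List ℕ → ℕ | Surv fun u => y (u ++ w)} :=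
    (show Measurable fun (y : List ℕ → ℕ) u => y (u ++ w) by fun_prop) measurableSet_surv
  simp only [IsThin, measurableSet_setOfPred] at *
  refine Measurable.and (measurableSet_setOfPred.1 measurableSet_surv) <|
    Measurable.forall fun w => Measurable.forall fun w' => Measurable.imp measurable_const <|
    Measurable.imp (measurableSet_setOfPred.1 (measurableSet_isGW w)) <|
    Measurable.imp (measurableSet_setOfPred.1 (measurableSet_isGW w')) <|
    Measurable.imp (h w) <| Measurable.imp (h w') measurable_const

lemma IsThin.exists_sub {y : List ℕ → ℕ} (h : IsThin y) :
    ∃ j < y [], IsThin (sub y j) ∧ ∀ i < y [], i ≠ j → ¬ Surv (sub y i) := by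
  obtain ⟨j, hj, hs⟩ := (surv_iff y).1 h.1
  refine ⟨j, hj, ⟨hs, fun w w' hl hw hw' hsw hsw' => ?_⟩, fun i hi hij hsi => ?_⟩
  · have := h.2 (w ++ [j]) (w' ++ [j]) (by simp [hl]) ((isGW_snoc _ _ _).2 ⟨hj, hw⟩)
      ((isGW_snoc _ _ _).2 ⟨hj, hw'⟩) (by simpa [sub] using hsw) (by simpa [sub] using hsw')
    exact (List.append_inj' this rfl).1
  · have := h.2 [i] [j] rfl ⟨trivial, hi⟩ ⟨trivial, hj⟩ hsi hs
    simp_all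

/-- In a thin tree exactly one child survives, and its subtree is thin, so the probability t
satisfies t ≤ t f'(1 - s). Here f'(1 - s) < 1 because s f'(1 - s) < 1 - f(1 - s) = s. -/
theorem gw_isThin (hm : 1 < mean π) (htop : mean π ≠ ∞) : gw π {y | IsThin y} = 0 := by
  have hs := survProb_pos hm htop
  have hne : mean π ≠ π 1 := (lt_of_le_of_lt (π.coe_le_one 1) hm).ne'
  obtain ⟨k, hk, hk'⟩ := exists_prob_pos hne
  have h1 := lt_reachMap survProb_mem htop hs hk hk'
  rw [← survProb_eq] at h1
  have h2 : ∑' k : ℕ, k * prob π k * (1 - survProb π) ^ (k - 1) < 1 := by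
    by_contra! hc
    nlinarith
  have h3 : (gw π).real {y | IsThin y} ≤ (gw π).real {y | IsThin y} *
      ∑' k : ℕ, k * prob π k * (1 - survProb π) ^ (k - 1) := by
    have hle : gw π {y | IsThin y} ≤ ∑' k : ℕ, π k * (k * (gw π {y | IsThin y} *
        gw π {y | Surv y}ᶜ ^ (k - 1))) :=
      (measure_mono fun y hy => IsThin.exists_sub hy).trans
        (gw_exists_sub_le π measurableSet_isThin measurableSet_surv.compl)
    have heq (k : ℕ) : π k * (k * (gw π {y | IsThin y} * gw π {y | Surv y}ᶜ ^ (k - 1))) =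
        ENNReal.ofReal ((gw π).real {y | IsThin y} *
          (k * prob π k * (1 - survProb π) ^ (k - 1))) := by
      have e1 : gw π {y | Surv y}ᶜ = ENNReal.ofReal (1 - survProb π) := by
        rw [survProb, ← probReal_compl_eq_one_sub measurableSet_surv, ofReal_measureReal]
      have h0 : 0 ≤ 1 - survProb π := by linarith [(survProb_mem (π := π)).2]
      have h0' := prob_nonneg (π := π) k
      rw [ENNReal.ofReal_mul measureReal_nonneg, ENNReal.ofReal_mul (by positivity),
        ENNReal.ofReal_mul (by positivity), ofReal_measureReal, ofReal_prob,
        ENNReal.ofReal_pow h0, ENNReal.ofReal_natCast, e1]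
      ring
    simp_rw [heq] at hle
    have hsum := (summable_deriv (π := π) (survProb_mem (π := π)) htop).mul_left ((gw π).real {y | IsThin y})
    have hnn : ∀ k : ℕ, 0 ≤ (gw π).real {y | IsThin y} *
        (k * prob π k * (1 - survProb π) ^ (k - 1)) := fun k => by
      have h0 : 0 ≤ 1 - survProb π := by linarith [(survProb_mem (π := π)).2]
      have h0' := prob_nonneg (π := π) k
      positivity
    rw [← ENNReal.ofReal_tsum_of_nonneg hnn hsum, tsum_mul_left] at hle
    refine ENNReal.toReal_le_of_le_ofReal ?_ hle
    exact mul_nonneg measureReal_nonneg (tsum_nonneg fun k => by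
      have h0 : 0 ≤ 1 - survProb π := by linarith [(survProb_mem (π := π)).2]
      have h0' := prob_nonneg (π := π) k
      positivity)
  have h4 : (gw π).real {y | IsThin y} = 0 := by
    have := measureReal_nonneg (μ := gw π) (s := {y | IsThin y})
    nlinarith
  exact (measureReal_eq_zero_iff).1 h4

end survival

end EGW

namespace EGW

variable {π : PMF ℕ} (h0 : mean π ≠ 0) (htop : mean π ≠ ∞)

/-! ### The series of the probabilities of `Branches` -/

/-- Given k children, the k - 1 of them off the path independently fail to reach depth n; summing
over the position of the path restores the factor k. -/
theorem branchProb_eq (n : ℕ) : branchProb h0 htop n = ∑' k : ℕ, ENNReal.ofReal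
    (k * prob π k / (mean π).toReal * (1 - (1 - reachProb π n) ^ (k - 1))) := by
  have hmpos : 0 < (mean π).toReal := ENNReal.toReal_pos h0 htop
  rw [branchProb, Measure.prod_apply (measurableSet_branches n), lintegral_countable']
  have hc (c : Σ k, Fin k) : gw π (Prod.mk c ⁻¹' {c | Branches n c}) =
      ENNReal.ofReal (1 - (1 - reachProb π n) ^ (c.1 - 1)) := by
    have h1 := gw_sub π ((Finset.range c.1).erase c.2) (A := fun _ => {y | Reaches n y}ᶜ)
      fun _ => (measurableSet_reaches n).compl
    rw [Finset.prod_const, Finset.card_erase_of_mem (Finset.mem_range.2 c.2.2),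
      Finset.card_range] at h1
    have h2 : Prod.mk c ⁻¹' {c | Branches n c} =
        {y | ∀ j ∈ (Finset.range c.1).erase c.2, sub y j ∈ {y | Reaches n y}ᶜ}ᶜ := by
      ext y
      simp only [Branches, mem_preimage, mem_ofPred_eq, mem_compl_iff, Finset.mem_erase,
        Finset.mem_range]
      push Not
      exact exists_congr fun j => by tauto
    have h3 : MeasurableSet (Prod.mk c ⁻¹' {c | Branches n c}) :=
      measurable_prodMk_left (measurableSet_branches n)
    rw [← ofReal_measureReal]
    congr 1
    have h4 := probReal_compl_eq_one_sub (μ := gw π) h3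
    have h5 : (gw π).real (Prod.mk c ⁻¹' {c | Branches n c})ᶜ =
        (1 - reachProb π n) ^ (c.1 - 1) := by
      rw [h2, compl_compl, measureReal_def, h1, ENNReal.toReal_pow, ← measureReal_def,
        probReal_compl_eq_one_sub (measurableSet_reaches n)]
      rfl
    linarith
  simp_rw [hc, (spineLaw π h0 htop).toMeasure_apply_singleton _ .of_discrete]
  simp_rw [mul_comm (ENNReal.ofReal (1 - (1 - reachProb π n) ^ (Sigma.fst _ - 1)))]
  rw [tsum_spineLaw_mul h0 htop fun c =>
    ENNReal.ofReal (1 - (1 - reachProb π n) ^ (c.1 - 1))]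
  refine tsum_congr fun k => ?_
  have hk := prob_nonneg (π := π) k
  dsimp only
  rw [Finset.sum_const, Finset.card_fin, nsmul_eq_mul, ENNReal.ofReal_mul
    (by positivity), ENNReal.ofReal_div_of_pos hmpos, ENNReal.ofReal_mul (by positivity),
    ENNReal.ofReal_natCast, ofReal_prob, ENNReal.ofReal_toReal htop]
  simp only [div_eq_mul_inv]
  ring

include htop in
lemma summable_branch (n : ℕ) : Summable fun k : ℕ =>
    k * prob π k / (mean π).toReal * (1 - (1 - reachProb π n) ^ (k - 1)) := by
  have hp := prob_nonneg (π := π)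
  refine ((hasSum_mul_prob htop).summable.div_const (mean π).toReal).of_nonneg_of_le
    (fun k => ?_) fun k => ?_
  · have := hp k
    exact mul_nonneg (by positivity) (one_sub_pow_mem (reachProb_mem n) _).1
  · have := hp k
    exact mul_le_of_le_one_right (by positivity) (one_sub_pow_mem (reachProb_mem n) _).2

lemma toReal_branchProb (n : ℕ) : (branchProb h0 htop n).toReal =
    1 - (∑' k : ℕ, k * prob π k * (1 - reachProb π n) ^ (k - 1)) / (mean π).toReal := by
  have hmpos : 0 < (mean π).toReal := ENNReal.toReal_pos h0 htop
  have hp := prob_nonneg (π := π)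
  rw [branchProb_eq, ← ENNReal.ofReal_tsum_of_nonneg _ (summable_branch htop n),
    ENNReal.toReal_ofReal]
  · have h1 := summable_deriv (π := π) (reachProb_mem (π := π) n) htop
    have h2 : ∀ k : ℕ, k * prob π k / (mean π).toReal * (1 - (1 - reachProb π n) ^ (k - 1)) =
        (k * prob π k - k * prob π k * (1 - reachProb π n) ^ (k - 1)) / (mean π).toReal := by
      intro k; ring
    simp_rw [h2]
    rw [tsum_div_const, (hasSum_mul_prob htop).summable.tsum_sub h1, (hasSum_mul_prob htop).tsum_eq,
      sub_div, div_self hmpos.ne']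
  · refine tsum_nonneg fun k => ?_
    have := hp k
    exact mul_nonneg (by positivity) (one_sub_pow_mem (reachProb_mem n) _).1
  · intro k
    have := hp k
    exact mul_nonneg (by positivity) (one_sub_pow_mem (reachProb_mem n) _).1

/-- For m = 1 convexity reads q_{n+1} ≥ q_n (1 - p_n). Summability of p_n would keep q_n away from
0, contradicting extinction. -/
theorem tsum_branchProb_of_mean_eq_one (hm : mean π = 1) (h1 : π 1 ≠ 1) :
    ∑' n, branchProb h0 htop n = ∞ := by
  by_contra hne
  set p : ℕ → ℝ := fun n => (branchProb h0 htop n).toReal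
  have hp : Summable p := ENNReal.summable_toReal hne
  have hstep (n : ℕ) : reachProb π n * (1 - p n) ≤ reachProb π (n + 1) := by
    rw [reachProb_succ]
    refine le_trans (le_of_eq ?_) (le_reachMap (reachProb_mem n) htop)
    simp [p, toReal_branchProb, hm]
  have hp0 : ∀ n, 0 ≤ p n := fun n => ENNReal.toReal_nonneg
  obtain ⟨N, hN⟩ := ((tendsto_sum_nat_add p).eventually (gt_mem_nhds one_half_pos)).exists
  have hsumm : Summable fun k => p (k + N) := (summable_nat_add_iff N).2 hp
  have hpart (n : ℕ) : ∑ k ∈ Finset.range n, p (k + N) ≤ 1 / 2 :=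
    (hsumm.sum_le_tsum _ fun k _ => hp0 _).trans hN.le
  -- From an index N with tail sum below 1/2, a product of factors 1 - p is at least 1 minus their
  -- sum.
  have hlow (n : ℕ) : reachProb π N * (1 - ∑ k ∈ Finset.range n, p (k + N)) ≤
      reachProb π (n + N) := by
    induction n with
    | zero => simp
    | succ n ih =>
      rw [Finset.sum_range_succ, show n + 1 + N = n + N + 1 by ring]
      refine le_trans ?_ (hstep (n + N))
      have hpn := hp0 (n + N)
      have h2 := hpart (n + 1)
      rw [Finset.sum_range_succ] at h2
      have h3 : 0 ≤ ∑ k ∈ Finset.range n, p (k + N) := Finset.sum_nonneg fun k _ => hp0 _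
      have h4 := mul_le_mul_of_nonneg_right ih (show 0 ≤ 1 - p (n + N) by linarith)
      refine le_trans ?_ h4
      have := reachProb_pos h0 N
      nlinarith [mul_nonneg this.le (mul_nonneg h3 hpn)]
  have hlim : Filter.Tendsto (fun n => reachProb π (n + N)) Filter.atTop (nhds 0) := by
    have := tendsto_reachProb (π := π)
    rw [survProb_eq_zero hm.le h1] at this
    exact this.comp (Filter.tendsto_add_atTop_nat N)
  have h6 : reachProb π N * (1 / 2) ≤ 0 := by
    refine ge_of_tendsto' hlim fun n => le_trans ?_ (hlow n)
    have := reachProb_pos h0 N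
    have := hpart n
    nlinarith
  linarith [reachProb_pos h0 N]

/-- A single k ≥ 2 charged by π contributes at least a fixed multiple of the survival probability to
every term. -/
theorem tsum_branchProb_of_one_lt_mean (hm : 1 < mean π) :
    ∑' n, branchProb h0 htop n = ∞ := by
  have hmpos : 0 < (mean π).toReal := ENNReal.toReal_pos h0 htop
  obtain ⟨k, hk, hk'⟩ := exists_prob_pos (π := π) (lt_of_le_of_lt (π.coe_le_one 1) hm).ne'
  have hs := survProb_pos hm htop
  set c := k * prob π k / (mean π).toReal * survProb π
  have hc : 0 < c := by
    have : (0 : ℝ) < k := by exact_mod_cast (by omega : 0 < k)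
    positivity
  have hle (n : ℕ) : ENNReal.ofReal c ≤ branchProb h0 htop n := by
    rw [branchProb_eq]
    refine le_trans (ENNReal.ofReal_le_ofReal ?_) (ENNReal.le_tsum k)
    refine mul_le_mul_of_nonneg_left ?_ (by positivity)
    have hq := reachProb_mem (π := π) n
    have : (1 - reachProb π n) ^ (k - 1) ≤ (1 - reachProb π n) ^ 1 :=
      pow_le_pow_of_le_one (by linarith [hq.2]) (by linarith [hq.1]) (by omega)
    have := survProb_le_reachProb (π := π) n
    linarith
  refine top_unique (le_trans (le_of_eq ?_) (ENNReal.tsum_le_tsum hle))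
  exact (ENNReal.tsum_const_eq_top_of_ne_zero (ENNReal.ofReal_pos.2 hc).ne').symm

/-! ### Subcritical case: the series and the k log k condition -/

section subcritical

/-- An upper bound of a truncated geometric series. -/
lemma tsum_min_pow_le {m : ℝ} (hm0 : 0 < m) (hm1 : m < 1) {k : ℕ} (hk : 1 ≤ k) :
    ∑' n : ℕ, ENNReal.ofReal (min 1 (k * m ^ n)) ≤
      ENNReal.ofReal (Real.log k / Real.log m⁻¹ + 1 + (1 - m)⁻¹) := by
  have hL : 0 < Real.log m⁻¹ := Real.log_pos ((one_lt_inv₀ hm0).2 hm1)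
  have hk0 : (0 : ℝ) < k := by exact_mod_cast hk
  have hlogk : 0 ≤ Real.log k := Real.log_nonneg (by exact_mod_cast hk)
  -- From `N` on, k m^n ≤ 1: the earlier terms are bounded by 1, the later ones by a geometric
  -- series.
  set N := ⌈Real.log k / Real.log m⁻¹⌉₊
  have hN1 : (N : ℝ) ≤ Real.log k / Real.log m⁻¹ + 1 :=
    (Nat.ceil_lt_add_one (by positivity)).le
  have hN2 : k * m ^ N ≤ 1 := by
    have h1 : Real.log k ≤ N * Real.log m⁻¹ := (div_le_iff₀ hL).1 (Nat.le_ceil _)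
    rw [← Real.log_pow, Real.log_le_log_iff hk0 (by positivity), inv_pow] at h1
    calc k * m ^ N ≤ (m ^ N)⁻¹ * m ^ N := by gcongr
      _ = 1 := inv_mul_cancel₀ (by positivity)
  rw [← ENNReal.summable.sum_add_tsum_nat_add' (k := N)]
  have h1 : ∑ n ∈ Finset.range N, ENNReal.ofReal (min 1 (k * m ^ n)) ≤ ENNReal.ofReal N := by
    rw [ENNReal.ofReal_natCast]
    calc _ ≤ ∑ n ∈ Finset.range N, (1 : ℝ≥0∞) := Finset.sum_le_sum fun n _ => by
          rw [← ENNReal.ofReal_one]; exact ENNReal.ofReal_le_ofReal (min_le_left _ _)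
      _ = N := by simp
  have h2 : ∑' n, ENNReal.ofReal (min 1 (k * m ^ (n + N))) ≤ ENNReal.ofReal (1 - m)⁻¹ := by
    rw [← (hasSum_geometric_of_lt_one hm0.le hm1).tsum_eq, ENNReal.ofReal_tsum_of_nonneg
      (fun n => by positivity) (summable_geometric_of_lt_one hm0.le hm1)]
    refine ENNReal.tsum_le_tsum fun n => ENNReal.ofReal_le_ofReal ((min_le_right _ _).trans ?_)
    rw [pow_add]
    have : 0 < m ^ n := by positivity
    nlinarith
  refine (add_le_add h1 h2).trans ?_
  have h3 : (0 : ℝ) < 1 - m := by linarith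
  rw [← ENNReal.ofReal_add (by positivity) (by positivity)]
  exact ENNReal.ofReal_le_ofReal (by linarith)

/-- As long as (k - 1) a^n ≥ 1, the n-th term is at least 1 - 1/e ≥ 1/2, and this holds for about
log (k - 1) / log a⁻¹ values of n. For k < 2 the left side vanishes. -/
lemma le_tsum_one_sub_pow {a : ℝ} (ha0 : 0 < a) (ha1 : a < 1) (k : ℕ) :
    ENNReal.ofReal ((Real.log k - Real.log 2) / (2 * Real.log a⁻¹)) ≤
      ∑' n : ℕ, ENNReal.ofReal (1 - (1 - a ^ n) ^ (k - 1)) := by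
  have hL : 0 < Real.log a⁻¹ := Real.log_pos ((one_lt_inv₀ ha0).2 ha1)
  rcases Nat.lt_or_ge k 2 with hk | hk
  · have h2 : Real.log k ≤ 0 := by
      interval_cases k <;> simp
    rw [ENNReal.ofReal_of_nonpos]
    · exact zero_le
    · exact div_nonpos_of_nonpos_of_nonneg (by linarith [Real.log_pos one_lt_two]) (by positivity)
  obtain ⟨k, rfl⟩ := Nat.exists_eq_add_of_le' (show 1 ≤ k by omega)
  have hk1 : (1 : ℝ) ≤ k := by exact_mod_cast (by omega : 1 ≤ k)
  have hk0 : (0 : ℝ) < k := by linarith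
  have hlogk : 0 ≤ Real.log k := Real.log_nonneg hk1
  rw [Nat.add_sub_cancel]
  set N := ⌊Real.log k / Real.log a⁻¹⌋₊
  have hterm : ∀ n ∈ Finset.range (N + 1),
      ENNReal.ofReal (1 / 2) ≤ ENNReal.ofReal (1 - (1 - a ^ n) ^ k) := by
    intro n hn
    refine ENNReal.ofReal_le_ofReal ?_
    have hn' : (n : ℝ) ≤ Real.log k / Real.log a⁻¹ :=
      (Nat.cast_le.2 (Nat.lt_succ_iff.1 (Finset.mem_range.1 hn))).trans (Nat.floor_le (by positivity))
    have h1 : n * Real.log a⁻¹ ≤ Real.log k := (le_div_iff₀ hL).1 hn'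
    rw [← Real.log_pow, Real.log_le_log_iff (by positivity) hk0, inv_pow] at h1
    have h2 : 1 ≤ a ^ n * k := by
      calc (1 : ℝ) = a ^ n * (a ^ n)⁻¹ := (mul_inv_cancel₀ (by positivity)).symm
        _ ≤ a ^ n * k := by gcongr
    have han : a ^ n ≤ 1 := pow_le_one₀ ha0.le ha1.le
    have h3 : (1 - a ^ n) ^ k ≤ Real.exp (-1) := by
      calc (1 - a ^ n) ^ k ≤ Real.exp (-a ^ n) ^ k := by
            refine pow_le_pow_left₀ (by linarith) ?_ k
            have := Real.add_one_le_exp (-a ^ n)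
            linarith
        _ = Real.exp (-(a ^ n * k)) := by rw [← Real.exp_nat_mul]; ring_nf
        _ ≤ _ := Real.exp_le_exp.2 (by linarith)
    have h4 : Real.exp (-1) ≤ 1 / 2 := by
      rw [Real.exp_neg, one_div]
      refine inv_anti₀ two_pos ?_
      have := Real.add_one_le_exp (1 : ℝ)
      linarith
    linarith
  have hsum := Finset.sum_le_sum hterm
  refine le_trans ?_ (hsum.trans (ENNReal.sum_le_tsum _))
  rw [Finset.sum_const, Finset.card_range, nsmul_eq_mul, ← ENNReal.ofReal_natCast,
    ← ENNReal.ofReal_mul (by positivity)]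
  refine ENNReal.ofReal_le_ofReal ?_
  have hN : Real.log k / Real.log a⁻¹ ≤ N + 1 := (Nat.lt_floor_add_one _).le
  -- Here `k` stands for the original k minus 1; the term log 2 pays for the shift, by k + 1 ≤ 2k.
  have h5 : Real.log (k + 1 : ℕ) - Real.log 2 ≤ Real.log k := by
    rw [← Real.log_div (by positivity) two_ne_zero]
    refine Real.log_le_log (by positivity) ?_
    push_cast
    linarith
  calc _ ≤ Real.log k / (2 * Real.log a⁻¹) := by gcongr
    _ = Real.log k / Real.log a⁻¹ * (1 / 2) := by field_simp
    _ ≤ _ := by push_cast; gcongr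

variable (hm : mean π < 1)
include hm

lemma prob_zero_pos_of_mean_lt_one : 0 < prob π 0 := by
  by_contra hc
  have h1 : prob π 0 = 0 := le_antisymm (not_lt.1 hc) (prob_nonneg 0)
  have h2 : π 0 = 0 := by rw [← ofReal_prob, h1]; simp
  refine absurd hm (not_lt.2 ?_)
  rw [← π.tsum_coe]
  refine ENNReal.tsum_le_tsum fun k => ?_
  rcases Nat.eq_zero_or_pos k with rfl | hk
  · simp [h2]
  · exact le_mul_of_one_le_left zero_le (by exact_mod_cast hk)

/-- Exchange the two sums and use q_n ≤ m^n: the inner sum over n is at most a multiple of log k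
plus a constant. -/
theorem tsum_branchProb_ne_top_of_summable
    (hsum : Summable fun k : ℕ => (k : ℝ) * Real.log k * (π k).toReal) :
    ∑' n, branchProb h0 htop n ≠ ∞ := by
  set m := (mean π).toReal
  have hm0 : 0 < m := ENNReal.toReal_pos h0 htop
  have hm1 : m < 1 := by simpa using (ENNReal.toReal_lt_toReal htop ENNReal.one_ne_top).2 hm
  have hL : 0 < Real.log m⁻¹ := Real.log_pos ((one_lt_inv₀ hm0).2 hm1)
  have hp := prob_nonneg (π := π)
  set C := 1 + (1 - m)⁻¹
  have hC : 0 ≤ C := by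
    have : 0 < 1 - m := by linarith
    positivity
  have hlog (k : ℕ) : 0 ≤ Real.log k := Real.log_natCast_nonneg k
  have hfin : ∑' k : ℕ, ENNReal.ofReal (k * prob π k / m * (Real.log k / Real.log m⁻¹ + C)) ≠ ∞ := by
    rw [← ENNReal.ofReal_tsum_of_nonneg]
    · exact ENNReal.ofReal_ne_top
    · intro k
      have := hp k
      have := hlog k
      positivity
    · have h1 := (hsum.mul_left (m⁻¹ * (Real.log m⁻¹)⁻¹)).add
        ((hasSum_mul_prob htop).summable.mul_left (m⁻¹ * C))
      refine h1.congr fun k => ?_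
      simp only [prob]
      field_simp
  refine ne_top_of_le_ne_top hfin ?_
  simp_rw [branchProb_eq]
  rw [ENNReal.tsum_comm]
  refine ENNReal.tsum_le_tsum fun k => ?_
  have hk := hp k
  rcases Nat.eq_zero_or_pos k with rfl | hk1
  · simp
  rw [ENNReal.ofReal_mul (by positivity)]
  simp_rw [ENNReal.ofReal_mul (show 0 ≤ k * prob π k / (mean π).toReal by positivity)]
  rw [ENNReal.tsum_mul_left]
  refine mul_le_mul_right (le_trans (ENNReal.tsum_le_tsum fun n => ?_)
    ((tsum_min_pow_le hm0 hm1 hk1).trans (ENNReal.ofReal_le_ofReal (by simp only [C]; linarith)))) _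
  refine ENNReal.ofReal_le_ofReal (le_min (one_sub_pow_mem (reachProb_mem n) _).2 ?_)
  have h1 := one_sub_pow_le (reachProb_mem (π := π) n) (k - 1)
  have h2 := reachProb_le_pow htop n
  have h3 : ((k - 1 : ℕ) : ℝ) ≤ k := by exact_mod_cast k.sub_le 1
  calc _ ≤ _ := h1
    _ ≤ k * m ^ n := mul_le_mul h3 h2 (reachProb_mem n).1 k.cast_nonneg

/-- Exchange the two sums and use q_n ≥ a^n with a = 1 - π_0, which lies strictly between 0 and 1
because 0 < m < 1. -/
theorem summable_of_tsum_branchProb_ne_top (hne : ∑' n, branchProb h0 htop n ≠ ∞) :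
    Summable fun k : ℕ => (k : ℝ) * Real.log k * (π k).toReal := by
  set m := (mean π).toReal
  have hm0 : 0 < m := ENNReal.toReal_pos h0 htop
  have hp := prob_nonneg (π := π)
  set a := 1 - prob π 0
  have ha0 : 0 < a := by have := prob_zero_lt_one h0; simp only [a]; linarith
  have ha1 : a < 1 := by have := prob_zero_pos_of_mean_lt_one hm; simp only [a]; linarith
  have hL : 0 < Real.log a⁻¹ := Real.log_pos ((one_lt_inv₀ ha0).2 ha1)
  have hfin : ∑' k : ℕ, ENNReal.ofReal (k * prob π k / m *
      ((Real.log k - Real.log 2) / (2 * Real.log a⁻¹))) ≠ ∞ := by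
    refine ne_top_of_le_ne_top hne ?_
    simp_rw [branchProb_eq]
    rw [ENNReal.tsum_comm]
    refine ENNReal.tsum_le_tsum fun k => ?_
    have hk := hp k
    rw [ENNReal.ofReal_mul (by positivity)]
    simp_rw [ENNReal.ofReal_mul (show 0 ≤ k * prob π k / (mean π).toReal by positivity)]
    rw [ENNReal.tsum_mul_left]
    refine mul_le_mul_right ((le_tsum_one_sub_pow ha0 ha1 k).trans
      (ENNReal.tsum_le_tsum fun n => ENNReal.ofReal_le_ofReal ?_)) _
    have h1 := pow_le_reachProb h0 n
    have h2 := (reachProb_mem (π := π) n).2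
    have : (1 - reachProb π n) ^ (k - 1) ≤ (1 - a ^ n) ^ (k - 1) :=
      pow_le_pow_left₀ (by linarith) (by linarith) _
    linarith
  have h1 := ENNReal.summable_toReal hfin
  have h2 := (h1.mul_left (m * (2 * Real.log a⁻¹))).add
    ((hasSum_mul_prob htop).summable.mul_left (Real.log 2))
  refine h2.of_nonneg_of_le (fun k => ?_) fun k => ?_
  · have := Real.log_natCast_nonneg k
    positivity
  · have hk := hp k
    have h3 : k * prob π k / m * ((Real.log k - Real.log 2) / (2 * Real.log a⁻¹)) ≤
        (ENNReal.ofReal (k * prob π k / m *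
          ((Real.log k - Real.log 2) / (2 * Real.log a⁻¹)))).toReal := by
      -- The summand is negative at k = 1; truncation at 0 only increases it.
      rw [ENNReal.toReal_ofReal']
      exact le_max_left _ _
    have h4 := mul_le_mul_of_nonneg_left h3 (show 0 ≤ m * (2 * Real.log a⁻¹) by positivity)
    have h5 : m * (2 * Real.log a⁻¹) * (k * prob π k / m *
        ((Real.log k - Real.log 2) / (2 * Real.log a⁻¹))) =
        k * prob π k * (Real.log k - Real.log 2) := by
      have := hL.ne'
      generalize Real.log a⁻¹ = l at *
      field_simp
    rw [h5] at h4
    change k * Real.log k * prob π k ≤ _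
    linarith

end subcritical

end EGW

namespace EGW

variable {π : PMF ℕ} (h0 : mean π ≠ 0) (htop : mean π ≠ ∞)

/-! ### Trees of descendants -/

lemma parent_iterate_append (d : Sample) (i : ℕ) (u w : List ℕ) (h : IsVertex d i (u ++ w))
    (h' : IsVertex d i w) :
    (parent d)^[u.length] ⟨(i, u ++ w), h⟩ = ⟨(i, w), h'⟩ := by
  induction u with
  | nil => rfl
  | cons j u ih =>
    exact ih h.1

/-- The vertices `o_i` with i ≥ 1 are excluded, as their children are governed by the spine
ingredients and not by the bush. -/
lemma isVertex_append {d : Sample} {i : ℕ} {w : List ℕ} (hw : i = 0 ∨ w ≠ [])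
    (h : IsVertex d i w) {u : List ℕ} (hu : IsGW (fun v => bush d i (v ++ w)) u) :
    IsVertex d i (u ++ w) := by
  induction u with
  | nil => exact h
  | cons j u ih =>
    have hn : numChildren d (i, u ++ w) = bush d i (u ++ w) ∧ ¬ IsSpineSlot d (i, u ++ w) j := by
      rcases i with - | i
      · cases u ++ w <;> simp [numChildren, IsSpineSlot, bush]
      · obtain ⟨l, v, hl⟩ := List.exists_cons_of_ne_nil
          (List.append_ne_nil_of_right_ne_nil u (hw.resolve_left (by simp)))
        rw [hl]
        simp [numChildren, IsSpineSlot, bush]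
    exact ⟨ih hu.1, hn.1 ▸ hu.2, hn.2⟩

lemma spine_index_le_iterate (d : Sample) (n : ℕ) (v : Vertex d) :
    v.1.1 ≤ ((parent d)^[n] v).1.1 := by
  induction n with
  | zero => exact le_rfl
  | succ n ih =>
    rw [Function.iterate_succ_apply']
    refine ih.trans ?_
    generalize (parent d)^[n] v = x
    obtain ⟨⟨i, w⟩, h⟩ := x
    cases w <;> simp [parent]

lemma finite_isVertex {d : Sample} (hd : ∀ i v, ¬ Surv fun w => bush d i (w ++ v)) (i : ℕ) :
    {w | IsVertex d i w}.Finite := by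
  rcases i with - | i
  · refine (finite_isGW (y := bush d 0) ?_).subset fun w hw => (isVertex_zero d w).1 hw
    simpa using hd 0 []
  · refine ((finite_singleton []).union ((finite_Iio (d.1 i).1).biUnion fun j _ =>
      (finite_isGW (hd (i + 1) [j])).image fun w => w ++ [j])).subset fun w hw => ?_
    rcases List.eq_nil_or_concat w with rfl | ⟨v, j, rfl⟩
    · exact .inl rfl
    · rw [List.concat_eq_append] at *
      have := (isVertex_succ_snoc d i v j).1 hw
      exact .inr (mem_biUnion (x := j) this.1.1 ⟨v, this.2, rfl⟩)

/-- Passing to a parent never lowers the index of the bush, so descendants of `v` lie in the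
finitely many finite bushes up to that of `v`. -/
lemma finite_descendants {d : Sample} (hd : ∀ i v, ¬ Surv fun w => bush d i (w ++ v))
    (v : (tree d).V) : ((tree d).descendants v).Finite := by
  refine Set.Finite.of_finite_image (f := Subtype.val) ?_ Subtype.val_injective.injOn
  refine ((finite_Iic v.1.1).biUnion fun i _ =>
    (finite_isVertex hd i).image (Prod.mk i)).subset ?_
  rintro _ ⟨x, ⟨n, hn⟩, rfl⟩
  refine mem_biUnion (x := x.1.1) ?_ ⟨x.1.2, x.2, rfl⟩
  have := spine_index_le_iterate d n x
  rw [show (parent d)^[n] x = v from hn] at this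
  exact this

theorem ae_finite_descendants (hm : mean π ≤ 1) (h1 : π 1 ≠ 1) :
    ∀ᵐ d ∂sampleLaw π h0 htop, ∀ v, ((tree d).descendants v).Finite := by
  have hs : gw π {y | Surv y} = 0 := (measureReal_eq_zero_iff).1 (survProb_eq_zero hm h1)
  have key (i : ℕ) (v : List ℕ) :
      ∀ᵐ d ∂sampleLaw π h0 htop, ¬ Surv fun w => bush d i (w ++ v) := by
    rw [← map_bush_append h0 htop i v] at hs
    refine ae_of_ae_map (p := fun y => ¬ Surv y) (by unfold bush; fun_prop) ?_
    simpa [ae_iff] using hs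
  filter_upwards [ae_all_iff.2 fun i => ae_all_iff.2 (key i)] with d hd
  exact finite_descendants hd

lemma infinite_descendants_root {d : Sample} (h : Surv (bush d 0)) :
    ((tree d).descendants (root d)).Infinite := by
  choose w hw hv using h
  refine (infinite_range_of_injective (f := fun n =>
    (⟨(0, w n), (isVertex_zero d _).2 (hv n)⟩ : Vertex d)) fun m n hmn => ?_).mono ?_
  · have := congrArg (fun v : Vertex d => v.1.2.length) hmn
    simpa [hw] using this
  · rintro _ ⟨n, rfl⟩
    refine ⟨(w n).length, ?_⟩
    have := parent_iterate_append d 0 (w n) [] ((isVertex_zero d _).2 (by simpa using hv n)) trivial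
    simp only [List.append_nil] at this
    exact this

theorem sampleLaw_surv_root : sampleLaw π h0 htop {d | Surv (bush d 0)} = gw π {y | Surv y} := by
  rw [← map_bush h0 htop 0, Measure.map_apply (measurable_bush 0) measurableSet_surv]
  rfl

/-! ### Uncountably many descending rays -/

/-- Some child outside the ancestral path has infinitely many descendants. -/
def BranchesForever (c : (Σ k, Fin k) × (List ℕ → ℕ)) : Prop :=
  ∃ j < c.1.1, j ≠ c.1.2 ∧ Surv (sub c.2 j)

lemma measurableSet_branchesForever : MeasurableSet {c | BranchesForever c} := by
  have : {c | BranchesForever c} = ⋃ j : ℕ, {c : (Σ k, Fin k) × (List ℕ → ℕ) |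
      (j < c.1.1 ∧ j ≠ c.1.2)} ∩ {c | Surv (sub c.2 j)} := by
    ext; simp [BranchesForever, and_assoc]
  rw [this]
  refine MeasurableSet.iUnion fun j => .inter ?_ ?_
  · exact measurable_fst (MeasurableSet.of_discrete (s := {c : Σ k, Fin k | j < c.1 ∧ j ≠ c.2}))
  · exact ((measurable_sub j).comp measurable_snd) measurableSet_surv

theorem ae_exists_branchesForever (hm : 1 < mean π) :
    ∀ᵐ d ∂sampleLaw π h0 htop, ∃ i, BranchesForever (d.1 i, bush d (i + 1)) := by
  obtain ⟨k, hk, hk'⟩ := exists_prob_pos (π := π) (lt_of_le_of_lt (π.coe_le_one 1) hm).ne'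
  have hpos : ((spineLaw π h0 htop).toMeasure.prod (gw π)) {c | BranchesForever c} ≠ 0 := by
    -- With the path in slot 0 and k ≥ 2, child number 1 lies off the path and survives with
    -- positive probability.
    set c₀ : Σ k, Fin k := ⟨k, ⟨0, by omega⟩⟩
    have h1 : ({c₀} : Set (Σ k, Fin k)) ×ˢ {y | ∀ j ∈ ({1} : Finset ℕ), sub y j ∈ {y | Surv y}} ⊆
        {c | BranchesForever c} := by
      rintro ⟨c, y⟩ ⟨hc, hy⟩
      rw [mem_singleton_iff] at hc
      change c = c₀ at hc
      subst hc
      exact ⟨1, hk, by simp, hy 1 (by simp)⟩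
    refine fun h => absurd (measure_mono_null h1 h) ?_
    rw [Measure.prod_prod, gw_sub π {1} fun _ => measurableSet_surv,
      (spineLaw π h0 htop).toMeasure_apply_singleton _ .of_discrete, spineLaw_apply,
      Finset.prod_singleton]
    have h2 : π k ≠ 0 := by rw [← ofReal_prob]; exact (ENNReal.ofReal_pos.2 hk').ne'
    have h3 : gw π {y | Surv y} ≠ 0 := fun h =>
      (survProb_pos hm htop).ne' ((measureReal_eq_zero_iff).2 h)
    exact mul_ne_zero (ENNReal.div_ne_zero.2 ⟨h2, htop⟩) h3
  have hms (i : ℕ) : MeasurableSet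
      {d : Sample | (d.1 i, bush d (i + 1)) ∈ {c | BranchesForever c}} :=
    (Measurable.prodMk (by fun_prop) (measurable_bush _)) measurableSet_branchesForever
  have h1 := measure_limsup_eq_one hms (iIndepSet_spine h0 htop (f := id) Function.injective_id
    fun i => measurableSet_branchesForever) (by
      simp_rw [sampleLaw_spine h0 htop _ measurableSet_branchesForever]
      exact ENNReal.tsum_const_eq_top_of_ne_zero hpos)
  have h2 := (prob_compl_eq_zero_iff (MeasurableSet.measurableSet_limsup hms)).2 h1
  filter_upwards [compl_mem_ae_iff.2 h2] with d hd
  rw [compl_compl, Filter.mem_limsup_iff_frequently_mem] at hd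
  exact hd.exists

/-- Almost surely no address carries a thin tree, so every surviving vertex other than o₁, o₂, … has
two surviving descendants in a common generation. -/
theorem ae_not_countable_descendingRays (hm : 1 < mean π) :
    ∀ᵐ d ∂sampleLaw π h0 htop, ∃ v, ¬ ((tree d).descendingRays v).Countable := by
  have key (i : ℕ) (v : List ℕ) :
      ∀ᵐ d ∂sampleLaw π h0 htop, ¬ IsThin fun w => bush d i (w ++ v) := by
    have hs := gw_isThin hm htop
    rw [← map_bush_append h0 htop i v] at hs
    refine ae_of_ae_map (p := fun y => ¬ IsThin y) (by unfold bush; fun_prop) ?_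
    simpa [ae_iff] using hs
  filter_upwards [ae_all_iff.2 fun i => ae_all_iff.2 (key i), ae_exists_branchesForever h0 htop hm]
    with d hd ⟨i, j, hj, hj', hs⟩
  refine ⟨⟨(i + 1, [j]), (isVertex_succ_snoc d i [] j).2 ⟨⟨hj, hj'⟩, trivial⟩⟩,
    EFT.not_countable_descendingRays
      (A := {x : Vertex d | Surv (fun u => bush d x.1.1 (u ++ x.1.2)) ∧ (x.1.1 = 0 ∨ x.1.2 ≠ [])})
      ⟨hs, .inr (by simp)⟩ ?_⟩
  rintro ⟨⟨i, w⟩, hv⟩ ⟨hs, hw⟩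
  have hthin := hd i w
  unfold IsThin at hthin
  push Not at hthin
  obtain ⟨u, u', hl, hu, hu', hsu, hsu', hne⟩ := hthin hs
  refine ⟨u.length, ⟨(i, u ++ w), isVertex_append hw hv hu⟩, ⟨?_, ?_⟩,
    ⟨(i, u' ++ w), isVertex_append hw hv hu'⟩, ⟨?_, ?_⟩, ?_, ?_, ?_⟩
  · simpa using hsu
  · exact hw.imp id fun h => List.append_ne_nil_of_right_ne_nil u h
  · simpa using hsu'
  · exact hw.imp id fun h => List.append_ne_nil_of_right_ne_nil u' h
  · intro h
    have := congrArg (fun v : Vertex d => v.1.2) h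
    exact hne (List.append_cancel_right this)
  · exact parent_iterate_append d i u w _ _
  · rw [hl]
    exact parent_iterate_append d i u' w _ _

/-! ### The deterministic case -/

/-- The only vertices are the `o_i` and the single line of descendants of `o₀`, so `level` is a
bijection onto ℤ. -/
theorem isClassIF_of_forall_one {d : Sample} (h1 : ∀ i, (d.1 i).1 = 1) (h2 : ∀ x, d.2 x = 1) :
    (tree d).IsClassIF ∧ ∀ v, (tree d).generation v = {v} := by
  have hzero (w : List ℕ) : IsVertex d 0 w ↔ w = List.replicate w.length 0 := by
    rw [isVertex_zero]
    induction w with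
    | nil => simp [IsGW]
    | cons j w ih => simp [IsGW, ih, bush, h2, List.replicate_succ, and_comm]
  have hsucc (i : ℕ) (w : List ℕ) : IsVertex d (i + 1) w ↔ w = [] := by
    rcases List.eq_nil_or_concat w with rfl | ⟨v, j, rfl⟩
    · simp [IsVertex]
    · rw [List.concat_eq_append, isVertex_succ_snoc]
      simp only [List.append_eq_nil_iff, List.cons_ne_self, and_false, iff_false]
      rintro ⟨⟨h3, h4⟩, -⟩
      have := (d.1 i).2.2
      have := h1 i
      omega
  refine (isLevel d).isClassIF_of_bijective ⟨?_, fun n => ?_⟩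
  · rintro ⟨⟨i, w⟩, h⟩ ⟨⟨i', w'⟩, h'⟩ he
    change (i : ℤ) - w.length = i' - w'.length at he
    refine Subtype.ext ?_
    rcases i with - | i <;> rcases i' with - | i'
    · have hl : w.length = w'.length := by simpa using he
      change (0, w) = (0, w')
      rw [(hzero w).1 h, (hzero w').1 h', hl]
    · obtain rfl := (hsucc i' w').1 h'
      simp at he
      omega
    · obtain rfl := (hsucc i w).1 h
      simp at he
      omega
    · obtain rfl := (hsucc i w).1 h
      obtain rfl := (hsucc i' w').1 h'
      simpa using he
  · rcases n with n | n
    · exact ⟨spine d n, by simp [level, spine]⟩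
    · refine ⟨⟨(0, List.replicate (n + 1) 0), (hzero _).2 (by simp)⟩, ?_⟩
      simp [level, Int.negSucc_eq]

theorem ae_forall_one (h1 : π 1 = 1) :
    ∀ᵐ d ∂sampleLaw π h0 htop, (∀ i, (d.1 i).1 = 1) ∧ ∀ x, d.2 x = 1 := by
  have hπ (k : ℕ) (hk : k ≠ 1) : π k = 0 := by
    have := π.apply_eq_one_iff 1 |>.1 h1
    rw [π.apply_eq_zero_iff, this]
    simpa using hk
  have hA : ∀ᵐ a ∂(Measure.infinitePi fun _ : ℕ => (spineLaw π h0 htop).toMeasure),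
      ∀ i, (a i).1 = 1 := by
    refine ae_all_iff.2 fun i => ?_
    have h2 : ∀ᵐ c ∂(spineLaw π h0 htop).toMeasure, c.1 = 1 := by
      rw [ae_iff, PMF.toMeasure_apply_eq_zero_iff _ .of_discrete, Set.disjoint_left]
      rintro ⟨k, j⟩ hc hc'
      rw [PMF.mem_support_iff, spineLaw_apply, hπ k hc'] at hc
      simp at hc
    rw [← Measure.infinitePi_map_eval (fun _ : ℕ => (spineLaw π h0 htop).toMeasure) i] at h2
    exact ae_of_ae_map (measurable_pi_apply i).aemeasurable h2
  have hB : ∀ᵐ y ∂(Measure.infinitePi fun _ : ℕ × List ℕ => π.toMeasure), ∀ x, y x = 1 := by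
    refine ae_all_iff.2 fun i => ?_
    have h2 : ∀ᵐ c ∂π.toMeasure, c = 1 := by
      rw [ae_iff, PMF.toMeasure_apply_eq_zero_iff _ .of_discrete, Set.disjoint_left]
      intro k hc hc'
      exact hc (hπ k hc')
    rw [← Measure.infinitePi_map_eval (fun _ : ℕ × List ℕ => π.toMeasure) i] at h2
    exact ae_of_ae_map (measurable_pi_apply i).aemeasurable h2
  unfold sampleLaw
  filter_upwards [Measure.quasiMeasurePreserving_fst.ae hA,
    Measure.quasiMeasurePreserving_snd.ae hB] with d h1 h2
  exact ⟨h1, h2⟩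

end EGW

namespace EGW

/-! ### The mean size of the generation of the root -/

lemma tsum_list_snoc (f : List ℕ → ℝ≥0∞) : ∑' w, f w = f [] + ∑' j, ∑' w, f (w ++ [j]) := by
  have hg : Function.Injective fun p : ℕ × List ℕ => p.2 ++ [p.1] := by
    rintro ⟨j, w⟩ ⟨j', w'⟩ h
    simpa [and_comm] using List.append_inj' h rfl
  rw [ENNReal.tsum_eq_add_tsum_ite [], ← ENNReal.tsum_prod]
  congr 1
  refine (hg.tsum_eq (f := fun w => @ite _ (w = []) (Classical.propDecidable _) 0 (f w)) ?_).symm.trans ?_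
  · intro w hw
    rcases List.eq_nil_or_concat w with rfl | ⟨v, j, rfl⟩
    · simp at hw
    · exact ⟨(j, v), by simp⟩
  · simp

lemma tsum_measure_Ioi (μ : Measure ℕ) : ∑' j, μ {k | j < k} = ∑' k : ℕ, k * μ {k} := by
  have h (j : ℕ) : μ {k | j < k} = ∑' k, if j < k then μ {k} else 0 := by
    rw [← lintegral_indicator_one .of_discrete, lintegral_countable']
    refine tsum_congr fun k => ?_
    by_cases hk : j < k <;> simp [hk]
  simp_rw [h]
  rw [ENNReal.tsum_comm]
  refine tsum_congr fun k => ?_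
  rw [tsum_eq_sum (s := Finset.range k)]
  · rw [Finset.sum_congr rfl fun j hj => if_pos (Finset.mem_range.1 hj)]
    simp
  · intro j hj
    exact if_neg fun h => hj (Finset.mem_range.2 h)

theorem tsum_gw_isGW (π : PMF ℕ) (n : ℕ) :
    (∑' w : List ℕ, if w.length = n then gw π {y | IsGW y w} else 0) = mean π ^ n := by
  induction n with
  | zero => rw [tsum_list_snoc]; simp [IsGW]
  | succ n ih =>
    rw [tsum_list_snoc]
    have h (j : ℕ) (w : List ℕ) : gw π {y | IsGW y (w ++ [j])} =
        π.toMeasure {k | j < k} * gw π {y | IsGW y w} := by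
      have := gw_root_sub π {k | j < k} {j} (A := fun _ => {y | IsGW y w})
        fun _ => measurableSet_isGW w
      rw [Finset.prod_singleton] at this
      rw [← this]
      congr 1
      ext y
      simp [isGW_snoc]
    have h' (j : ℕ) (w : List ℕ) :
        (if (w ++ [j]).length = n + 1 then gw π {y | IsGW y (w ++ [j])} else 0) =
        π.toMeasure {k | j < k} * if w.length = n then gw π {y | IsGW y w} else 0 := by
      simp [h]
    simp_rw [h', ENNReal.tsum_mul_left, ih]
    rw [ENNReal.tsum_mul_right, tsum_measure_Ioi, pow_succ']
    simp [mean, PMF.toMeasure_apply_singleton]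

variable {π : PMF ℕ} (h0 : mean π ≠ 0) (htop : mean π ≠ ∞)

lemma measurableSet_isVertex (i : ℕ) (w : List ℕ) : MeasurableSet {d | IsVertex d i w} := by
  rcases i with - | i
  · simp_rw [isVertex_zero]
    exact measurable_bush 0 (measurableSet_isGW w)
  · rcases List.eq_nil_or_concat w with rfl | ⟨v, j, rfl⟩
    · simp [IsVertex]
    · simp_rw [List.concat_eq_append, isVertex_succ_snoc]
      refine .inter ?_ ?_
      · exact (show Measurable fun d : Sample => d.1 i by fun_prop)
          (MeasurableSet.of_discrete (s := {c : Σ k, Fin k | j < c.1 ∧ j ≠ c.2}))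
      · exact ((measurable_sub j).comp (measurable_bush (i + 1))) (measurableSet_isGW v)

/-- The root has level 0, so its generation consists of the vertices `(i, w)` whose depth in the
bush equals i. -/
lemma encard_generation (d : Sample) : (((tree d).generation (root d)).encard : ℝ≥0∞) =
    ∑' i : ℕ, ∑' w : List ℕ, if w.length = i then {d | IsVertex d i w}.indicator 1 d else 0 := by
  have h2 : Subtype.val '' (show Set (Vertex d) from (tree d).generation (root d)) =
      {x : ℕ × List ℕ | IsVertex d x.1 x.2 ∧ x.2.length = x.1} := by
    ext ⟨i, w⟩
    constructor
    · rintro ⟨⟨⟨i', w'⟩, h⟩, hv, he⟩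
      obtain ⟨rfl, rfl⟩ := Prod.mk.inj he
      have hv : (i' : ℤ) - w'.length = 0 := (isLevel d).mem_generation_iff.1 hv
      exact ⟨h, by simp only; omega⟩
    · rintro ⟨h, h'⟩
      refine ⟨⟨(i, w), h⟩, (isLevel d).mem_generation_iff.2 ?_, rfl⟩
      change (i : ℤ) - w.length = 0
      simp only at h'
      omega
  have h3 : ((tree d).generation (root d)).encard =
      {x : ℕ × List ℕ | IsVertex d x.1 x.2 ∧ x.2.length = x.1}.encard := by
    rw [← h2]
    exact (Subtype.val_injective.encard_image _).symm
  rw [h3, ← ENNReal.tsum_set_one, ← ENNReal.tsum_prod, tsum_subtype _ (fun _ => (1 : ℝ≥0∞))]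
  refine tsum_congr fun x => ?_
  by_cases h : IsVertex d x.1 x.2 <;> by_cases h' : x.2.length = x.1 <;> simp [h, h']

/-- The mean number of children of `oᵢ₊₁` outside the ancestral path. -/
def meanBranches (π : PMF ℕ) : ℝ≥0∞ := ∑' k : ℕ, π k / mean π * (k * (k - 1 : ℕ))

/-- Each child of `o_{n+1}` off the path starts a Galton–Watson tree whose n-th generation has mean
size m^n. -/
theorem tsum_sampleLaw_isVertex (n : ℕ) :
    (∑' w : List ℕ, if w.length = n + 1 then sampleLaw π h0 htop {d | IsVertex d (n + 1) w} else 0) =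
      meanBranches π * mean π ^ n := by
  rw [tsum_list_snoc]
  have h (j : ℕ) (w : List ℕ) : sampleLaw π h0 htop {d | IsVertex d (n + 1) (w ++ [j])} =
      (spineLaw π h0 htop).toMeasure {c | j < c.1 ∧ j ≠ c.2} * gw π {y | IsGW y w} := by
    have h1 := gw_sub π {j} (A := fun _ => {y | IsGW y w}) fun _ => measurableSet_isGW w
    rw [Finset.prod_singleton] at h1
    rw [← h1, ← Measure.prod_prod, ← sampleLaw_spine h0 htop n]
    · congr 1
      ext d
      simp [isVertex_succ_snoc]
    · refine MeasurableSet.of_discrete.prod ?_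
      have : MeasurableSet {y | IsGW (sub y j) w} := measurable_sub j (measurableSet_isGW w)
      simpa using this
  have h' (j : ℕ) (w : List ℕ) : (if (w ++ [j]).length = n + 1 then
      sampleLaw π h0 htop {d | IsVertex d (n + 1) (w ++ [j])} else 0) =
      (spineLaw π h0 htop).toMeasure {c | j < c.1 ∧ j ≠ c.2} *
        if w.length = n then gw π {y | IsGW y w} else 0 := by
    simp [h]
  simp_rw [h', ENNReal.tsum_mul_left, tsum_gw_isGW]
  rw [ENNReal.tsum_mul_right]
  have h2 (j : ℕ) : (spineLaw π h0 htop).toMeasure {c | j < c.1 ∧ j ≠ c.2} =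
      ∑' c, spineLaw π h0 htop c * if j < c.1 ∧ j ≠ c.2 then 1 else 0 := by
    rw [PMF.toMeasure_apply _ .of_discrete]
    refine tsum_congr fun c => ?_
    by_cases hc : j < c.1 ∧ j ≠ c.2 <;> simp [indicator, hc]
  have h3 : ∑' j, (spineLaw π h0 htop).toMeasure {c | j < c.1 ∧ j ≠ c.2} = meanBranches π := by
    simp_rw [h2]
    rw [ENNReal.tsum_comm]
    have h4 (c : Σ k, Fin k) :
        ∑' j : ℕ, (spineLaw π h0 htop c * if j < c.1 ∧ j ≠ c.2 then (1 : ℝ≥0∞) else 0) =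
        spineLaw π h0 htop c * (c.1 - 1 : ℕ) := by
      rw [ENNReal.tsum_mul_left, tsum_eq_sum (s := (Finset.range c.1).erase c.2)]
      · rw [Finset.sum_congr rfl (g := fun _ => 1)]
        · simp
        · intro j hj
          simp only [Finset.mem_erase, Finset.mem_range] at hj
          exact if_pos ⟨hj.2, hj.1⟩
      · intro j hj
        simp only [Finset.mem_erase, Finset.mem_range, not_and'] at hj
        exact if_neg fun h => hj h.1 h.2
    simp_rw [h4]
    rw [tsum_spineLaw_mul h0 htop fun c => ((c.1 - 1 : ℕ) : ℝ≥0∞), meanBranches]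
    simp
  rw [h3]
  simp

theorem lintegral_encard_generation :
    ∫⁻ d, (((tree d).generation (root d)).encard : ℝ≥0∞) ∂sampleLaw π h0 htop =
      1 + ∑' n, meanBranches π * mean π ^ n := by
  simp_rw [encard_generation]
  have hm (i : ℕ) (w : List ℕ) : Measurable fun d : Sample =>
      if w.length = i then {d | IsVertex d i w}.indicator (1 : Sample → ℝ≥0∞) d else 0 := by
    split_ifs
    · exact measurable_one.indicator (measurableSet_isVertex i w)
    · exact measurable_const
  rw [lintegral_tsum fun i => (Measurable.tsum fun w => hm i w).aemeasurable]
  simp_rw [lintegral_tsum fun w => (hm _ w).aemeasurable]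
  have h1 (i : ℕ) (w : List ℕ) : (∫⁻ d, if w.length = i then
      {d | IsVertex d i w}.indicator (1 : Sample → ℝ≥0∞) d else 0 ∂sampleLaw π h0 htop) =
      if w.length = i then sampleLaw π h0 htop {d | IsVertex d i w} else 0 := by
    split_ifs
    · exact lintegral_indicator_one (measurableSet_isVertex i w)
    · simp
  simp_rw [h1]
  rw [tsum_eq_zero_add' ENNReal.summable]
  simp_rw [tsum_sampleLaw_isVertex]
  congr 1
  rw [tsum_list_snoc]
  simp [IsVertex]

lemma measurable_encard_generation :
    Measurable fun d : Sample => (((tree d).generation (root d)).encard : ℝ≥0∞) := by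
  simp_rw [encard_generation]
  refine Measurable.tsum fun i => Measurable.tsum fun w => ?_
  split_ifs
  · exact measurable_one.indicator (measurableSet_isVertex i w)
  · exact measurable_const

include h0 htop in
-- Up to the factor 1/m this is E[Z(Z - 1)], which together with the finite mean controls E[Z²].
theorem meanBranches_lt_top_iff :
    meanBranches π < ∞ ↔ evariance (fun k : ℕ => (k : ℝ)) π.toMeasure < ∞ := by
  have h1 : meanBranches π = (mean π)⁻¹ * ∑' k : ℕ, π k * (k * (k - 1 : ℕ)) := by
    rw [meanBranches, ← ENNReal.tsum_mul_left]
    refine tsum_congr fun k => ?_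
    rw [div_eq_mul_inv]
    ring
  have h2 : (∑' k : ℕ, π k * (k * (k - 1 : ℕ))) + mean π = ∑' k : ℕ, (k : ℝ≥0∞) ^ 2 * π k := by
    rw [mean, ← ENNReal.tsum_add]
    refine tsum_congr fun k => ?_
    rcases k with - | k
    · simp
    · push_cast [Nat.add_sub_cancel]
      ring
  have h3 : MemLp (fun k : ℕ => (k : ℝ)) 2 π.toMeasure ↔ ∑' k : ℕ, (k : ℝ≥0∞) ^ 2 * π k < ∞ := by
    rw [MemLp, and_iff_right (by fun_prop), eLpNorm_lt_top_iff_lintegral_rpow_enorm_lt_top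
      two_ne_zero ENNReal.ofNat_ne_top, lintegral_countable']
    have (k : ℕ) : ‖(k : ℝ)‖ₑ ^ (2 : ℝ≥0∞).toReal * π.toMeasure {k} = (k : ℝ≥0∞) ^ 2 * π k := by
      rw [PMF.toMeasure_apply_singleton _ _ .of_discrete, Real.enorm_natCast]
      simp
    simp_rw [this]
  rw [evariance_lt_top_iff_memLp (by fun_prop), h3, ← h2, h1]
  rw [ENNReal.add_lt_top, and_iff_left htop.lt_top]
  constructor
  · intro h
    by_contra hc
    rw [not_lt, top_le_iff] at hc
    rw [hc, ENNReal.mul_top (ENNReal.inv_ne_zero.2 htop)] at h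
    exact lt_irrefl _ h
  · exact fun h => ENNReal.mul_lt_top (ENNReal.inv_lt_top.2 (pos_iff_ne_zero.2 h0)) h

theorem lintegral_encard_generation_lt_top_iff (hm : mean π < 1) :
    ∫⁻ d, (((tree d).generation (root d)).encard : ℝ≥0∞) ∂sampleLaw π h0 htop < ∞ ↔
      evariance (fun k : ℕ => (k : ℝ)) π.toMeasure < ∞ := by
  rw [lintegral_encard_generation, ← meanBranches_lt_top_iff h0 htop, ENNReal.tsum_mul_left,
    ENNReal.tsum_geometric, ENNReal.add_lt_top, and_iff_right ENNReal.one_lt_top]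
  constructor
  · intro h
    by_contra hc
    rw [not_lt, top_le_iff] at hc
    rw [hc, ENNReal.top_mul (ENNReal.inv_ne_zero.2 (ENNReal.sub_ne_top ENNReal.one_ne_top))] at h
    exact lt_irrefl _ h
  · exact fun h => ENNReal.mul_lt_top h (ENNReal.inv_lt_top.2 (tsub_pos_of_lt hm))

end EGW

/-! ### Balls and the local topology -/

section ball

variable {M : Type}

lemma RootedEFT.mem_ball_zero (T : RootedEFT M) (v : T.V) : v ∈ T.ball 0 ↔ v = T.root := by
  simp [RootedEFT.ball, eq_comm (a := v)]

/-- This recursion removes the graph distance from all later arguments about balls. -/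
lemma RootedEFT.mem_ball_succ (T : RootedEFT M) (r : ℕ) (v : T.V) :
    v ∈ T.ball (r + 1) ↔ v ∈ T.ball r ∨ ∃ u ∈ T.ball r, T.parent u = v ∨ T.parent v = u := by
  simp only [RootedEFT.ball, mem_ofPred_eq]
  constructor
  · intro h
    rw [SimpleGraph.edist_comm] at h
    obtain ⟨p, hp⟩ := T.graph.exists_walk_of_edist_ne_top
      (ne_top_of_le_ne_top (ENat.natCast_ne_top _) h)
    rw [← hp] at h
    cases p with
    | nil => left; simp
    | @cons _ u _ hadj q =>
      right
      refine ⟨u, ?_, (EFT.graph_adj _).1 hadj.symm⟩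
      rw [SimpleGraph.edist_comm]
      refine (SimpleGraph.edist_le q).trans ?_
      simpa using h
  · rintro (h | ⟨u, hu, h⟩)
    · exact h.trans (by exact_mod_cast r.le_succ)
    · have hadj : T.graph.Adj u v := (EFT.graph_adj _).2 h
      refine (SimpleGraph.edist_triangle (v := u)).trans ?_
      rw [SimpleGraph.edist_eq_one_iff_adj.2 hadj]
      push_cast
      gcongr

/-- An isomorphism of rooted trees preserves the balls around the root. -/
lemma RootedEFT.mem_ball_iso {T S : RootedEFT M} {φ : T.V ≃ S.V}
    (h : EFT.IsIso (T := T.toEFT) (S := S.toEFT) φ) (h' : φ T.root = S.root) (r : ℕ) (v : T.V) :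
    φ v ∈ S.ball r ↔ v ∈ T.ball r := by
  induction r generalizing v with
  | zero => rw [mem_ball_zero, mem_ball_zero, ← h', φ.apply_eq_iff_eq]
  | succ r ih =>
    rw [mem_ball_succ, mem_ball_succ, ih, φ.surjective.exists]
    simp_rw [ih, ← h.parent, φ.apply_eq_iff_eq]

/-- The isomorphism of balls induced by an isomorphism of rooted trees. -/
def RootedEFT.ballEquiv {T S : RootedEFT M} {φ : T.V ≃ S.V}
    (h : EFT.IsIso (T := T.toEFT) (S := S.toEFT) φ) (h' : φ T.root = S.root) (r : ℕ) :
    T.ball r ≃ S.ball r :=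
  φ.subtypeEquiv fun v => (mem_ball_iso h h' r v).symm

lemma RootedEFT.isBallIso_ballEquiv {T S : RootedEFT M} {φ : T.V ≃ S.V}
    (h : EFT.IsIso (T := T.toEFT) (S := S.toEFT) φ) (h' : φ T.root = S.root) (r : ℕ) :
    RootedEFT.IsBallIso (ballEquiv h h' r) where
  root v := by
    change _ ↔ φ v = S.root
    rw [← h', φ.apply_eq_iff_eq]
  parent v w := by
    change _ ↔ S.parent (φ v) = φ w
    rw [← h.parent, φ.apply_eq_iff_eq]
  mark v := h.mark v

lemma RootedEFT.IsBallIso.trans {T S R : RootedEFT M} {r : ℕ} {φ : T.ball r ≃ S.ball r}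
    {ψ : S.ball r ≃ R.ball r} (h : RootedEFT.IsBallIso φ) (k : RootedEFT.IsBallIso ψ) :
    RootedEFT.IsBallIso (φ.trans ψ) where
  root v := (h.root v).trans (k.root _)
  parent v w := (h.parent v w).trans (k.parent _ _)
  mark v := (k.mark _).trans (h.mark v)

/-- The basic open sets of `EFTStar M`. -/
def EFTStar.basicOpen (r : ℕ) (S : RootedEFT M) : Set (EFTStar M) :=
  {x | ∃ T : RootedEFT M, EFTStar.mk T = x ∧ ∃ φ : T.ball r ≃ S.ball r, RootedEFT.IsBallIso φ}

/-- The basic open sets of `EFTStarStar M`. -/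
def EFTStarStar.basicOpen (r : ℕ) (S : BirootedEFT M) : Set (EFTStarStar M) :=
  {x | ∃ T : BirootedEFT M, EFTStarStar.mk T = x ∧
      ∃ φ : T.ball r ≃ S.ball r, RootedEFT.IsBallIso φ ∧
        ∃ h : T.second ∈ T.ball r, (φ ⟨T.second, h⟩ : S.V) = S.second}

lemma EFTStar.mk_mem_basicOpen {r : ℕ} {S T : RootedEFT M} :
    EFTStar.mk T ∈ EFTStar.basicOpen r S ↔ ∃ φ : T.ball r ≃ S.ball r, RootedEFT.IsBallIso φ := by
  constructor
  · rintro ⟨T', hT', φ, hφ⟩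
    obtain ⟨ψ, hψ, hroot⟩ := Quotient.exact hT'.symm
    exact ⟨_, (RootedEFT.isBallIso_ballEquiv hψ hroot r).trans hφ⟩
  · exact fun h => ⟨T, rfl, h⟩

lemma EFTStarStar.mk_mem_basicOpen {r : ℕ} {S T : BirootedEFT M} :
    EFTStarStar.mk T ∈ EFTStarStar.basicOpen r S ↔
      ∃ φ : T.ball r ≃ S.ball r, RootedEFT.IsBallIso φ ∧
        ∃ h : T.second ∈ T.ball r, (φ ⟨T.second, h⟩ : S.V) = S.second := by
  constructor
  · rintro ⟨T', hT', φ, hφ, h, h'⟩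
    obtain ⟨ψ, hψ, hroot, hsec⟩ := Quotient.exact hT'.symm
    refine ⟨_, (RootedEFT.isBallIso_ballEquiv hψ hroot r).trans hφ, ?_, ?_⟩
    · rwa [← RootedEFT.mem_ball_iso hψ hroot, hsec]
    · rw [← h']
      change (φ ⟨ψ T.second, _⟩ : S.V) = _
      congr 2
      exact Subtype.ext hsec
  · exact fun h => ⟨T, rfl, h⟩

lemma EFTStar.isOpen_basicOpen (r : ℕ) (S : RootedEFT M) : IsOpen (EFTStar.basicOpen r S) :=
  TopologicalSpace.isOpen_generateFrom_of_mem ⟨r, S, rfl⟩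

lemma EFTStarStar.isOpen_basicOpen (r : ℕ) (S : BirootedEFT M) :
    IsOpen (EFTStarStar.basicOpen r S) :=
  TopologicalSpace.isOpen_generateFrom_of_mem ⟨r, S, rfl⟩

instance : BorelSpace (EFTStar M) := ⟨rfl⟩

instance : BorelSpace (EFTStarStar M) := ⟨rfl⟩

/-- Forgetting the marks of a doubly rooted tree. -/
def BirootedEFT.forget (T : BirootedEFT M) : BirootedEFT Unit :=
  T.toEFT.forget.withRoots T.root T.second

/-- Forgetting the marks of a rooted tree. -/
def RootedEFT.forget (T : RootedEFT M) : RootedEFT Unit := T.toEFT.forget.withRoot T.root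

lemma RootedEFT.IsBallIso.forget {T S : RootedEFT M} {r : ℕ} {φ : T.ball r ≃ S.ball r}
    (h : RootedEFT.IsBallIso φ) :
    RootedEFT.IsBallIso (T := T.forget) (S := S.forget) (r := r) φ where
  root := h.root
  parent := h.parent
  mark _ := rfl

/-- Forgetting the marks, on isomorphism classes. -/
def EFTStar.forget : EFTStar M → EFTStar Unit :=
  Quotient.lift (fun T => EFTStar.mk T.forget) fun _ _ ⟨φ, h, h'⟩ =>
    Quotient.sound ⟨φ, ⟨h.parent, fun _ => rfl⟩, h'⟩

/-- Forgetting the marks, on isomorphism classes of doubly rooted trees. -/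
def EFTStarStar.forget : EFTStarStar M → EFTStarStar Unit :=
  Quotient.lift (fun T => EFTStarStar.mk T.forget) fun _ _ ⟨φ, h, h', h''⟩ =>
    Quotient.sound ⟨φ, ⟨h.parent, fun _ => rfl⟩, h', h''⟩

/-- If the marked r-ball of a tree agrees with that of `T`, so does the unmarked one. -/
lemma EFTStar.continuous_forget : Continuous (EFTStar.forget (M := M)) := by
  refine continuous_generateFrom_iff.2 ?_
  rintro _ ⟨r, S, rfl⟩
  refine isOpen_iff_forall_mem_open.2 ?_
  rintro ⟨T⟩ hT
  obtain ⟨φ, hφ⟩ := EFTStar.mk_mem_basicOpen.1 (show EFTStar.mk T.forget ∈ basicOpen r S from hT)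
  refine ⟨basicOpen r T, ?_, isOpen_basicOpen r T, ⟨T, rfl, Equiv.refl _,
    ⟨fun _ => Iff.rfl, fun _ _ => Iff.rfl, fun _ => rfl⟩⟩⟩
  rintro _ ⟨R, rfl, ψ, hψ⟩
  exact EFTStar.mk_mem_basicOpen.2 ⟨_, hψ.forget.trans hφ⟩

lemma EFTStarStar.continuous_forget : Continuous (EFTStarStar.forget (M := M)) := by
  refine continuous_generateFrom_iff.2 ?_
  rintro _ ⟨r, S, rfl⟩
  refine isOpen_iff_forall_mem_open.2 ?_
  rintro ⟨T⟩ hT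
  obtain ⟨φ, hφ, h, h'⟩ := EFTStarStar.mk_mem_basicOpen.1
    (show EFTStarStar.mk T.forget ∈ basicOpen r S from hT)
  refine ⟨basicOpen r T, ?_, isOpen_basicOpen r T, ⟨T, rfl, Equiv.refl _,
    ⟨fun _ => Iff.rfl, fun _ _ => Iff.rfl, fun _ => rfl⟩, h, rfl⟩⟩
  rintro _ ⟨R, rfl, ψ, hψ, k, k'⟩
  refine EFTStarStar.mk_mem_basicOpen.2 ⟨_, hψ.forget.trans hφ, k, ?_⟩
  rw [← h']
  change (φ (ψ ⟨R.second, k⟩) : S.V) = _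
  congr 2
  exact Subtype.ext k'

end ball

namespace EGW

/-! ### The tree depends continuously on the ingredients -/

instance : DiscreteTopology (Σ k : ℕ, Fin k) := inferInstance

instance : OpensMeasurableSpace (Σ k : ℕ, Fin k) := ⟨fun _ _ => .of_discrete⟩

/-- The address of the parent. -/
def parentAddr : ℕ × List ℕ → ℕ × List ℕ
  | (i, []) => (i + 1, [])
  | (i, _ :: w) => (i, w)

lemma parent_val (d : Sample) (v : Vertex d) : (parent d v).1 = parentAddr v.1 := by
  obtain ⟨⟨i, w⟩, h⟩ := v
  cases w <;> rfl

lemma parent_eq_iff {d : Sample} (v w : Vertex d) : parent d v = w ↔ parentAddr v.1 = w.1 := by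
  rw [← parent_val]
  exact Subtype.ext_iff

/-- The rank of the vertex with a given address among its siblings. -/
def rankAddr (d : Sample) : ℕ × List ℕ → ℕ
  | (i, []) => (d.1 i).2
  | (_, j :: _) => j

lemma rank_eq (d : Sample) (v : Vertex d) : rank d v = rankAddr d v.1 := by
  obtain ⟨⟨i, w⟩, h⟩ := v
  cases w <;> rfl

open Filter Topology

lemma eventually_fst_eq (d₀ : Sample) (i : ℕ) : ∀ᶠ d in 𝓝 d₀, d.1 i = d₀.1 i :=
  ((continuous_apply i).comp continuous_fst).continuousAt.eventually
    ((isOpen_discrete {d₀.1 i}).mem_nhds rfl)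

lemma eventually_snd_eq (d₀ : Sample) (x : ℕ × List ℕ) : ∀ᶠ d in 𝓝 d₀, d.2 x = d₀.2 x :=
  ((continuous_apply x).comp continuous_snd).continuousAt.eventually
    ((isOpen_discrete {d₀.2 x}).mem_nhds rfl)

lemma eventually_rankAddr (d₀ : Sample) (x : ℕ × List ℕ) :
    ∀ᶠ d in 𝓝 d₀, rankAddr d x = rankAddr d₀ x := by
  obtain ⟨i, w⟩ := x
  cases w with
  | nil =>
    filter_upwards [eventually_fst_eq d₀ i] with d hd
    exact congrArg (fun c : Σ k, Fin k => (c.2 : ℕ)) hd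
  | cons j w => exact Eventually.of_forall fun _ => rfl

lemma eventually_children (d₀ : Sample) (x : ℕ × List ℕ) : ∀ᶠ d in 𝓝 d₀,
    ∀ j, (j < numChildren d x ∧ ¬ IsSpineSlot d x j) ↔
      (j < numChildren d₀ x ∧ ¬ IsSpineSlot d₀ x j) := by
  obtain ⟨i, w⟩ := x
  -- The spine ingredient that governs `o_i` has index i - 1; for i = 0 the truncated index is
  -- harmless, since it is not used.
  filter_upwards [eventually_fst_eq d₀ (i - 1), eventually_snd_eq d₀ (i, w)] with d h1 h2 j
  have h3 := congrArg (fun c : Σ k, Fin k => (c.2 : ℕ)) h1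
  rcases i with - | i <;> rcases w with - | ⟨l, w⟩ <;>
    simp_all [numChildren, IsSpineSlot]

lemma eventually_isVertex (d₀ : Sample) (i : ℕ) (w : List ℕ) :
    ∀ᶠ d in 𝓝 d₀, (IsVertex d i w ↔ IsVertex d₀ i w) := by
  induction w with
  | nil => exact Eventually.of_forall fun _ => Iff.rfl
  | cons j w ih =>
    filter_upwards [ih, eventually_children d₀ (i, w)] with d h1 h2
    simp only [IsVertex, h1, h2 j]

/-- An address has infinitely many potential children, so one neighbourhood of `d₀` must serve all
`z`; it does, because one number decides which child slots are filled, together with the excluded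
slot on the path. -/
lemma eventually_neighbours (d₀ : Sample) (u : ℕ × List ℕ) : ∀ᶠ d in 𝓝 d₀,
    ∀ z, (parentAddr u = z ∨ parentAddr z = u) → (IsVertex d z.1 z.2 ↔ IsVertex d₀ z.1 z.2) := by
  filter_upwards [eventually_isVertex d₀ (parentAddr u).1 (parentAddr u).2,
    eventually_isVertex d₀ u.1 u.2, eventually_children d₀ u] with d h1 h2 h3
  rintro ⟨i, w⟩ (h | rfl)
  · exact h ▸ h1
  · cases w with
    | nil => exact Iff.rfl
    | cons j w =>
      exact and_congr h2 (h3 j)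

/-- The addresses of the vertices in the ball around the vertex with address `x`. -/
def ballAddr (d : Sample) (x : ℕ × List ℕ) : ℕ → Set (ℕ × List ℕ)
  | 0 => {x}
  | r + 1 => ballAddr d x r ∪
      {z | IsVertex d z.1 z.2 ∧ ∃ u ∈ ballAddr d x r, parentAddr u = z ∨ parentAddr z = u}

lemma isVertex_of_mem_ballAddr {d : Sample} {x z : ℕ × List ℕ} (hx : IsVertex d x.1 x.2) {r : ℕ}
    (hz : z ∈ ballAddr d x r) : IsVertex d z.1 z.2 := by
  induction r with
  | zero => rw [show z = x from hz]; exact hx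
  | succ r ih => exact hz.elim ih fun h => h.1

lemma mem_ball_iff {d : Sample} {x : ℕ × List ℕ} (hx : IsVertex d x.1 x.2) (r : ℕ)
    (v : Vertex d) : v ∈ ((tree d).withRoot ⟨x, hx⟩).ball r ↔ v.1 ∈ ballAddr d x r := by
  induction r generalizing v with
  | zero =>
    exact (RootedEFT.mem_ball_zero _ _).trans Subtype.ext_iff
  | succ r ih =>
    refine (RootedEFT.mem_ball_succ _ _ _).trans (or_congr (ih v) ?_)
    constructor
    · rintro ⟨u, hu, h⟩
      exact ⟨v.2, u.1, (ih u).1 hu, h.imp (parent_eq_iff u v).1 (parent_eq_iff v u).1⟩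
    · rintro ⟨-, u, hu, h⟩
      have hu' := isVertex_of_mem_ballAddr hx hu
      exact ⟨⟨u, hu'⟩, (ih ⟨u, hu'⟩).2 hu, h.imp (parent_eq_iff ⟨u, hu'⟩ v).2
        (parent_eq_iff v ⟨u, hu'⟩).2⟩

lemma finite_ballAddr {d : Sample} {x : ℕ × List ℕ} (hx : IsVertex d x.1 x.2) (r : ℕ) :
    (ballAddr d x r).Finite := by
  induction r with
  | zero => exact finite_singleton x
  | succ r ih =>
    refine ih.union ((ih.biUnion (t := fun u => {parentAddr u} ∪
      {z | IsVertex d z.1 z.2 ∧ parentAddr z = u ∧ IsVertex d u.1 u.2}) fun u hu => ?_).subset ?_)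
    · refine (finite_singleton _).union ?_
      have hu' := isVertex_of_mem_ballAddr hx hu
      refine (((tree d).locallyFinite ⟨u, hu'⟩).image Subtype.val).subset ?_
      rintro z ⟨hz, hzu, -⟩
      exact ⟨⟨z, hz⟩, (parent_eq_iff (d := d) ⟨z, hz⟩ ⟨u, hu'⟩).2 hzu, rfl⟩
    · rintro z ⟨hz, u, hu, h | h⟩
      · exact mem_biUnion hu (.inl h.symm)
      · exact mem_biUnion hu (.inr ⟨hz, h, isVertex_of_mem_ballAddr hx hu⟩)

lemma eventually_ballAddr {d₀ : Sample} {x : ℕ × List ℕ} (hx : IsVertex d₀ x.1 x.2) (r : ℕ) :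
    ∀ᶠ d in 𝓝 d₀, ballAddr d x r = ballAddr d₀ x r := by
  induction r with
  | zero => exact Eventually.of_forall fun _ => rfl
  | succ r ih =>
    filter_upwards [ih, (eventually_all_finite (finite_ballAddr hx r)).2
      fun u _ => eventually_neighbours d₀ u] with d h1 h2
    simp only [ballAddr, h1]
    congr 1
    ext z
    constructor <;> rintro ⟨hz, u, hu, h⟩
    · exact ⟨(h2 u hu z h).1 hz, u, hu, h⟩
    · exact ⟨(h2 u hu z h).2 hz, u, hu, h⟩

/-- Near `d₀` the ball consists of the same addresses with the same ranks, so the identity on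
addresses is an isomorphism. -/
lemma eventually_ballIso {d₀ : Sample} {x : ℕ × List ℕ} (hx₀ : IsVertex d₀ x.1 x.2) (r : ℕ) :
    ∀ᶠ d in 𝓝 d₀, ∀ hx : IsVertex d x.1 x.2,
      ∃ φ : ((tree d).withRoot ⟨x, hx⟩).ball r ≃ ((tree d₀).withRoot ⟨x, hx₀⟩).ball r,
        RootedEFT.IsBallIso φ ∧
          ∀ v, Subtype.val (show Vertex d₀ from (φ v).1) = Subtype.val (show Vertex d from v.1) := by
  filter_upwards [eventually_ballAddr hx₀ r, (eventually_all_finite (finite_ballAddr hx₀ r)).2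
      fun u _ => eventually_rankAddr d₀ u] with d h1 h2 hx
  have hto (v : Vertex d) (hv : v ∈ ((tree d).withRoot ⟨x, hx⟩).ball r) : v.1 ∈ ballAddr d₀ x r :=
    h1 ▸ (mem_ball_iff hx r v).1 hv
  have hfrom (v : Vertex d₀) (hv : v ∈ ((tree d₀).withRoot ⟨x, hx₀⟩).ball r) :
      v.1 ∈ ballAddr d x r := h1.symm ▸ (mem_ball_iff hx₀ r v).1 hv
  let φ : ((tree d).withRoot ⟨x, hx⟩).ball r ≃ ((tree d₀).withRoot ⟨x, hx₀⟩).ball r :=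
    { toFun := fun v => ⟨(⟨v.1.1, isVertex_of_mem_ballAddr hx₀ (hto v.1 v.2)⟩ : Vertex d₀),
        (mem_ball_iff hx₀ r _).2 (hto v.1 v.2)⟩
      invFun := fun v => ⟨(⟨v.1.1, isVertex_of_mem_ballAddr hx (hfrom v.1 v.2)⟩ : Vertex d),
        (mem_ball_iff hx r _).2 (hfrom v.1 v.2)⟩
      left_inv := fun _ => rfl
      right_inv := fun _ => rfl }
  refine ⟨φ, ⟨fun v => ?_, fun v w => ?_, fun v => ?_⟩, fun v => rfl⟩
  · exact (Subtype.ext_iff (a1 := (v.1 : Vertex d))).trans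
      (Subtype.ext_iff (a1 := ((φ v).1 : Vertex d₀)) (a2 := ⟨x, hx₀⟩)).symm
  · exact (parent_eq_iff (d := d) v.1 w.1).trans (parent_eq_iff (d := d₀) (φ v).1 (φ w).1).symm
  · exact (rank_eq d₀ (φ v).1).trans ((h2 _ (hto v.1 v.2)).symm.trans (rank_eq d v.1).symm)

theorem continuous_ordered : Continuous ordered := by
  refine continuous_generateFrom_iff.2 ?_
  rintro _ ⟨r, S, rfl⟩
  refine isOpen_iff_mem_nhds.2 fun d₀ hd₀ => ?_
  obtain ⟨ψ, hψ⟩ := EFTStar.mk_mem_basicOpen.1 hd₀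
  filter_upwards [eventually_ballIso (d₀ := d₀) (x := (0, [])) trivial r] with d hd
  obtain ⟨φ, hφ, -⟩ := hd trivial
  exact EFTStar.mk_mem_basicOpen.2 ⟨φ.trans ψ, hφ.trans hψ⟩

/-- The doubly rooted tree with roots at given addresses. -/
def birooted (x y : ℕ × List ℕ) (d : {d : Sample // IsVertex d x.1 x.2 ∧ IsVertex d y.1 y.2}) :
    EFTStarStar ℕ := .mk ((tree d.1).withRoots ⟨x, d.2.1⟩ ⟨y, d.2.2⟩)

theorem continuous_birooted (x y : ℕ × List ℕ) : Continuous (birooted x y) := by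
  refine continuous_generateFrom_iff.2 ?_
  rintro _ ⟨r, S, rfl⟩
  refine isOpen_iff_mem_nhds.2 fun d₀ hd₀ => ?_
  obtain ⟨ψ, hψ, h, h'⟩ := EFTStarStar.mk_mem_basicOpen.1 hd₀
  filter_upwards [continuous_subtype_val.continuousAt.eventually
    (eventually_ballIso (d₀ := d₀.1) d₀.2.1 r), continuous_subtype_val.continuousAt.eventually
    (eventually_ballAddr (d₀ := d₀.1) d₀.2.1 r)] with d hd hball
  obtain ⟨φ, hφ, hval⟩ := hd d.2.1
  refine EFTStarStar.mk_mem_basicOpen.2 ⟨φ.trans ψ, hφ.trans hψ, ?_, ?_⟩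
  · refine (mem_ball_iff d.2.1 r ⟨y, d.2.2⟩).2 ?_
    rw [hball]
    exact (mem_ball_iff d₀.2.1 r ⟨y, d₀.2.2⟩).1 h
  · rw [← h']
    refine congrArg (fun z => (ψ z : S.V)) ?_
    exact Subtype.ext (Subtype.ext (hval _))

/-- The supremum over a proposition extends the function by 0 to the samples for which the addresses
are not vertices. -/
theorem measurable_birooted {g : EFTStarStar ℕ → ℝ≥0∞} (hg : Measurable g) (x y : ℕ × List ℕ) :
    Measurable fun d : Sample =>
      ⨆ h : IsVertex d x.1 x.2 ∧ IsVertex d y.1 y.2, g (birooted x y ⟨d, h⟩) := by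
  classical
  have hs : MeasurableSet {d : Sample | IsVertex d x.1 x.2 ∧ IsVertex d y.1 y.2} :=
    (measurableSet_isVertex _ _).inter (measurableSet_isVertex _ _)
  have h1 : Measurable fun d : {d : Sample | IsVertex d x.1 x.2 ∧ IsVertex d y.1 y.2} =>
      g (birooted x y d) := hg.comp (continuous_birooted x y).measurable
  convert! Measurable.dite h1 (measurable_const (a := (0 : ℝ≥0∞))) hs using 2 with d
  by_cases h : IsVertex d x.1 x.2 ∧ IsVertex d y.1 y.2
  · rw [iSup_pos h]
    split_ifs with h'
    · rfl
    · exact absurd h h'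
  · rw [iSup_neg h]
    split_ifs with h'
    · exact absurd h' h
    · rfl

end EGW

namespace EGW

/-! ### Changing the root to its parent -/

/-- The address of a vertex before the root is moved to its parent, in terms of the address
afterwards; `j` is the position of the former root. -/
def oldAddr (j : ℕ) : ℕ × List ℕ → ℕ × List ℕ
  | (0, w) => if w.getLast? = some j then (0, w.dropLast) else (1, w)
  | (i + 1, w) => (i + 2, w)

/-- The address of a vertex after the root has been moved to its parent. -/
def newAddr (j : ℕ) : ℕ × List ℕ → ℕ × List ℕ
  | (0, w) => (0, w ++ [j])
  | (1, w) => (0, w)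
  | (i + 2, w) => (i + 1, w)

lemma oldAddr_snoc_self (j : ℕ) (w : List ℕ) : oldAddr j (0, w ++ [j]) = (0, w) := by
  simp [oldAddr]

lemma oldAddr_snoc_of_ne {j l : ℕ} (h : l ≠ j) (w : List ℕ) :
    oldAddr j (0, w ++ [l]) = (1, w ++ [l]) := by
  simp [oldAddr, h]

lemma newAddr_oldAddr (j : ℕ) (x : ℕ × List ℕ) : newAddr j (oldAddr j x) = x := by
  obtain ⟨i, w⟩ := x
  rcases i with - | i
  · rcases List.eq_nil_or_concat w with rfl | ⟨v, l, rfl⟩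
    · simp [oldAddr, newAddr]
    · rw [List.concat_eq_append]
      by_cases h : l = j
      · subst h
        rw [oldAddr_snoc_self]
        rfl
      · rw [oldAddr_snoc_of_ne h]
        rfl
  · rfl

lemma oldAddr_injective (j : ℕ) : Function.Injective (oldAddr j) :=
  Function.LeftInverse.injective (newAddr_oldAddr j)

lemma parentAddr_newAddr (j : ℕ) (x : ℕ × List ℕ) :
    parentAddr (newAddr j x) = newAddr j (parentAddr x) := by
  obtain ⟨i, w⟩ := x
  rcases i with - | - | i <;> cases w <;> rfl

/-- The ingredients of the tree rooted at `o₁` if `c` are the ingredients at `o₁`. -/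
def rerootWith (c : Σ k, Fin k) (d : Sample) : Sample :=
  -- `oldAddr` sends `(0, [])` to `(1, [])`, whose offspring number was idle because the spine
  -- ingredient took its place; that ingredient's number of children is written there.
  (fun i => d.1 (i + 1), Function.update (fun x => d.2 (oldAddr c.2 x)) (0, []) c.1)

/-- The ingredients of the tree rooted at `o₁`. -/
def reroot (d : Sample) : Sample := rerootWith (d.1 0) d

/-- The new bush of index 0 joins two old ones at o₁: its child in the slot of the former root
carries the old bush 0, the other children the old bush 1. -/
lemma isVertex_reroot (d : Sample) (x : ℕ × List ℕ) : IsVertex (reroot d) x.1 x.2 ↔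
    IsVertex d (oldAddr (d.1 0).2 x).1 (oldAddr (d.1 0).2 x).2 := by
  obtain ⟨i, w⟩ := x
  rcases i with - | i
  · rcases List.eq_nil_or_concat w with rfl | ⟨v, l, rfl⟩
    · simp [oldAddr, IsVertex]
    · rw [List.concat_eq_append, isVertex_zero, isGW_snoc]
      have h1 : bush (reroot d) 0 [] = (d.1 0).1 := by simp [bush, reroot, rerootWith]
      have h2 : sub (bush (reroot d) 0) l = fun u => d.2 (oldAddr (d.1 0).2 (0, u ++ [l])) := by
        funext u
        simp [sub, bush, reroot, rerootWith, Function.update_of_ne]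
      rw [h1, h2]
      by_cases h : l = (d.1 0).2
      · subst h
        simp_rw [oldAddr_snoc_self]
        rw [isVertex_zero, and_iff_right (d.1 0).2.2]
        rfl
      · simp_rw [oldAddr_snoc_of_ne h]
        rw [isVertex_succ_snoc, and_iff_left h]
        rfl
  · change IsVertex (reroot d) (i + 1) w ↔ IsVertex d (i + 2) w
    induction w with
    | nil => exact Iff.rfl
    | cons l w ih =>
      simp only [IsVertex, ih]
      cases w <;> simp [numChildren, IsSpineSlot, reroot, rerootWith, oldAddr]

lemma oldAddr_newAddr {d : Sample} {x : ℕ × List ℕ} (hx : IsVertex d x.1 x.2) :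
    oldAddr (d.1 0).2 (newAddr (d.1 0).2 x) = x := by
  obtain ⟨i, w⟩ := x
  rcases i with - | - | i
  · exact oldAddr_snoc_self _ _
  · rcases List.eq_nil_or_concat w with rfl | ⟨v, l, rfl⟩
    · simp [oldAddr, newAddr]
    · rw [List.concat_eq_append] at *
      exact oldAddr_snoc_of_ne ((isVertex_succ_snoc d 0 v l).1 hx).1.2 v
  · rfl

/-- The identification of the vertices when the root is moved to its parent. -/
def rerootEquiv (d : Sample) : Vertex d ≃ Vertex (reroot d) where
  toFun v := ⟨newAddr (d.1 0).2 v.1, (isVertex_reroot d _).2 (by rw [oldAddr_newAddr v.2]; exact v.2)⟩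
  invFun v := ⟨oldAddr (d.1 0).2 v.1, (isVertex_reroot d _).1 v.2⟩
  left_inv v := Subtype.ext (oldAddr_newAddr v.2)
  right_inv v := Subtype.ext (newAddr_oldAddr _ _)

lemma rerootEquiv_parent (d : Sample) (v : Vertex d) :
    rerootEquiv d (parent d v) = parent (reroot d) (rerootEquiv d v) := by
  refine Subtype.ext ?_
  rw [parent_val]
  change newAddr _ (parent d v).1 = parentAddr (newAddr _ v.1)
  rw [parent_val, parentAddr_newAddr]

lemma isIso_rerootEquiv (d : Sample) :
    EFT.IsIso (T := tree d) (S := tree (reroot d)) (rerootEquiv d) where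
  parent := rerootEquiv_parent d
  mark v := by
    refine (rank_eq (reroot d) _).trans (Eq.trans ?_ (rank_eq d v).symm)
    change rankAddr (reroot d) (newAddr _ (Subtype.val (show Vertex d from v))) = _
    obtain ⟨⟨i, w⟩, h⟩ := v
    rcases i with - | - | i <;> cases w <;> rfl

lemma iterate_rerootEquiv (d : Sample) (n : ℕ) (v : Vertex d) :
    (parent (reroot d))^[n] (rerootEquiv d v) = rerootEquiv d ((parent d)^[n] v) := by
  induction n with
  | zero => rfl
  | succ n ih => rw [Function.iterate_succ_apply', Function.iterate_succ_apply', ih,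
      rerootEquiv_parent]

/-! ### The law of the rerooted tree -/

variable {π : PMF ℕ} (h0 : mean π ≠ 0) (htop : mean π ≠ ∞)

lemma measurable_rerootWith (c : Σ k, Fin k) : Measurable (rerootWith c) := by
  unfold rerootWith
  refine Measurable.prodMk (by fun_prop) (measurable_pi_lambda _ fun x => ?_)
  by_cases h : x = (0, [])
  · subst h; simp
  · simp only [Function.update_of_ne h]; fun_prop

/-- Both sides equal ∑_k π_k ∑_{j<k} R(k, j). On the left, (k, j) has weight π_k / m with m = 1; on
the right, π_k is the law of the root's offspring number and j runs over its children. -/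
theorem lintegral_reroot (hm : mean π = 1) {G : Sample → ℕ → ℝ≥0∞}
    (hG : ∀ j, Measurable fun d => G d j) :
    ∫⁻ d, G (reroot d) (d.1 0).2 ∂sampleLaw π h0 htop =
      ∫⁻ d, ∑' j : ℕ, (if j < d.2 (0, []) then G d j else 0) ∂sampleLaw π h0 htop := by
  set ν := Measure.infinitePi fun _ : ℕ => (spineLaw π h0 htop).toMeasure
  set ρ := Measure.infinitePi fun _ : ℕ × List ℕ => π.toMeasure
  have hup (k : ℕ) : Measurable fun y : ℕ × List ℕ → ℕ => Function.update y (0, []) k :=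
    measurable_pi_lambda _ fun x => by
      by_cases h : x = (0, [])
      · subst h; simp
      · simp only [Function.update_of_ne h]; fun_prop
  -- The mean of `G` at j when the root is forced to have k children.
  let R : ℕ → ℕ → ℝ≥0∞ := fun k j => ∫⁻ a, ∫⁻ y, G (a, Function.update y (0, []) k) j ∂ρ ∂ν
  have hGu (k j : ℕ) : Measurable fun p : (ℕ → Σ k, Fin k) × (ℕ × List ℕ → ℕ) =>
      G (p.1, Function.update p.2 (0, []) k) j :=
    (hG j).comp (measurable_fst.prodMk ((hup k).comp measurable_snd))
  have hf : Measurable fun p : Sample × (Σ k, Fin k) => G (rerootWith p.2 p.1) p.2.2 :=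
    measurable_from_prod_countable_left fun c => (hG c.2).comp (measurable_rerootWith c)
  have hf' : Measurable fun d : Sample => G (reroot d) (d.1 0).2 :=
    hf.comp (measurable_id.prodMk (by fun_prop : Measurable fun d : Sample => d.1 0))
  have hL : ∫⁻ d, G (reroot d) (d.1 0).2 ∂sampleLaw π h0 htop =
      ∑' k, π k * ∑ j : Fin k, R k j := by
    unfold sampleLaw
    rw [lintegral_prod _ hf'.aemeasurable,
      Measure.lintegral_infinitePi_update _ 0 (Measurable.lintegral_prod_right' hf'),
      lintegral_countable']
    have hc (c : Σ k, Fin k) : ∫⁻ a, ∫⁻ y, G (reroot (Function.update a 0 c, y))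
        (((Function.update a 0 c, y) : Sample).1 0).2 ∂ρ ∂ν = R c.1 c.2 := by
      have h1 (a : ℕ → Σ k, Fin k) (y : ℕ × List ℕ → ℕ) :
          G (reroot (Function.update a 0 c, y)) (((Function.update a 0 c, y) : Sample).1 0).2 =
          G (fun i => a (i + 1), Function.update (fun x => y (oldAddr c.2 x)) (0, []) c.1) c.2 := by
        simp only [reroot, rerootWith, Function.update_self, Function.update_of_ne, ne_eq,
          Nat.add_eq_zero_iff, one_ne_zero, and_false, not_false_eq_true]
        rw [Function.update_self]
      simp_rw [h1]
      have h2 (a : ℕ → Σ k, Fin k) :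
          ∫⁻ y, G (fun i => a (i + 1), Function.update (fun x => y (oldAddr c.2 x)) (0, []) c.1) c.2 ∂ρ =
          ∫⁻ y, G (fun i => a (i + 1), Function.update y (0, []) c.1) c.2 ∂ρ :=
        Measure.lintegral_infinitePi_comp π.toMeasure (oldAddr_injective c.2)
          (F := fun y => G (fun i => a (i + 1), Function.update y (0, []) c.1) c.2)
          ((hGu c.1 c.2).comp measurable_prodMk_left)
      simp_rw [h2]
      exact Measure.lintegral_infinitePi_comp (spineLaw π h0 htop).toMeasure
        (f := fun i => i + 1) (add_left_injective 1)
        (F := fun a => ∫⁻ y, G (a, Function.update y (0, []) c.1) c.2 ∂ρ)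
        (Measurable.lintegral_prod_right' (hGu c.1 c.2))
    refine (tsum_congr fun c => ?_).trans ((tsum_spineLaw_mul h0 htop fun c => R c.1 c.2).trans ?_)
    · rw [(spineLaw π h0 htop).toMeasure_apply_singleton _ .of_discrete, mul_comm]
      exact congrArg _ (hc c)
    · simp [hm]
  have hmR : Measurable fun d : Sample => ∑' j : ℕ, (if j < d.2 (0, []) then G d j else 0) := by
    refine Measurable.tsum fun j => Measurable.ite ?_ (hG j) measurable_const
    exact measurableSet_lt measurable_const (by fun_prop)
  rw [hL]
  unfold sampleLaw
  rw [lintegral_prod _ hmR.aemeasurable]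
  have hin (a : ℕ → Σ k, Fin k) :
      ∫⁻ y, ∑' j : ℕ, (if j < y (0, []) then G (a, y) j else 0) ∂ρ =
      ∑' k, ∑ j : Fin k, (∫⁻ y, G (a, Function.update y (0, []) k) j ∂ρ) * π k := by
    refine (Measure.lintegral_infinitePi_update π.toMeasure (0, [])
      (hmR.comp (measurable_prodMk_left (x := a)))).trans ?_
    rw [lintegral_countable']
    refine tsum_congr fun k => ?_
    rw [π.toMeasure_apply_singleton _ .of_discrete, ← Finset.sum_mul]
    congr 1
    have h3 (y : ℕ × List ℕ → ℕ) : ((fun d : Sample => ∑' j : ℕ, if j < d.2 (0, []) then G d j else 0) ∘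
        Prod.mk a) (Function.update y (0, []) k) = ∑ j : Fin k, G (a, Function.update y (0, []) k) j := by
      change ∑' j : ℕ, (if j < Function.update y (0, []) k (0, []) then
        G (a, Function.update y (0, []) k) j else 0) =
        ∑ j : Fin k, G (a, Function.update y (0, []) k) j
      rw [Function.update_self, tsum_eq_sum (s := Finset.range k), ← Fin.sum_univ_eq_sum_range
        (fun j => if j < k then G (a, Function.update y (0, []) k) j else 0)]
      · exact Finset.sum_congr rfl fun j _ => if_pos j.2
      · intro j hj
        exact if_neg fun h => hj (Finset.mem_range.2 h)
    simp_rw [h3]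
    exact lintegral_finsetSum _ fun j _ => (hGu k j).comp measurable_prodMk_left
  refine Eq.trans ?_ (lintegral_congr fun a => (hin a).symm)
  have hm1 (k j : ℕ) : Measurable fun a : ℕ → Σ k, Fin k =>
      (∫⁻ y, G (a, Function.update y (0, []) k) j ∂ρ) * π k :=
    (Measurable.lintegral_prod_right' (hGu k j)).mul_const _
  rw [lintegral_tsum (f := fun k a => ∑ j : Fin k,
    (∫⁻ y, G (a, Function.update y (0, []) k) j ∂ρ) * π k)
    fun k => (Finset.measurable_sum Finset.univ fun (j : Fin k) _ => hm1 k j).aemeasurable]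
  refine tsum_congr fun k => ?_
  rw [lintegral_finsetSum _ fun (j : Fin k) _ => hm1 k j, Finset.mul_sum]
  refine Finset.sum_congr rfl fun j _ => ?_
  rw [lintegral_mul_const _ (Measurable.lintegral_prod_right' (hGu k j)), mul_comm]

/-! ### Mass transport -/

/-- A function of a vertex of the tree which does not depend on the choice of the root. -/
structure IsInvariant (H : ∀ d, Vertex d → ℝ≥0∞) : Prop where
  measurable : ∀ x : ℕ × List ℕ, Measurable fun d => ⨆ h : IsVertex d x.1 x.2, H d ⟨x, h⟩
  reroot : ∀ d v, H (reroot d) (rerootEquiv d v) = H d v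

/-- A function of two vertices of the tree which does not depend on the choice of the root. -/
structure IsInvariant₂ (k : ∀ d, Vertex d → Vertex d → ℝ≥0∞) : Prop where
  measurable : ∀ x y : ℕ × List ℕ, Measurable fun d =>
    ⨆ h : IsVertex d x.1 x.2 ∧ IsVertex d y.1 y.2, k d ⟨x, h.1⟩ ⟨y, h.2⟩
  reroot : ∀ d u v, k (reroot d) (rerootEquiv d u) (rerootEquiv d v) = k d u v

/-- A relation of vertices of the tree which does not depend on the choice of the root. -/
structure IsInvariantRel (R : ∀ d, Vertex d → Vertex d → Prop) : Prop where
  addr : ∃ r : ℕ × List ℕ → ℕ × List ℕ → Prop, ∀ d u v, R d u v ↔ r u.1 v.1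
  reroot : ∀ d u v, R (reroot d) (rerootEquiv d u) (rerootEquiv d v) ↔ R d u v

/-- The sum of `k u v` over the vertices `v` related to `u`. -/
def relSum (R : ∀ d, Vertex d → Vertex d → Prop) (k : ∀ d, Vertex d → Vertex d → ℝ≥0∞)
    (d : Sample) (u : Vertex d) : ℝ≥0∞ := ∑' v, ⨆ _ : R d u v, k d u v

lemma tsum_vertex {d : Sample} (f : Vertex d → ℝ≥0∞) :
    ∑' v, f v = ∑' y : ℕ × List ℕ, ⨆ h : IsVertex d y.1 y.2, f ⟨y, h⟩ := by
  refine Eq.trans ?_ (Function.Injective.tsum_eq (g := fun v : Vertex d => v.1)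
    Subtype.val_injective (f := fun y => ⨆ h : IsVertex d y.1 y.2, f ⟨y, h⟩) ?_)
  · exact tsum_congr fun v => (iSup_pos (f := fun h => f ⟨v.1, h⟩) v.2).symm
  · intro y hy
    by_cases h : IsVertex d y.1 y.2
    · exact ⟨⟨y, h⟩, rfl⟩
    · exact absurd (iSup_neg h) hy

lemma iSup_tsum {α : Type*} (p : Prop) (f : α → ℝ≥0∞) : ⨆ _ : p, ∑' v, f v = ∑' v, ⨆ _ : p, f v := by
  by_cases h : p <;> simp [h]

lemma iSup_iSup_congr_prop {p q p' q' : Prop} (c : ℝ≥0∞) (h : p ∧ q ↔ p' ∧ q') :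
    ⨆ _ : p, ⨆ _ : q, c = ⨆ _ : p', ⨆ _ : q', c := by
  by_cases hp : p <;> by_cases hq : q <;> by_cases hp' : p' <;> by_cases hq' : q' <;> simp_all

/-- Since the relation is decided by the addresses, the sum is over countably many addresses with
measurable terms. -/
theorem IsInvariant₂.relSum {k : ∀ d, Vertex d → Vertex d → ℝ≥0∞} (hk : IsInvariant₂ k)
    {R : ∀ d, Vertex d → Vertex d → Prop} (hR : IsInvariantRel R) : IsInvariant (relSum R k) where
  measurable x := by
    obtain ⟨r, hr⟩ := hR.addr
    have : (fun d => ⨆ h : IsVertex d x.1 x.2, EGW.relSum R k d ⟨x, h⟩) = fun d =>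
        ∑' y : ℕ × List ℕ, ⨆ _ : r x y,
          ⨆ h : IsVertex d x.1 x.2 ∧ IsVertex d y.1 y.2, k d ⟨x, h.1⟩ ⟨y, h.2⟩ := by
      funext d
      by_cases hx : IsVertex d x.1 x.2
      · rw [iSup_pos hx]
        refine (tsum_vertex _).trans (tsum_congr fun y => ?_)
        by_cases hy : IsVertex d y.1 y.2
        · rw [iSup_pos hy, iSup_congr_Prop (hr d ⟨x, hx⟩ ⟨y, hy⟩) fun _ => rfl]
          exact iSup_congr fun _ => (iSup_pos (f := fun h : IsVertex d x.1 x.2 ∧ IsVertex d y.1 y.2 =>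
            k d ⟨x, h.1⟩ ⟨y, h.2⟩) ⟨hx, hy⟩).symm
        · rw [iSup_neg hy]
          simp [hy]
      · simp [hx]
    rw [this]
    refine Measurable.tsum fun y => ?_
    by_cases h : r x y
    · simp only [h, iSup_pos]
      exact hk.measurable x y
    · simp only [h, iSup_false]
      exact measurable_const
  reroot d u := by
    refine ((rerootEquiv d).tsum_eq _).symm.trans (tsum_congr fun v => ?_)
    rw [hk.reroot]
    exact iSup_congr_Prop (hR.reroot d u v) fun _ => rfl

lemma IsInvariant.right {H : ∀ d, Vertex d → ℝ≥0∞} (hH : IsInvariant H) :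
    IsInvariant₂ fun d _ v => H d v where
  measurable x y := by
    have h : (fun d => ⨆ _ : IsVertex d x.1 x.2 ∧ IsVertex d y.1 y.2, H d ⟨y, by tauto⟩) =
        {d | IsVertex d x.1 x.2}.indicator fun d => ⨆ h : IsVertex d y.1 y.2, H d ⟨y, h⟩ := by
      funext d
      by_cases hx : IsVertex d x.1 x.2
      · rw [indicator_of_mem (show d ∈ {d | IsVertex d x.1 x.2} from hx)]
        by_cases hy : IsVertex d y.1 y.2
        · rw [iSup_pos hy, iSup_pos ⟨hx, hy⟩]
        · rw [iSup_neg hy, iSup_neg fun h => hy h.2]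
      · rw [indicator_of_notMem (show d ∉ {d | IsVertex d x.1 x.2} from hx), iSup_neg fun h => hx h.1]
        rfl
    rw [h]
    exact (hH.measurable y).indicator (measurableSet_isVertex _ _)
  reroot d _ v := hH.reroot d v

lemma parent_iterate_val (d : Sample) (n : ℕ) (v : Vertex d) :
    ((parent d)^[n] v).1 = parentAddr^[n] v.1 := by
  induction n with
  | zero => rfl
  | succ n ih => rw [Function.iterate_succ_apply', Function.iterate_succ_apply', parent_val, ih]

lemma iterate_eq_iff {d : Sample} (i n : ℕ) (u v : Vertex d) :
    (parent d)^[i] u = (parent d)^[n] v ↔ parentAddr^[i] u.1 = parentAddr^[n] v.1 := by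
  rw [← parent_iterate_val d i u, ← parent_iterate_val d n v]
  exact Subtype.ext_iff

/-- `v` is a descendant of `u`, `n` generations later. -/
def IsDesc (n : ℕ) (d : Sample) (u v : Vertex d) : Prop := (parent d)^[n] v = u

lemma isInvariantRel_isDesc (n : ℕ) : IsInvariantRel (IsDesc n) where
  addr := ⟨fun x y => parentAddr^[n] y = x, fun _ u v => iterate_eq_iff n 0 v u⟩
  reroot d u v := by
    unfold IsDesc
    rw [iterate_rerootEquiv, (rerootEquiv d).apply_eq_iff_eq]

/-- The youngest common ancestor of `u` and `v` is `i` generations older than `u` and `n`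
generations older than `v`. -/
def Meet (i n : ℕ) (d : Sample) (u v : Vertex d) : Prop :=
  (parent d)^[i] u = (parent d)^[n] v ∧
    ∀ i' n', (parent d)^[i'] u = (parent d)^[n'] v → i ≤ i' ∧ n ≤ n'

lemma isInvariantRel_meet (i n : ℕ) : IsInvariantRel (Meet i n) where
  addr := ⟨fun x y => parentAddr^[i] x = parentAddr^[n] y ∧
    ∀ i' n', parentAddr^[i'] x = parentAddr^[n'] y → i ≤ i' ∧ n ≤ n', fun d u v => by
      simp only [Meet, iterate_eq_iff]⟩
  reroot d u v := by
    unfold Meet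
    simp_rw [iterate_rerootEquiv, (rerootEquiv d).apply_eq_iff_eq]

lemma Meet.symm {i n : ℕ} {d : Sample} {u v : Vertex d} (h : Meet i n d u v) : Meet n i d v u :=
  ⟨h.1.symm, fun i' n' h' => (h.2 n' i' h'.symm).symm⟩

lemma meet_unique {i n i' n' : ℕ} {d : Sample} {u v : Vertex d} (h : Meet i n d u v)
    (h' : Meet i' n' d u v) : i = i' ∧ n = n' := by
  have h1 := h.2 _ _ h'.1
  have h2 := h'.2 _ _ h.1
  omega

/-- Take the least possible i; levels force the difference between i and n, so n is least as well.
-/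
lemma exists_meet {d : Sample} (u v : Vertex d) : ∃ i n, Meet i n d u v := by
  classical
  have hex : ∃ i n, (parent d)^[i] u = (parent d)^[n] v := (tree d).confluent u v
  have hlev (i n : ℕ) (h : (parent d)^[i] u = (parent d)^[n] v) :
      level d u + i = level d v + n := by
    rw [← level_iterate, ← level_iterate, h]
  obtain ⟨n, hn⟩ := Nat.find_spec hex
  refine ⟨Nat.find hex, n, hn, fun i' n' h => ?_⟩
  have h1 := Nat.find_min' hex ⟨n', h⟩
  have h2 := hlev _ _ hn
  have h3 := hlev _ _ h
  omega

lemma tsum_meet {d : Sample} (u v : Vertex d) (c : ℝ≥0∞) :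
    ∑' i, ∑' n, ⨆ _ : Meet i n d u v, c = c := by
  obtain ⟨i, n, h⟩ := exists_meet u v
  rw [tsum_eq_single i, tsum_eq_single n, iSup_pos h]
  · exact fun n' hn' => iSup_neg fun h' => hn' (meet_unique h h').2.symm
  · intro i' hi'
    rw [ENNReal.tsum_eq_zero]
    exact fun n' => iSup_neg fun h' => hi' (meet_unique h h').1.symm

lemma IsInvariant.measurable_root {H : ∀ d, Vertex d → ℝ≥0∞} (hH : IsInvariant H) :
    Measurable fun d => H d (spine d 0) := by
  have h : (fun d => H d (spine d 0)) = fun d => ⨆ h : IsVertex d 0 [], H d ⟨(0, []), h⟩ :=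
    funext fun d => (iSup_pos (f := fun h => H d ⟨(0, []), h⟩) trivial).symm
  rw [h]
  exact hH.measurable (0, [])

/-- Seen from its parent, the former root is the child in slot `(d.1 0).2`; apply `lintegral_reroot`
to the value of `H` at child j of the root. -/
theorem lintegral_root_eq_children (hm : mean π = 1) {H : ∀ d, Vertex d → ℝ≥0∞}
    (hH : IsInvariant H) :
    ∫⁻ d, H d (spine d 0) ∂sampleLaw π h0 htop =
      ∫⁻ d, relSum (IsDesc 1) (fun d _ v => H d v) d (spine d 0) ∂sampleLaw π h0 htop := by
  let G : Sample → ℕ → ℝ≥0∞ := fun d j => ⨆ h : IsVertex d 0 [j], H d ⟨(0, [j]), h⟩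
  have hG := lintegral_reroot h0 htop hm (G := G) fun j => hH.measurable (0, [j])
  have hl (d : Sample) : G (reroot d) (d.1 0).2 = H d (spine d 0) := by
    rw [← hH.reroot d]
    exact iSup_pos (f := fun h => H (reroot d) ⟨(0, [((d.1 0).2 : ℕ)]), h⟩)
      (rerootEquiv d (spine d 0)).2
  simp_rw [hl] at hG
  rw [hG]
  refine lintegral_congr fun d => ?_
  have hv (j : ℕ) : IsVertex d 0 [j] ↔ j < d.2 (0, []) := by
    simp [IsVertex, numChildren, IsSpineSlot]
  rw [relSum, tsum_vertex]
  have hinj : Function.Injective fun j : ℕ => ((0, [j]) : ℕ × List ℕ) := fun j j' h => by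
    simpa using h
  rw [← hinj.tsum_eq]
  · refine tsum_congr fun j => ?_
    split_ifs with h
    · have h' := (hv j).2 h
      rw [iSup_pos (f := fun h : IsVertex d 0 [j] => ⨆ _ : IsDesc 1 d (spine d 0) ⟨(0, [j]), h⟩,
        H d ⟨(0, [j]), h⟩) h', iSup_pos (show IsDesc 1 d (spine d 0) ⟨(0, [j]), h'⟩ from rfl)]
      exact iSup_pos (f := fun h => H d ⟨(0, [j]), h⟩) h'
    · exact (iSup_neg fun h' => h ((hv j).1 h')).symm
  · rintro ⟨i, w⟩ hx
    by_contra hc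
    refine hx ?_
    by_cases h : IsVertex d i w
    swap
    · exact iSup_neg (f := fun h : IsVertex d i w => ⨆ _ : IsDesc 1 d (spine d 0) ⟨(i, w), h⟩,
        H d ⟨(i, w), h⟩) h
    refine (iSup_pos (f := fun h : IsVertex d i w => ⨆ _ : IsDesc 1 d (spine d 0) ⟨(i, w), h⟩,
      H d ⟨(i, w), h⟩) h).trans (iSup_neg fun hd => ?_)
    have h1 : parentAddr (i, w) = (0, []) := ((parent_eq_iff (d := d) ⟨(i, w), h⟩ (spine d 0)).1 hd)
    rcases w with - | ⟨j, w⟩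
    · simp [parentAddr] at h1
    · simp only [parentAddr, Prod.mk.injEq] at h1
      obtain ⟨rfl, rfl⟩ := h1
      exact hc ⟨j, rfl⟩

theorem lintegral_root_eq_desc (hm : mean π = 1) {H : ∀ d, Vertex d → ℝ≥0∞}
    (hH : IsInvariant H) (n : ℕ) :
    ∫⁻ d, H d (spine d 0) ∂sampleLaw π h0 htop =
      ∫⁻ d, relSum (IsDesc n) (fun d _ v => H d v) d (spine d 0) ∂sampleLaw π h0 htop := by
  induction n with
  | zero =>
    refine lintegral_congr fun d => ?_
    rw [relSum, tsum_eq_single (spine d 0)]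
    · exact (iSup_pos (f := fun _ : IsDesc 0 d (spine d 0) (spine d 0) => H d (spine d 0)) rfl).symm
    · exact fun v hv => iSup_neg fun h => hv h
  | succ n ih =>
    rw [ih, lintegral_root_eq_children h0 htop hm
      (hH.right.relSum (isInvariantRel_isDesc n))]
    refine lintegral_congr fun d => ?_
    simp only [relSum]
    simp_rw [iSup_tsum]
    rw [ENNReal.tsum_comm]
    refine tsum_congr fun v => ?_
    -- A descendant of order n + 1 is counted through exactly one child of the root, its own n-th
    -- ancestor.
    rw [tsum_eq_single ((parent d)^[n] v)]
    · have h1 : IsDesc 1 d (spine d 0) ((parent d)^[n] v) ↔ IsDesc (n + 1) d (spine d 0) v := by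
        unfold IsDesc
        rw [Function.iterate_succ_apply' (parent d) n]
        rfl
      rw [iSup_congr_Prop h1 fun _ => rfl]
      exact iSup_congr fun _ => iSup_pos rfl
    · intro u hu
      refine (iSup_congr fun _ => iSup_neg fun h => hu h.symm).trans iSup_bot

theorem mass_transport (hm : mean π = 1) {k : ∀ d, Vertex d → Vertex d → ℝ≥0∞}
    (hk : IsInvariant₂ k) (hk' : IsInvariant₂ fun d u v => k d v u) :
    ∫⁻ d, ∑' v, k d (spine d 0) v ∂sampleLaw π h0 htop =
      ∫⁻ d, ∑' v, k d v (spine d 0) ∂sampleLaw π h0 htop := by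
  have hsplit {k : ∀ d, Vertex d → Vertex d → ℝ≥0∞} (hk : IsInvariant₂ k) :
      ∫⁻ d, ∑' v, k d (spine d 0) v ∂sampleLaw π h0 htop =
        ∑' i, ∑' n, ∫⁻ d, relSum (Meet i n) k d (spine d 0) ∂sampleLaw π h0 htop := by
    have hmeas (i n : ℕ) := (hk.relSum (isInvariantRel_meet i n)).measurable_root
    rw [tsum_congr fun i => (lintegral_tsum fun n => (hmeas i n).aemeasurable).symm,
      ← lintegral_tsum fun i => (Measurable.tsum fun n => hmeas i n).aemeasurable]
    refine lintegral_congr fun d => ?_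
    refine (tsum_congr fun v => (tsum_meet (spine d 0) v (k d (spine d 0) v)).symm).trans ?_
    rw [ENNReal.tsum_comm]
    exact tsum_congr fun i => ENNReal.tsum_comm
  rw [hsplit hk, hsplit hk', ENNReal.tsum_comm]
  refine tsum_congr fun n => tsum_congr fun i => ?_
  -- On either side the root is moved up to the youngest common ancestor, i generations above u and
  -- n above v; both become the sum over pairs that meet at the root.
  rw [lintegral_root_eq_desc h0 htop hm (hk.relSum (isInvariantRel_meet i n)) i,
    lintegral_root_eq_desc h0 htop hm (hk'.relSum (isInvariantRel_meet n i)) n]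
  refine lintegral_congr fun d => ?_
  simp only [relSum]
  simp_rw [iSup_tsum]
  rw [ENNReal.tsum_comm]
  refine tsum_congr fun v => tsum_congr fun u => ?_
  refine iSup_iSup_congr_prop _ ⟨?_, ?_⟩
  · rintro ⟨h, h'⟩
    exact ⟨h'.1.symm.trans h, h'.symm⟩
  · rintro ⟨h, h'⟩
    exact ⟨h'.1.symm.trans h, h'.symm⟩

end EGW

namespace EGW

/-! ### Unimodularity -/

lemma mk_withRoots_reroot (d : Sample) (u v : Vertex d) :
    EFTStarStar.mk ((tree (reroot d)).withRoots (rerootEquiv d u) (rerootEquiv d v)) =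
      EFTStarStar.mk ((tree d).withRoots u v) :=
  Eq.symm <| Quotient.sound <| show ∃ φ : Vertex d ≃ Vertex (reroot d),
    EFT.IsIso (T := tree d) (S := tree (reroot d)) φ ∧ φ u = rerootEquiv d u ∧
      φ v = rerootEquiv d v from ⟨rerootEquiv d, isIso_rerootEquiv d, rfl, rfl⟩

lemma isInvariant₂_birooted {g : EFTStarStar ℕ → ℝ≥0∞} (hg : Measurable g) :
    IsInvariant₂ fun d u v => g (.mk ((tree d).withRoots u v)) where
  measurable x y := measurable_birooted hg x y
  reroot d u v := congrArg g (mk_withRoots_reroot d u v)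

lemma isInvariant₂_birooted_swap {g : EFTStarStar ℕ → ℝ≥0∞} (hg : Measurable g) :
    IsInvariant₂ fun d u v => g (.mk ((tree d).withRoots v u)) where
  measurable x y := by
    have h : (fun d => ⨆ h : IsVertex d x.1 x.2 ∧ IsVertex d y.1 y.2,
        g (.mk ((tree d).withRoots (show Vertex d from ⟨y, h.2⟩) (show Vertex d from ⟨x, h.1⟩)))) =
        fun d => ⨆ h : IsVertex d y.1 y.2 ∧ IsVertex d x.1 x.2, g (birooted y x ⟨d, h⟩) :=
      funext fun d => iSup_congr_Prop and_comm fun _ => rfl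
    exact h ▸ measurable_birooted hg y x
  reroot d u v := congrArg g (mk_withRoots_reroot d v u)

variable {π : PMF ℕ} (h0 : mean π ≠ 0) (htop : mean π ≠ ∞)

lemma IsInvariant₂.measurable_tsum_root {k : ∀ d, Vertex d → Vertex d → ℝ≥0∞}
    (hk : IsInvariant₂ k) : Measurable fun d => ∑' v, k d (spine d 0) v := by
  have hR : IsInvariantRel fun _ _ _ => True := ⟨⟨fun _ _ => True, fun _ _ _ => Iff.rfl⟩,
    fun _ _ _ => Iff.rfl⟩
  have h : (fun d => ∑' v, k d (spine d 0) v) =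
      fun d => EGW.relSum (fun _ _ _ => True) k d (spine d 0) :=
    funext fun d => tsum_congr fun v => (iSup_pos (f := fun _ : True => k d (spine d 0) v) trivial).symm
  exact h ▸ (hk.relSum hR).measurable_root

section Unimodular

variable {Ω : Type*} [MeasurableSpace Ω] {P : Measure Ω} {D : Ω → Sample}

theorem isUnimodular_ordered (hm : mean π = 1) (hD : Measurable D)
    (hlaw : P.map D = sampleLaw π h0 htop) : IsUnimodular P fun ω => ordered (D ω) where
  measurable := continuous_ordered.measurable.comp hD
  mass_transport g hg := by
    have h1 := isInvariant₂_birooted hg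
    have h2 := isInvariant₂_birooted_swap hg
    have h := mass_transport h0 htop hm h1 h2
    rw [← hlaw, lintegral_map h1.measurable_tsum_root hD,
      lintegral_map h2.measurable_tsum_root hD] at h
    exact h

theorem isUnimodular_unordered (hm : mean π = 1) (hD : Measurable D)
    (hlaw : P.map D = sampleLaw π h0 htop) : IsUnimodular P fun ω => unordered (D ω) where
  measurable := EFTStar.continuous_forget.measurable.comp (continuous_ordered.measurable.comp hD)
  mass_transport g hg := (isUnimodular_ordered h0 htop hm hD hlaw).mass_transport
    (g ∘ EFTStarStar.forget) (hg.comp EFTStarStar.continuous_forget.measurable)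

end Unimodular

/-! ### The classification -/

lemma forall_generation {d : Sample} {p : Set (Vertex d) → Prop}
    (h : ∀ k : ℤ, p {v | level d v = k}) (v : Vertex d) : p ((tree d).generation v) :=
  (congrArg p (generation_eq d v)).mpr (h _)

lemma not_hasYoungestGeneration {d : Sample} (h : ∀ k : ℤ, {v | level d v = k}.Infinite) :
    ¬ (tree d).HasYoungestGeneration :=
  (isLevel d).not_hasYoungestGeneration fun k => (h k).nonempty

lemma one_le_mean_of_apply_one (h1 : π 1 = 1) : 1 ≤ mean π :=
  le_trans (by simp [h1]) (ENNReal.le_tsum (f := fun k : ℕ => (k : ℝ≥0∞) * π k) 1)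

end EGW

end

/-! ### The three regimes together -/

theorem mainTheorem8
    (π : PMF ℕ) (h0 : EGW.mean π ≠ 0) (htop : EGW.mean π ≠ ∞)
    {Ω : Type*} [MeasurableSpace Ω] (P : Measure Ω) [IsProbabilityMeasure P]
    (D : Ω → EGW.Sample) (hD : Measurable D)
    (hlaw : P.map D = EGW.sampleLaw π h0 htop) :
    (EGW.mean π = 1 →
      IsUnimodular P (fun ω => EGW.ordered (D ω)) ∧
      IsUnimodular P (fun ω => EGW.unordered (D ω)) ∧
      (π 1 ≠ 1 → ∀ᵐ ω ∂P, (EGW.tree (D ω)).IsClassII ∧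
        ¬ (EGW.tree (D ω)).HasYoungestGeneration) ∧
      (π 1 = 1 → ∀ᵐ ω ∂P, (EGW.tree (D ω)).IsClassIF ∧
        ∀ v, (EGW.tree (D ω)).generation v = {v})) ∧
    (1 < EGW.mean π →
      (∀ᵐ ω ∂P, (∀ v, ((EGW.tree (D ω)).generation v).Infinite) ∧
        ¬ (EGW.tree (D ω)).HasYoungestGeneration) ∧
      0 < P {ω | ((EGW.tree (D ω)).descendants (EGW.root (D ω))).Infinite} ∧
      (∀ᵐ ω ∂P, ¬ (EGW.tree (D ω)).biInfinitePaths.Countable ∧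
        Uncountable (EGW.tree (D ω)).Ends)) ∧
    (EGW.mean π < 1 →
      (∀ᵐ ω ∂P, (∀ v, ((EGW.tree (D ω)).descendants v).Finite) ∧
        (EGW.tree (D ω)).OneEnded) ∧
      ((∀ᵐ ω ∂P, ∀ v, ((EGW.tree (D ω)).generation v).Finite) ↔
        Summable fun k : ℕ => (k : ℝ) * Real.log k * (π k).toReal) ∧
      ((∀ᵐ ω ∂P, ∀ v, ((EGW.tree (D ω)).generation v).Infinite) ↔
        ¬ Summable fun k : ℕ => (k : ℝ) * Real.log k * (π k).toReal) ∧
      (∫⁻ ω, (((EGW.tree (D ω)).generation (EGW.root (D ω))).encard : ℝ≥0∞) ∂P < ∞ ↔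
        evariance (fun k : ℕ => (k : ℝ)) π.toMeasure < ∞)) := by
  have transfer {p : EGW.Sample → Prop} (h : ∀ᵐ d ∂EGW.sampleLaw π h0 htop, p d) :
      ∀ᵐ ω ∂P, p (D ω) := ae_of_ae_map hD.aemeasurable (hlaw ▸ h)
  refine ⟨fun hm => ⟨EGW.isUnimodular_ordered h0 htop hm hD hlaw,
    EGW.isUnimodular_unordered h0 htop hm hD hlaw, fun h1 => ?_, fun h1 => ?_⟩,
    fun hm => ⟨?_, ?_, ?_⟩, fun hm => ?_⟩
  · filter_upwards [transfer (EGW.ae_finite_descendants h0 htop hm.le h1),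
      transfer (EGW.ae_infinite_level h0 htop
        (EGW.tsum_branchProb_of_mean_eq_one h0 htop hm h1))] with ω hfin hinf
    exact ⟨EFT.isClassII_of_finite_descendants (EGW.root (D ω)) hfin
      (EGW.forall_generation hinf), EGW.not_hasYoungestGeneration hinf⟩
  · filter_upwards [transfer (EGW.ae_forall_one h0 htop h1)] with ω h
    exact EGW.isClassIF_of_forall_one h.1 h.2
  · filter_upwards [transfer (EGW.ae_infinite_level h0 htop
      (EGW.tsum_branchProb_of_one_lt_mean h0 htop hm))] with ω hinf
    exact ⟨EGW.forall_generation hinf, EGW.not_hasYoungestGeneration hinf⟩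
  · have h1 : 0 < EGW.sampleLaw π h0 htop {d | EGW.Surv (EGW.bush d 0)} := by
      rw [EGW.sampleLaw_surv_root, pos_iff_ne_zero, ← measureReal_ne_zero_iff]
      exact (EGW.survProb_pos hm htop).ne'
    rw [← hlaw, Measure.map_apply hD
      (show MeasurableSet {d | EGW.Surv (EGW.bush d 0)} from
        EGW.measurable_bush 0 EGW.measurableSet_surv)] at h1
    -- An inclusion of events suffices, so the event of infinitely many descendants need not be
    -- shown measurable.
    exact h1.trans_le (measure_mono fun ω hω => EGW.infinite_descendants_root hω)
  · filter_upwards [transfer (EGW.ae_not_countable_descendingRays h0 htop hm)] with ω ⟨v, hv⟩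
    exact ⟨EFT.not_countable_biInfinitePaths hv, EFT.uncountable_ends hv⟩
  have h1 : π 1 ≠ 1 := fun h => hm.not_ge (EGW.one_le_mean_of_apply_one h)
  have hfin (hs : Summable fun k : ℕ => (k : ℝ) * Real.log k * (π k).toReal) :
      ∀ᵐ ω ∂P, ∀ v, ((EGW.tree (D ω)).generation v).Finite := by
    filter_upwards [transfer (EGW.ae_finite_level h0 htop
      (EGW.tsum_branchProb_ne_top_of_summable h0 htop hm hs))] with ω h
    exact EGW.forall_generation h
  have hinf (hs : ¬ Summable fun k : ℕ => (k : ℝ) * Real.log k * (π k).toReal) :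
      ∀ᵐ ω ∂P, ∀ v, ((EGW.tree (D ω)).generation v).Infinite := by
    filter_upwards [transfer (EGW.ae_infinite_level h0 htop (not_not.1 fun h =>
      hs (EGW.summable_of_tsum_branchProb_ne_top h0 htop hm h)))] with ω h
    exact EGW.forall_generation h
  -- Finite and infinite generations cannot both be almost sure under a probability measure; this
  -- turns the two implications above into equivalences.
  have hexcl (ha : ∀ᵐ ω ∂P, ∀ v, ((EGW.tree (D ω)).generation v).Finite)
      (hb : ∀ᵐ ω ∂P, ∀ v, ((EGW.tree (D ω)).generation v).Infinite) : False := by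
    obtain ⟨ω, hω, hω'⟩ := (ha.and hb).exists
    exact hω' (EGW.root (D ω)) (hω _)
  refine ⟨?_, ⟨fun h => by_contra fun hs => hexcl h (hinf hs), hfin⟩,
    ⟨fun h hs => hexcl (hfin hs) h, hinf⟩, ?_⟩
  · filter_upwards [transfer (EGW.ae_finite_descendants h0 htop hm.le h1)] with ω h
    exact ⟨h, EFT.oneEnded_of_finite_descendants (EGW.root (D ω)) h⟩
  · rw [← EGW.lintegral_encard_generation_lt_top_iff h0 htop hm, ← hlaw,
      lintegral_map EGW.measurable_encard_generation hD]
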